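/- **Definitions.** For a set $\mathcal L$ let $\mathbf W(\mathcal L)$ be the set of finite words in $\mathcal L$, with concatenation $\circ$. A *partial group* is a non-empty set $\mathcal L$ with a domain $\mathbf D\subseteq\mathbf W(\mathcal L)$, a product $\Pi:\mathbf D\to\mathcal L$ and an involutory bijection $x\mapsto x^{-1}$ of $\mathcal L$ such that: (1) $\mathbf D$ contains all words of length $1$, and $u\circ v\in\mathbf D$ implies $u,v\in\mathbf D$; (2) $\Pi(x)=x$ for $x\in\mathcal L$; (3) if $u\circ v\circ w\in\mathbf D$ then $u\circ(\Pi(v))\circ w\in\mathbf D$, with the same product; (4) if $w=(x_1,\dots,x_n)\in\mathbf D$ and $w^{-1}=(x_n^{-1},\dots,x_1^{-1})$, then $w^{-1}\circ w\in\mathbf D$ and $\Pi(w^{-1}\circ w)=\mathbf 1:=\Pi(\emptyset)$. A *homomorphism* $\beta:\mathcal L\to\mathcal L'$ is a map whose induced map $\beta^*$ on words sends $\mathbf D$ into $\mathbf D'$ and satisfies $\beta(\Pi(w))=\Pi'(\beta^*(w))$ for $w\in\mathbf D$; $\mathrm{Ker}(\beta)=\{g\mid \beta(g)=\mathbf 1'\}$.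 Write $x^g=\Pi(g^{-1},x,g)$ when $(g^{-1},x,g)\in\mathbf D$; "$X^g=Y$" means that $x^g$ is defined for all $x\in X$ and $Y=\{x^g\mid x\in X\}$. A *partial subgroup* is a non-empty subset closed under inversion and under all defined products; it is a *subgroup* if moreover all words in it lie in $\mathbf D$. A partial subgroup $\mathcal N$ is a *partial normal subgroup*, $\mathcal N\trianglelefteq\mathcal L$, if $x^g\in\mathcal N$ whenever $x\in\mathcal N$, $g\in\mathcal L$ and $x^g$ is defined. A *$p$-subgroup* is a subgroup all of whose elements have order a power of $p$. Let $\Delta$ be a set of subgroups of $\mathcal L$ and $S\in\Delta$ such that every member of $\Delta$ is contained in $S$. Then $(\mathcal L,\Delta,S)$ is a *pre-locality* if (O1) $(g_1,\dots,g_n)\in\mathbf D$ if and only if there are $X_0,\dots,X_n\in\Delta$ with $X_{i-1}^{g_i}=X_i$ for all $i$; and (O2) whenever $X,Y\in\Delta$, $g\in\mathcal L$ and $X^g$ is a subgroup of $Y$, every subgroup of $Y$ containing $X^g$ is in $\Delta$. For a word $w$ let $S_w$ be the set of those $x\in S$ that are conjugated successively into $S$ by the entries of $w$; for a subgroup $X$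 of $S$ let $X^\star$ be the intersection of all $S_w$ containing $X$, and let $\Omega_S(\mathcal L)$ be the poset of all the $X^\star$. A *locality at the prime $p$* is a pre-locality $(\mathcal L,\Delta,S)$ such that the lengths of the chains in $\Omega_S(\mathcal L)$ are bounded, $S$ is a $p$-group and is maximal among the $p$-subgroups of $\mathcal L$, and every subgroup of $\mathcal L$ is countable and locally finite; a *locality* is a locality at some prime. A *projection* from a locality $(\mathcal L,\Delta,S)$ to a locality $(\mathcal L',\Delta',S')$ is a homomorphism $\beta:\mathcal L\to\mathcal L'$ with $\beta^*(\mathbf D)=\mathbf D'$ and $\Delta'=\{\beta(P)\mid P\in\Delta\}$. A *coset* of $\mathcal N\trianglelefteq\mathcal L$ is a set $\mathcal Nf=\{\Pi(x,f)\mid x\in\mathcal N,\ (x,f)\in\mathbf D\}$ with $f\in\mathcal L$; it is *maximal* if it is not a proper subset of any coset of $\mathcal N$. Let $\mathcal L/\mathcal N$ be the set of maximal cosets of $\mathcal N$. **Corollary 5.5.** Let $(\mathcal L,\Delta,S)$ be a locality at the prime $p$. (a) Let $\mathcal N\trianglelefteq\mathcal L$ be a partial normal subgroup. Then each $g\in\mathcal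 L$ lies in exactly one maximal coset of $\mathcal N$; denote it by $\rho(g)$. There is a unique partial group structure on $\mathcal L/\mathcal N$ with domain $\rho^*(\mathbf D)$ such that $\rho:\mathcal L\to\mathcal L/\mathcal N$ is a homomorphism, and $\mathrm{Ker}(\rho)=\mathcal N$. With this structure, $(\mathcal L/\mathcal N,\ \{\rho(P)\mid P\in\Delta\},\ \rho(S))$ is a locality at $p$, and $\rho$ is a projection. (b) A subset $\mathcal N$ of $\mathcal L$ is a partial normal subgroup of $\mathcal L$ if and only if it is the kernel of a projection from $(\mathcal L,\Delta,S)$ to some locality. -/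

import Mathlib

universe u v

/-- A partial group on `L`: a set `D` of words (the domain), a product defined on the members of `D`
only, and an inversion. The empty word is required to lie in `D`; given the two conditions on `D`
that follow, this says exactly that `L` is non-empty. -/
structure PartialGroup (L : Type u) where
  D : Set (List L)
  prod : (w : List L) → w ∈ D → L
  inv : L → L
  nil_mem : [] ∈ D
  singleton_mem : ∀ x : L, [x] ∈ D
  of_append : ∀ u v : List L, u ++ v ∈ D → u ∈ D ∧ v ∈ D
  prod_singleton : ∀ x : L, prod [x] (singleton_mem x) = x
  prod_append : ∀ (u v w : List L) (h : u ++ v ++ w ∈ D) (hv : v ∈ D),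
    ∃ h' : u ++ [prod v hv] ++ w ∈ D, prod (u ++ v ++ w) h = prod (u ++ [prod v hv] ++ w) h'
  inv_inv : ∀ x : L, inv (inv x) = x
  inv_append : ∀ w : List L, w ∈ D →
    ∃ h : (w.map inv).reverse ++ w ∈ D, prod ((w.map inv).reverse ++ w) h = prod [] nil_mem

namespace PartialGroup

variable {L : Type u} {L' : Type v}

/-- The identity element, the product of the empty word. -/
def one (G : PartialGroup L) : L := G.prod [] G.nil_mem

/-- `x` can be conjugated by `g`, and `x ^ g = g⁻¹ x g` equals `y`. -/
def Conj (G : PartialGroup L) (g x y : L) : Prop :=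
  ∃ h : [G.inv g, x, g] ∈ G.D, G.prod [G.inv g, x, g] h = y

/-- `X ^ g = Y`: every element of `X` can be conjugated by `g`, and `Y` is the set of conjugates. -/
def SetConj (G : PartialGroup L) (X : Set L) (g : L) (Y : Set L) : Prop :=
  (∀ x ∈ X, [G.inv g, x, g] ∈ G.D) ∧ Y = {y | ∃ x ∈ X, G.Conj g x y}

/-- `H` is a partial subgroup. -/
structure IsPartialSubgroup (G : PartialGroup L) (H : Set L) : Prop where
  nonempty : H.Nonempty
  inv_mem : ∀ x ∈ H, G.inv x ∈ H
  prod_mem : ∀ (w : List L) (h : w ∈ G.D), (∀ x ∈ w, x ∈ H) → G.prod w h ∈ H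

/-- `N` is a partial normal subgroup. -/
structure IsPartialNormal (G : PartialGroup L) (N : Set L) : Prop
    extends IsPartialSubgroup G N where
  conj_mem : ∀ x ∈ N, ∀ g y : L, G.Conj g x y → y ∈ N

/-- `H` is a subgroup: a partial subgroup all of whose words lie in the domain. -/
structure IsSubgroup (G : PartialGroup L) (H : Set L) : Prop
    extends IsPartialSubgroup G H where
  mem_D : ∀ w : List L, (∀ x ∈ w, x ∈ H) → w ∈ G.D

/-- `H` is a `p`-subgroup: a subgroup in which every element has order a power of `p`. -/
def IsPSubgroup (p : ℕ) (G : PartialGroup L) (H : Set L) : Prop :=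
  G.IsSubgroup H ∧ ∀ x ∈ H, ∃ k : ℕ, ∃ h : List.replicate (p ^ k) x ∈ G.D,
    G.prod (List.replicate (p ^ k) x) h = G.one

/-- The subgroup `H` is locally finite: each finite subset lies in a finite subgroup of `H`. -/
def IsLocallyFinite (G : PartialGroup L) (H : Set L) : Prop :=
  ∀ F : Set L, F ⊆ H → F.Finite → ∃ K : Set L, G.IsSubgroup K ∧ K.Finite ∧ F ⊆ K ∧ K ⊆ H

/-- A homomorphism of partial groups. -/
def IsHom (G : PartialGroup L) (G' : PartialGroup L') (β : L → L') : Prop :=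
  ∀ (w : List L) (h : w ∈ G.D), ∃ h' : w.map β ∈ G'.D,
    β (G.prod w h) = G'.prod (w.map β) h'

/-- The kernel of a map into a partial group. -/
def ker (G' : PartialGroup L') (β : L → L') : Set L := {g | β g = G'.one}

/-- For a word `w = (g₁, …, gₙ)`: there are members `X = X₀, X₁, …, Xₙ` of `Δ` with
`Xᵢ₋₁ ^ gᵢ = Xᵢ` for all `i`. -/
def Via (G : PartialGroup L) (Δ : Set (Set L)) : Set L → List L → Prop
  | X, [] => X ∈ Δ
  | X, g :: w => X ∈ Δ ∧ ∃ Y, G.SetConj X g Y ∧ Via G Δ Y w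

/-- `(L, Δ)` is an objective partial group. -/
structure IsObjective (G : PartialGroup L) (Δ : Set (Set L)) : Prop where
  isSubgroup : ∀ X ∈ Δ, G.IsSubgroup X
  mem_D_iff : ∀ w : List L, w ∈ G.D ↔ ∃ X, G.Via Δ X w
  closed : ∀ X ∈ Δ, ∀ Y ∈ Δ, ∀ (g : L) (Z : Set L), G.SetConj X g Z → G.IsSubgroup Z → Z ⊆ Y →
    ∀ W : Set L, G.IsSubgroup W → Z ⊆ W → W ⊆ Y → W ∈ Δ

/-- `(L, Δ, S)` is a pre-locality. -/
structure IsPreLocality (G : PartialGroup L) (Δ : Set (Set L)) (S : Set L) : Prop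
    extends IsObjective G Δ where
  S_mem : S ∈ Δ
  subset_S : ∀ X ∈ Δ, X ⊆ S

/-- The set `S_w` of all `x ∈ S` that are conjugated successively into `S` by the entries of `w`. -/
def conjInto (G : PartialGroup L) (S : Set L) : List L → Set L
  | [] => S
  | g :: w => {x | x ∈ S ∧ ∃ y, G.Conj g x y ∧ y ∈ conjInto G S w}

/-- `X^⋆`, the intersection of all the sets `S_w` that contain `X`. -/
def star (G : PartialGroup L) (S X : Set L) : Set L :=
  ⋂ (w : List L) (_ : X ⊆ G.conjInto S w), G.conjInto S w

/-- `Ω_S(L)`, the set of all `X^⋆` for `X` a subgroup of `S`; it is ordered by inclusion. -/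
def Omega (G : PartialGroup L) (S : Set L) : Set (Set L) :=
  {Y | ∃ X : Set L, G.IsSubgroup X ∧ X ⊆ S ∧ Y = G.star S X}

/-- `(L, Δ, S)` is a locality at the prime `p`. Here `Order.krullDim` is the supremum of the lengths
`d` of the chains `X₀ < ⋯ < X_d`. -/
structure IsLocality (p : ℕ) (G : PartialGroup L) (Δ : Set (Set L)) (S : Set L) : Prop
    extends IsPreLocality G Δ S where
  prime : p.Prime
  finite_dim : Order.krullDim (G.Omega S) < ⊤
  isPSubgroup : G.IsPSubgroup p S
  maximal : ∀ R : Set L, G.IsPSubgroup p R → S ⊆ R → R = S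
  countable : ∀ H : Set L, G.IsSubgroup H → H.Countable
  locallyFinite : ∀ H : Set L, G.IsSubgroup H → G.IsLocallyFinite H

/-- A homomorphism `β` is a projection from `(L, Δ, S)` to `(L', Δ', S')` if it maps the domain of the
product onto the domain of the product, and `Δ` onto `Δ'`. -/
structure IsProjection (G : PartialGroup L) (Δ : Set (Set L)) (G' : PartialGroup L')
    (Δ' : Set (Set L')) (β : L → L') : Prop where
  isHom : G.IsHom G' β
  map_D : List.map β '' G.D = G'.D
  map_objects : Set.image β '' Δ = Δ'

/-- The coset `N f`, the set of all defined products `x f` with `x ∈ N`. -/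
def coset (G : PartialGroup L) (N : Set L) (f : L) : Set L :=
  {y | ∃ x ∈ N, ∃ h : [x, f] ∈ G.D, G.prod [x, f] h = y}

/-- `L / N`, the set of maximal cosets of `N`: those not properly contained in another coset. -/
def Quotient (G : PartialGroup L) (N : Set L) : Type u :=
  {X : Set L // Maximal (fun Y : Set L => ∃ f : L, Y = G.coset N f) X}

end PartialGroup

/-! Put T = S ∩ N. For x ∈ N and a ∈ S_x the conjugate a^x lies in aT, so N fixes the subgroups of S
above T: an object containing T that z ∈ N conjugates into S is normalized by z
(`mor_self_of_inter_subset`). Hence elements of N can be moved past any f that conjugates T into S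
(`exists_mul_eq_mul_left`).

The Frattini argument (`exists_eq_mul_of_subset_sg`) writes g = xf with x ∈ N and f normalizing T,
the factorization being valid on a given object inside S_g. It rests on Sylow's theorem
(`IsLocality.exists_conj_into`) for the product NS. Among the possible f, those are chosen for which
S_f cannot grow when f is changed by an element of N. Two elements that differ by an element of N on
one object above T have a common extension (`Agree.exists_extension`), so a maximal f dominates
everything it agrees with somewhere. This yields the splitting lemma S_{xf} ⊆ S_{(x,f)}
(`IsMaxRep.sg_mul_subset`); it follows that the maximal cosets are the Nf with f maximal, and that
they partition L.

Products of cosets are formed with maximal representatives: in a word of the domain the N-parts can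
be pushed to the front, so passing to representatives stays in the domain and changes the product
only by a left factor from N (`forall₂_isMaxRep`). The kernel is the coset of 1, which is N. For the
locality axioms the decisive fact is `IsMaxRep.mem_sg_of_proj`: s ∈ S lies in S_f once the image of
f conjugates the image of s into that of S. Preimages in S therefore carry objects and members of Ω
of the quotient to those of L, and subgroups lift because each normalizes an object
(`IsPreLocality.exists_subset_nz`). Conversely, kernels of homomorphisms are partial normal by
direct computation.

Subgroups may be infinite. Orders are replaced by the depth in Ω_S(L), which is bounded and
invariant under conjugation, and theorems on finite groups are applied inside finite subgroups
supplied by local finiteness. -/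

namespace PartialGroup

/-! ### Calculus of words, products and conjugates in a partial group. -/

section Basic

variable {L : Type u} (G : PartialGroup L)

open Classical in
/-- The product of a word, with the value `1` outside the domain. -/
noncomputable def pr (w : List L) : L := if h : w ∈ G.D then G.prod w h else G.one

/-- The product of two elements. -/
noncomputable def mul (a b : L) : L := G.pr [a, b]

/-- The conjugate `g⁻¹ x g`. -/
noncomputable def cj (g x : L) : L := G.pr [G.inv g, x, g]

lemma pr_eq {w : List L} (h : w ∈ G.D) : G.prod w h = G.pr w := by simp [pr, h]

lemma pr_nil : G.pr [] = G.one := (G.pr_eq G.nil_mem).symm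

lemma pr_singleton (x : L) : G.pr [x] = x := by
  rw [← G.pr_eq (G.singleton_mem x), G.prod_singleton]

lemma mem_left {u v : List L} (h : u ++ v ∈ G.D) : u ∈ G.D := (G.of_append u v h).1

lemma mem_right {u v : List L} (h : u ++ v ∈ G.D) : v ∈ G.D := (G.of_append u v h).2

lemma mem_mid (u v w : List L) (h : u ++ v ++ w ∈ G.D) : v ∈ G.D := G.mem_right (G.mem_left h)

lemma pr_mid (u v w : List L) (h : u ++ v ++ w ∈ G.D) :
    u ++ G.pr v :: w ∈ G.D ∧ G.pr (u ++ G.pr v :: w) = G.pr (u ++ v ++ w) := by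
  have hv := G.mem_mid u v w h
  obtain ⟨h', e⟩ := G.prod_append u v w h hv
  rw [G.pr_eq] at e
  simp only [G.pr_eq hv, List.append_assoc, List.singleton_append] at h' e
  rw [G.pr_eq h'] at e
  exact ⟨h', by simpa using e.symm⟩

lemma pr_append {u v : List L} (h : u ++ v ∈ G.D) :
    [G.pr u, G.pr v] ∈ G.D ∧ G.mul (G.pr u) (G.pr v) = G.pr (u ++ v) := by
  have h1 := G.pr_mid [] u v h
  have h2 := G.pr_mid [G.pr u] v [] (by simpa using h1.1)
  refine ⟨h2.1, h2.2.trans ?_⟩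
  simpa using h1.2

lemma pr_cons {a : L} {w : List L} (h : a :: w ∈ G.D) :
    [a, G.pr w] ∈ G.D ∧ G.mul a (G.pr w) = G.pr (a :: w) := by
  have := G.pr_append (u := [a]) (v := w) h
  rwa [G.pr_singleton] at this

lemma insert_one {u w : List L} (h : u ++ w ∈ G.D) :
    u ++ G.one :: w ∈ G.D ∧ G.pr (u ++ G.one :: w) = G.pr (u ++ w) := by
  have := G.pr_mid u [] w (by simpa using h)
  rw [G.pr_nil] at this
  simpa using this

lemma one_mul_mem (a : L) : [G.one, a] ∈ G.D := (G.insert_one (u := []) (G.singleton_mem a)).1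

lemma one_mul' (a : L) : G.mul G.one a = a :=
  (G.insert_one (u := []) (G.singleton_mem a)).2.trans (G.pr_singleton a)

lemma mul_one_mem (a : L) : [a, G.one] ∈ G.D :=
  (G.insert_one (u := [a]) (w := []) (G.singleton_mem a)).1

lemma mul_one' (a : L) : G.mul a G.one = a :=
  (G.insert_one (u := [a]) (w := []) (G.singleton_mem a)).2.trans (G.pr_singleton a)

lemma remove_one {u w : List L} (h : u ++ G.one :: w ∈ G.D) :
    u ++ w ∈ G.D ∧ G.pr (u ++ w) = G.pr (u ++ G.one :: w) := by
  cases w with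
  | nil =>
    have h' : u ∈ G.D := G.mem_left h
    have := (G.insert_one (u := u) (w := []) (by simpa using h')).2
    exact ⟨by simpa using h', this.symm⟩
  | cons a w =>
    have := G.pr_mid u [G.one, a] w (by simpa using h)
    have e : G.pr [G.one, a] = a := G.one_mul' a
    rw [e] at this
    simpa using this

lemma inv_append' {w : List L} (h : w ∈ G.D) :
    (w.map G.inv).reverse ++ w ∈ G.D ∧ G.pr ((w.map G.inv).reverse ++ w) = G.one := by
  obtain ⟨h', e⟩ := G.inv_append w h
  rw [G.pr_eq] at e
  exact ⟨h', e⟩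

lemma inv_word_mem {w : List L} (h : w ∈ G.D) : (w.map G.inv).reverse ∈ G.D :=
  G.mem_left (G.inv_append' h).1

lemma append_inv_mem {w : List L} (h : w ∈ G.D) : w ++ (w.map G.inv).reverse ∈ G.D := by
  have := (G.inv_append' (G.inv_word_mem h)).1
  simpa [List.map_reverse, Function.comp_def, G.inv_inv] using this

lemma inv_mul_mem (a : L) : [G.inv a, a] ∈ G.D := (G.inv_append' (G.singleton_mem a)).1

lemma inv_mul_self (a : L) : G.mul (G.inv a) a = G.one := (G.inv_append' (G.singleton_mem a)).2

lemma cancel_inv_mul {u w : List L} {a : L} (h : u ++ G.inv a :: a :: w ∈ G.D) :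
    u ++ w ∈ G.D ∧ G.pr (u ++ G.inv a :: a :: w) = G.pr (u ++ w) := by
  have h1 := G.pr_mid u [G.inv a, a] w (by simpa using h)
  have e : G.pr [G.inv a, a] = G.one := G.inv_mul_self a
  rw [e] at h1
  have h2 := G.remove_one h1.1
  exact ⟨h2.1, by simpa using h1.2.symm.trans h2.2.symm⟩

lemma cancel_mul_inv {u w : List L} {a : L} (h : u ++ a :: G.inv a :: w ∈ G.D) :
    u ++ w ∈ G.D ∧ G.pr (u ++ a :: G.inv a :: w) = G.pr (u ++ w) := by
  have := G.cancel_inv_mul (u := u) (w := w) (a := G.inv a) (by simpa [G.inv_inv] using h)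
  simpa [G.inv_inv] using this

lemma assoc_left {a b c : L} (h : [a, b, c] ∈ G.D) :
    [G.mul a b, c] ∈ G.D ∧ G.mul (G.mul a b) c = G.pr [a, b, c] :=
  G.pr_mid [] [a, b] [c] h

lemma assoc_right {a b c : L} (h : [a, b, c] ∈ G.D) :
    [a, G.mul b c] ∈ G.D ∧ G.mul a (G.mul b c) = G.pr [a, b, c] :=
  G.pr_mid [a] [b, c] [] h

lemma mul_assoc' {a b c : L} (h : [a, b, c] ∈ G.D) :
    G.mul (G.mul a b) c = G.mul a (G.mul b c) :=
  (G.assoc_left h).2.trans (G.assoc_right h).2.symm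

lemma inv_mul_cancel' {a b : L} (h : [a, b] ∈ G.D) : G.mul (G.inv a) (G.mul a b) = b := by
  -- A suffix of w⁻¹ ∘ w for w = (a, b).
  have h1 : [G.inv a, a, b] ∈ G.D := G.mem_right (u := [G.inv b]) (by simpa using (G.inv_append' h).1)
  rw [(G.assoc_right h1).2]
  exact (G.cancel_inv_mul (u := []) h1).2.trans (G.pr_singleton b)

lemma mul_inv_cancel' {a b : L} (h : [a, b] ∈ G.D) : G.mul (G.mul a b) (G.inv b) = a := by
  have h1 : [a, b, G.inv b] ∈ G.D :=
    G.mem_left (v := [G.inv a]) (by simpa using G.append_inv_mem h)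
  rw [(G.assoc_left h1).2]
  exact (G.cancel_mul_inv (u := [a]) h1).2.trans (G.pr_singleton a)

lemma eq_inv_of_mul_eq_one {a b : L} (h : [a, b] ∈ G.D) (e : G.mul a b = G.one) : a = G.inv b := by
  rw [← G.mul_inv_cancel' h, e, G.one_mul']

lemma inv_one : G.inv G.one = G.one :=
  (G.eq_inv_of_mul_eq_one (G.one_mul_mem G.one) (G.one_mul' _)).symm

lemma inv_pr {w : List L} (h : w ∈ G.D) : G.inv (G.pr w) = G.pr (w.map G.inv).reverse := by
  have h1 := G.inv_append' h
  have h2 := G.pr_append h1.1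
  exact (G.eq_inv_of_mul_eq_one h2.1 (h2.2.trans h1.2)).symm

lemma inv_mul_rev {a b : L} (h : [a, b] ∈ G.D) :
    G.inv (G.mul a b) = G.mul (G.inv b) (G.inv a) := by
  simpa [mul] using G.inv_pr h

lemma conj_iff {g x y : L} : G.Conj g x y ↔ [G.inv g, x, g] ∈ G.D ∧ G.cj g x = y := by
  constructor
  · rintro ⟨h, e⟩
    exact ⟨h, by rw [← e, G.pr_eq, cj]⟩
  · rintro ⟨h, e⟩
    exact ⟨h, by rw [G.pr_eq, ← e, cj]⟩

lemma setConj_iff {X Y : Set L} {g : L} :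
    G.SetConj X g Y ↔ (∀ x ∈ X, [G.inv g, x, g] ∈ G.D) ∧ Y = G.cj g '' X := by
  refine and_congr_right fun h => ?_
  have : {y | ∃ x ∈ X, G.Conj g x y} = G.cj g '' X := by
    ext y
    simp only [Set.mem_ofPred_eq, Set.mem_image, conj_iff]
    exact ⟨fun ⟨x, hx, _, e⟩ => ⟨x, hx, e⟩, fun ⟨x, hx, e⟩ => ⟨x, hx, h x hx, e⟩⟩
  rw [this]

lemma mul_cj {g x : L} (h : [G.inv g, x, g] ∈ G.D) :
    [g, G.inv g, x, g] ∈ G.D ∧ [g, G.cj g x] ∈ G.D ∧ G.mul g (G.cj g x) = G.mul x g := by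
  have h1 : [g, G.inv g, x, g] ∈ G.D := by
    have := (G.inv_append' h).1
    simp only [List.map_cons, List.map_nil, List.reverse_cons, List.reverse_nil, List.nil_append,
      List.cons_append, G.inv_inv] at this
    exact G.mem_right (u := [G.inv g, G.inv x]) this
  have h2 := G.pr_mid [g] [G.inv g, x, g] [] h1
  refine ⟨h1, h2.1, h2.2.trans ?_⟩
  exact (G.cancel_mul_inv (u := []) h1).2

lemma cj_inv_cj {g x : L} (h : [G.inv g, x, g] ∈ G.D) :
    [G.inv (G.inv g), G.cj g x, G.inv g] ∈ G.D ∧ G.cj (G.inv g) (G.cj g x) = x := by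
  have h1 := (G.mul_cj h).1
  have h2 : [g, G.inv g, x, g, G.inv g] ∈ G.D := by
    have := G.append_inv_mem h1
    simp only [List.map_cons, List.map_nil, List.reverse_cons, List.reverse_nil, List.nil_append,
      List.cons_append, G.inv_inv] at this
    exact G.mem_left (u := [g, G.inv g, x, g, G.inv g]) (v := [G.inv x, g, G.inv g]) this
  have h3 := G.pr_mid [g] [G.inv g, x, g] [G.inv g] h2
  unfold cj
  rw [G.inv_inv]
  refine ⟨h3.1, h3.2.trans ?_⟩
  have h4 := G.cancel_mul_inv (u := []) h2
  refine h4.2.trans ((G.cancel_mul_inv (u := [x]) h4.1).2.trans (G.pr_singleton x))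

lemma cj_inv_elem {g x : L} (h : [G.inv g, x, g] ∈ G.D) :
    [G.inv g, G.inv x, g] ∈ G.D ∧ G.cj g (G.inv x) = G.inv (G.cj g x) := by
  have h1 := G.inv_word_mem h
  have h2 := G.inv_pr h
  simp only [List.map_cons, List.map_nil, List.reverse_cons, List.reverse_nil, List.nil_append,
    List.cons_append, G.inv_inv] at h1 h2
  exact ⟨h1, h2.symm⟩

lemma cj_one_elem (g : L) : [G.inv g, G.one, g] ∈ G.D ∧ G.cj g G.one = G.one := by
  have := G.insert_one (u := [G.inv g]) (w := [g]) (G.inv_mul_mem g)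
  exact ⟨this.1, this.2.trans (G.inv_mul_self g)⟩

lemma cj_mul_elem {g x y : L} (h : [G.inv g, x, g, G.inv g, y, g] ∈ G.D) :
    [G.inv g, G.mul x y, g] ∈ G.D ∧ [G.cj g x, G.cj g y] ∈ G.D ∧
      G.cj g (G.mul x y) = G.mul (G.cj g x) (G.cj g y) := by
  have h1 := G.cancel_mul_inv (u := [G.inv g, x]) h
  have h2 := G.pr_mid [G.inv g] [x, y] [g] h1.1
  have h3 := G.pr_append (u := [G.inv g, x, g]) (v := [G.inv g, y, g]) h
  exact ⟨h2.1, h3.1, (h2.2.trans h1.2.symm).trans h3.2.symm⟩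

lemma cj_mul {a b x : L} (h : [G.inv b, G.inv a, x, a, b] ∈ G.D) :
    [G.inv (G.mul a b), x, G.mul a b] ∈ G.D ∧ G.cj (G.mul a b) x = G.cj b (G.cj a x) := by
  have hab : [a, b] ∈ G.D := G.mem_right (u := [G.inv b, G.inv a, x]) h
  have h1 := G.pr_mid [G.inv b, G.inv a, x] [a, b] [] h
  have h2 := G.pr_mid [] [G.inv b, G.inv a] [x, G.mul a b] h1.1
  have h3 := G.pr_mid [G.inv b] [G.inv a, x, a] [b] h
  unfold cj
  rw [G.inv_mul_rev hab]
  exact ⟨h2.1, h2.2.trans (h1.2.trans h3.2.symm)⟩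

lemma cj_eq_mul {g x : L} (h : [G.inv g, x, g] ∈ G.D) :
    G.cj g x = G.mul (G.mul (G.inv g) x) g := (G.assoc_left h).2.symm

/-- The factorization g = x⁻¹ · g · x^g shows how g acts on an object shifted by x; see `mor_shift`.
-/
lemma inv_cj_mul {g x : L} (h : [G.inv g, x, g] ∈ G.D) :
    [G.inv x, g, G.cj g x] ∈ G.D ∧ G.pr [G.inv x, g, G.cj g x] = g := by
  have h1 := (G.inv_append' h).1
  simp only [List.map_cons, List.map_nil, List.reverse_cons, List.reverse_nil, List.nil_append,
      List.cons_append, G.inv_inv] at h1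
  have h2 : [G.inv x, g, G.inv g, x, g] ∈ G.D := G.mem_right (u := [G.inv g]) h1
  have h3 := G.pr_mid [G.inv x, g] [G.inv g, x, g] [] h2
  refine ⟨h3.1, h3.2.trans ?_⟩
  have h4 := G.cancel_mul_inv (u := [G.inv x]) h2
  exact h4.2.trans ((G.cancel_inv_mul (u := []) h4.1).2.trans (G.pr_singleton g))

lemma one_cj (x : L) : [G.inv G.one, x, G.one] ∈ G.D ∧ G.cj G.one x = x := by
  unfold cj
  rw [G.inv_one]
  have h1 := G.insert_one (u := [x]) (w := []) (G.singleton_mem x)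
  have h2 := G.insert_one (u := []) (w := [x, G.one]) h1.1
  exact ⟨h2.1, h2.2.trans (h1.2.trans (G.pr_singleton x))⟩

end Basic

/-! ### Subgroups of a partial group as groups. -/

section Subgroups

variable {L : Type u} {G : PartialGroup L}

lemma IsPartialSubgroup.one_mem {H : Set L} (h : G.IsPartialSubgroup H) : G.one ∈ H :=
  h.prod_mem [] G.nil_mem (by simp)

lemma IsPartialSubgroup.pr_mem {H : Set L} (h : G.IsPartialSubgroup H) {w : List L}
    (hw : w ∈ G.D) (hx : ∀ x ∈ w, x ∈ H) : G.pr w ∈ H := by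
  rw [← G.pr_eq hw]
  exact h.prod_mem w hw hx

lemma IsPartialSubgroup.mul_mem {H : Set L} (h : G.IsPartialSubgroup H) {a b : L}
    (hD : [a, b] ∈ G.D) (ha : a ∈ H) (hb : b ∈ H) : G.mul a b ∈ H :=
  h.pr_mem hD (by simp [ha, hb])

lemma IsPartialNormal.cj_mem {N : Set L} (h : G.IsPartialNormal N) {g x : L}
    (hD : [G.inv g, x, g] ∈ G.D) (hx : x ∈ N) : G.cj g x ∈ N :=
  h.conj_mem x hx g _ (G.conj_iff.2 ⟨hD, rfl⟩)

lemma IsSubgroup.mul_mem {H : Set L} (h : G.IsSubgroup H) {a b : L} (ha : a ∈ H) (hb : b ∈ H) :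
    G.mul a b ∈ H :=
  h.toIsPartialSubgroup.mul_mem (h.mem_D _ (by simp [ha, hb])) ha hb

lemma IsSubgroup.one_mem {H : Set L} (h : G.IsSubgroup H) : G.one ∈ H :=
  h.toIsPartialSubgroup.one_mem

/-- A set that is closed under inversion and binary products is a subgroup, as soon as all its
words lie in the domain. -/
lemma isSubgroup_of_mul {H : Set L} (one : G.one ∈ H) (inv : ∀ x ∈ H, G.inv x ∈ H)
    (mul : ∀ x ∈ H, ∀ y ∈ H, G.mul x y ∈ H) (mem : ∀ w : List L, (∀ x ∈ w, x ∈ H) → w ∈ G.D) :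
    G.IsSubgroup H where
  nonempty := ⟨_, one⟩
  inv_mem := inv
  mem_D := mem
  prod_mem := by
    intro w hw hx
    rw [G.pr_eq]
    clear hw
    induction w with
    | nil => rwa [G.pr_nil]
    | cons a w ih =>
      rw [← (G.pr_cons (mem _ hx)).2]
      exact mul _ (hx _ (by simp)) _ (ih fun x hxw => hx x (by simp [hxw]))

lemma IsSubgroup.of_subset {H K : Set L} (hK : G.IsSubgroup K) (hHK : H ⊆ K) (one : G.one ∈ H)
    (inv : ∀ x ∈ H, G.inv x ∈ H) (mul : ∀ x ∈ H, ∀ y ∈ H, G.mul x y ∈ H) : G.IsSubgroup H :=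
  isSubgroup_of_mul one inv mul fun w hw => hK.mem_D w fun x hx => hHK (hw x hx)

/-- The group structure on a subgroup of a partial group. -/
@[reducible] noncomputable def IsSubgroup.group {H : Set L} (h : G.IsSubgroup H) : Group H :=
  letI : Mul H := ⟨fun a b => ⟨G.mul a b, h.mul_mem a.2 b.2⟩⟩
  letI : One H := ⟨⟨G.one, h.one_mem⟩⟩
  letI : Inv H := ⟨fun a => ⟨G.inv a, h.inv_mem _ a.2⟩⟩
  Group.ofLeftAxioms
    (fun a b c => Subtype.ext (G.mul_assoc' (h.mem_D _ (by simp))))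
    (fun a => Subtype.ext (G.one_mul' _))
    (fun a => Subtype.ext (G.inv_mul_self _))

lemma IsSubgroup.coe_mul {H : Set L} (h : G.IsSubgroup H) (a b : H) :
    letI := h.group
    ((a * b : H) : L) = G.mul a b := rfl

lemma IsSubgroup.coe_pow {H : Set L} (h : G.IsSubgroup H) (a : H) (n : ℕ) :
    letI := h.group
    ((a ^ n : H) : L) = G.pr (List.replicate n (a : L)) := by
  let _ := h.group
  induction n with
  | zero => simp only [pow_zero, List.replicate_zero, G.pr_nil]; rfl
  | succ n ih =>
    rw [pow_succ', h.coe_mul, ih, List.replicate_succ]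
    refine (G.pr_cons (h.mem_D _ ?_)).2
    simp +contextual [List.mem_replicate]

lemma IsSubgroup.coe_cj {H : Set L} (h : G.IsSubgroup H) (a b : H) :
    letI := h.group
    ((a⁻¹ * b * a : H) : L) = G.cj a b := by
  let _ := h.group
  rw [G.cj_eq_mul (h.mem_D _ (by simp [h.inv_mem]))]
  rfl

lemma IsSubgroup.cj_mem {H : Set L} (h : G.IsSubgroup H) {a b : L} (ha : a ∈ H) (hb : b ∈ H) :
    G.cj a b ∈ H := by
  rw [← h.coe_cj ⟨a, ha⟩ ⟨b, hb⟩]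
  exact Subtype.coe_prop _

/-- A subgroup of the group on `H`, as a subgroup of the partial group. -/
lemma IsSubgroup.coe_subgroup {H : Set L} (h : G.IsSubgroup H) :
    letI := h.group
    ∀ K : Subgroup H, G.IsSubgroup (Subtype.val '' (K : Set H)) := by
  let _ := h.group
  intro K
  refine h.of_subset (by rintro _ ⟨x, -, rfl⟩; exact x.2) ⟨1, K.one_mem, rfl⟩ ?_ ?_
  · rintro _ ⟨x, hx, rfl⟩
    exact ⟨x⁻¹, K.inv_mem hx, rfl⟩
  · rintro _ ⟨x, hx, rfl⟩ _ ⟨y, hy, rfl⟩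
    exact ⟨x * y, K.mul_mem hx hy, rfl⟩

/-- A subgroup contained in `H`, as a subgroup of the group on `H`. -/
def IsSubgroup.subgroupOf {H K : Set L} (h : G.IsSubgroup H) (hK : G.IsSubgroup K) :
    letI := h.group
    Subgroup H :=
  letI := h.group
  { carrier := {x | (x : L) ∈ K}
    mul_mem' := fun ha hb => hK.mul_mem ha hb
    one_mem' := hK.one_mem
    inv_mem' := fun ha => hK.inv_mem _ ha }

/-- `x` has order a power of `p`. -/
def IsPElem (p : ℕ) (G : PartialGroup L) (x : L) : Prop :=
  ∃ k : ℕ, ∃ h : List.replicate (p ^ k) x ∈ G.D, G.prod (List.replicate (p ^ k) x) h = G.one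

lemma IsSubgroup.isPElem_iff {H : Set L} (h : G.IsSubgroup H) (p : ℕ) (x : H) :
    letI := h.group
    G.IsPElem p x ↔ ∃ k : ℕ, x ^ p ^ k = 1 := by
  let _ := h.group
  refine exists_congr fun k => ?_
  rw [Subtype.ext_iff, h.coe_pow]
  constructor
  · rintro ⟨hD, e⟩
    rw [← G.pr_eq hD, e]; rfl
  · intro e
    have hD : List.replicate (p ^ k) (x : L) ∈ G.D :=
      h.mem_D _ (by simp +contextual [List.mem_replicate])
    exact ⟨hD, by rw [G.pr_eq, e]; rfl⟩

lemma isPSubgroup_iff {p : ℕ} {H : Set L} :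
    G.IsPSubgroup p H ↔ G.IsSubgroup H ∧ ∀ x ∈ H, G.IsPElem p x := Iff.rfl

lemma IsSubgroup.isPGroup_iff {H : Set L} (h : G.IsSubgroup H) (p : ℕ) :
    letI := h.group
    IsPGroup p H ↔ G.IsPSubgroup p H := by
  let _ := h.group
  rw [isPSubgroup_iff]
  constructor
  · intro hp
    exact ⟨h, fun x hx => (h.isPElem_iff p ⟨x, hx⟩).2 (hp ⟨x, hx⟩)⟩
  · rintro ⟨-, hp⟩ x
    exact (h.isPElem_iff p x).1 (hp x x.2)

lemma IsSubgroup.isPGroup_subgroup_iff {H : Set L} (h : G.IsSubgroup H) (p : ℕ) :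
    letI := h.group
    ∀ K : Subgroup H, IsPGroup p K ↔ G.IsPSubgroup p (Subtype.val '' (K : Set H)) := by
  let _ := h.group
  intro K
  rw [isPSubgroup_iff]
  constructor
  · intro hp
    refine ⟨h.coe_subgroup K, ?_⟩
    rintro _ ⟨x, hx, rfl⟩
    obtain ⟨k, hk⟩ := hp ⟨x, hx⟩
    exact (h.isPElem_iff p x).2 ⟨k, congrArg Subtype.val hk⟩
  · rintro ⟨-, hp⟩ x
    obtain ⟨k, hk⟩ := (h.isPElem_iff p x.1).1 (hp _ ⟨x.1, x.2, rfl⟩)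
    exact ⟨k, Subtype.ext hk⟩

end Subgroups

end PartialGroup

namespace PartialGroup

/-! ### Conjugation between objects. -/

section Objective

variable {L : Type u} {G : PartialGroup L} {Δ : Set (Set L)}

/-- `P` and `Q` are objects and `P ^ g = Q`. -/
structure Mor (G : PartialGroup L) (Δ : Set (Set L)) (g : L) (P Q : Set L) : Prop where
  src : P ∈ Δ
  tgt : Q ∈ Δ
  dom : ∀ x ∈ P, [G.inv g, x, g] ∈ G.D
  img : G.cj g '' P = Q

/-- The normalizer of an object. -/
def nz (G : PartialGroup L) (Δ : Set (Set L)) (P : Set L) : Set L := {g | G.Mor Δ g P P}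

lemma Via.src {X : Set L} {w : List L} (h : G.Via Δ X w) : X ∈ Δ := by
  cases w with
  | nil => exact h
  | cons g w => exact h.1

lemma via_nil {P : Set L} (h : P ∈ Δ) : G.Via Δ P [] := h

/-- Composable conjugations of objects form a chain, and a chain puts its word into the domain. Most
memberships in the domain below are obtained by exhibiting such a chain. -/
lemma Mor.cons {g : L} {P Q : Set L} {w : List L} (h : G.Mor Δ g P Q) (hw : G.Via Δ Q w) :
    G.Via Δ P (g :: w) :=
  ⟨h.src, Q, G.setConj_iff.2 ⟨h.dom, h.img.symm⟩, hw⟩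

lemma Via.uncons {g : L} {P : Set L} {w : List L} (h : G.Via Δ P (g :: w)) :
    G.Mor Δ g P (G.cj g '' P) ∧ G.Via Δ (G.cj g '' P) w := by
  obtain ⟨hP, Q, hQ, hw⟩ := h
  rw [setConj_iff] at hQ
  rw [hQ.2] at hw
  exact ⟨⟨hP, hw.src, hQ.1, rfl⟩, hw⟩

lemma Mor.single {g : L} {P Q : Set L} (h : G.Mor Δ g P Q) : G.Via Δ P [g] :=
  h.cons (via_nil h.tgt)

lemma Mor.image_mem {g x : L} {P Q : Set L} (h : G.Mor Δ g P Q) (hx : x ∈ P) : G.cj g x ∈ Q := by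
  rw [← h.img]
  exact Set.mem_image_of_mem _ hx

lemma Mor.inv {g : L} {P Q : Set L} (h : G.Mor Δ g P Q) : G.Mor Δ (G.inv g) Q P where
  src := h.tgt
  tgt := h.src
  dom := by
    rw [← h.img]
    rintro _ ⟨x, hx, rfl⟩
    exact (G.cj_inv_cj (h.dom x hx)).1
  img := by
    rw [← h.img, Set.image_image]
    refine (Set.image_congr fun x hx => ?_).trans (Set.image_id P)
    exact (G.cj_inv_cj (h.dom x hx)).2

lemma mor_one {P : Set L} (h : P ∈ Δ) : G.Mor Δ G.one P P where
  src := h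
  tgt := h
  dom := fun x _ => (G.one_cj x).1
  img := (Set.image_congr fun x _ => (G.one_cj x).2).trans (Set.image_id P)

variable (hO : G.IsObjective Δ)
include hO

lemma IsObjective.mem_D {X : Set L} {w : List L} (h : G.Via Δ X w) : w ∈ G.D :=
  (hO.mem_D_iff w).2 ⟨X, h⟩

lemma IsObjective.mor_of_mem {P : Set L} (hP : P ∈ Δ) {x : L} (hx : x ∈ P) : G.Mor Δ x P P := by
  have h := hO.isSubgroup P hP
  refine ⟨hP, hP, fun y hy => h.mem_D _ (by simp [hx, hy, h.inv_mem]), ?_⟩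
  apply Set.Subset.antisymm
  · rintro _ ⟨y, hy, rfl⟩
    exact h.cj_mem hx hy
  · intro y hy
    refine ⟨G.cj (G.inv x) y, h.cj_mem (h.inv_mem _ hx) hy, ?_⟩
    have h1 : [G.inv (G.inv x), y, G.inv x] ∈ G.D :=
      h.mem_D _ (by simp [hx, hy, h.inv_mem, G.inv_inv])
    have := (G.cj_inv_cj h1).2
    rwa [G.inv_inv] at this

lemma IsObjective.mul_mem_D {a b : L} {P Q R : Set L} (ha : G.Mor Δ a P Q) (hb : G.Mor Δ b Q R) :
    [a, b] ∈ G.D := hO.mem_D (ha.cons hb.single)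

lemma IsObjective.cj_comp {a b x : L} {P Q R : Set L} (ha : G.Mor Δ a P Q) (hb : G.Mor Δ b Q R)
    (hx : G.Mor Δ x P P) : [G.inv (G.mul a b), x, G.mul a b] ∈ G.D ∧
      G.cj (G.mul a b) x = G.cj b (G.cj a x) :=
  G.cj_mul (hO.mem_D (hb.inv.cons (ha.inv.cons (hx.cons (ha.cons hb.single)))))

lemma IsObjective.mor_mul {a b : L} {P Q R : Set L} (ha : G.Mor Δ a P Q) (hb : G.Mor Δ b Q R) :
    G.Mor Δ (G.mul a b) P R where
  src := ha.src
  tgt := hb.tgt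
  dom := fun _ hx => (hO.cj_comp ha hb (hO.mor_of_mem ha.src hx)).1
  img := by
    rw [← hb.img, ← ha.img, Set.image_image]
    exact Set.image_congr fun x hx => (hO.cj_comp ha hb (hO.mor_of_mem ha.src hx)).2

lemma IsObjective.assoc {a b c : L} {P Q R U : Set L} (ha : G.Mor Δ a P Q) (hb : G.Mor Δ b Q R)
    (hc : G.Mor Δ c R U) : G.mul (G.mul a b) c = G.mul a (G.mul b c) :=
  G.mul_assoc' (hO.mem_D (ha.cons (hb.cons hc.single)))

lemma IsObjective.inv_mul_cancel {a b : L} {P Q R : Set L} (ha : G.Mor Δ a P Q)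
    (hb : G.Mor Δ b Q R) : G.mul (G.inv a) (G.mul a b) = b :=
  G.inv_mul_cancel' (hO.mul_mem_D ha hb)

lemma IsObjective.mul_inv_cancel {a b : L} {P Q R : Set L} (ha : G.Mor Δ a P Q)
    (hb : G.Mor Δ b Q R) : G.mul (G.mul a b) (G.inv b) = a :=
  G.mul_inv_cancel' (hO.mul_mem_D ha hb)

lemma IsObjective.cj_mem_D {g x : L} {P Q : Set L} (hg : G.Mor Δ g P Q) (hx : G.Mor Δ x P P) :
    [G.inv g, x, g] ∈ G.D := hO.mem_D (hg.inv.cons (hx.cons hg.single))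

lemma IsObjective.mor_cj {g x : L} {P Q : Set L} (hg : G.Mor Δ g P Q) (hx : G.Mor Δ x P P) :
    G.Mor Δ (G.cj g x) Q Q := by
  rw [G.cj_eq_mul (hO.cj_mem_D hg hx)]
  exact hO.mor_mul (hO.mor_mul hg.inv hx) hg

lemma IsObjective.cj_inv_cj {g x : L} {P Q : Set L} (hg : G.Mor Δ g P Q) (hx : G.Mor Δ x P P) :
    G.cj (G.inv g) (G.cj g x) = x := (G.cj_inv_cj (hO.cj_mem_D hg hx)).2

lemma IsObjective.cj_mul {g x y : L} {P Q : Set L} (hg : G.Mor Δ g P Q) (hx : G.Mor Δ x P P)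
    (hy : G.Mor Δ y P P) : G.cj g (G.mul x y) = G.mul (G.cj g x) (G.cj g y) :=
  (G.cj_mul_elem (hO.mem_D
    (hg.inv.cons (hx.cons (hg.cons (hg.inv.cons (hy.cons hg.single))))))).2.2

lemma IsObjective.nz_isSubgroup {P : Set L} (hP : P ∈ Δ) : G.IsSubgroup (G.nz Δ P) := by
  refine isSubgroup_of_mul (mor_one hP) (fun x hx => Mor.inv hx)
    (fun x hx y hy => hO.mor_mul hx hy) fun w hw => hO.mem_D (X := P) ?_
  induction w with
  | nil => exact hP
  | cons a w ih => exact Mor.cons (hw a (by simp)) (ih fun x hx => hw x (by simp [hx]))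

lemma IsObjective.cj_cj {g x y : L} {P Q : Set L} (hg : G.Mor Δ g P Q) (hx : G.Mor Δ x P P)
    (hy : G.Mor Δ y P P) : G.cj (G.cj g x) (G.cj g y) = G.cj g (G.cj x y) := by
  have h1 := hO.mor_cj hg hx
  rw [G.cj_eq_mul (hO.cj_mem_D hx hy), G.cj_eq_mul (hO.cj_mem_D h1 (hO.mor_cj hg hy)),
    hO.cj_mul hg (hO.mor_mul hx.inv hy) hx, hO.cj_mul hg hx.inv hy,
    (G.cj_inv_elem (hO.cj_mem_D hg hx)).2]

lemma IsObjective.isPElem_cj {p : ℕ} {g x : L} {P Q : Set L} (hg : G.Mor Δ g P Q)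
    (hx : G.Mor Δ x P P) (h : G.IsPElem p x) : G.IsPElem p (G.cj g x) := by
  let _ := (hO.nz_isSubgroup hg.src).group
  let _ := (hO.nz_isSubgroup hg.tgt).group
  let φ : G.nz Δ P →* G.nz Δ Q := MonoidHom.mk' (fun x => ⟨G.cj g x, hO.mor_cj hg x.2⟩)
    fun a b => Subtype.ext (hO.cj_mul hg a.2 b.2)
  obtain ⟨k, hk⟩ := ((hO.nz_isSubgroup hg.src).isPElem_iff p ⟨x, hx⟩).1 h
  refine ((hO.nz_isSubgroup hg.tgt).isPElem_iff p (φ ⟨x, hx⟩)).2 ⟨k, ?_⟩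
  rw [← map_pow, hk, map_one]

lemma IsObjective.isSubgroup_cj {g : L} {P Q H : Set L} (hg : G.Mor Δ g P Q)
    (hH : G.IsSubgroup H) (hHP : H ⊆ G.nz Δ P) : G.IsSubgroup (G.cj g '' H) := by
  refine (hO.nz_isSubgroup hg.tgt).of_subset ?_ ⟨_, hH.one_mem, (G.cj_one_elem g).2⟩ ?_ ?_
  · rintro _ ⟨x, hx, rfl⟩
    exact hO.mor_cj hg (hHP hx)
  · rintro _ ⟨x, hx, rfl⟩
    exact ⟨_, hH.inv_mem x hx, (G.cj_inv_elem (hO.cj_mem_D hg (hHP hx))).2⟩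
  · rintro _ ⟨x, hx, rfl⟩ _ ⟨y, hy, rfl⟩
    exact ⟨_, hH.mul_mem hx hy, hO.cj_mul hg (hHP hx) (hHP hy)⟩

lemma IsObjective.isPSubgroup_cj {p : ℕ} {g : L} {P Q H : Set L} (hg : G.Mor Δ g P Q)
    (hH : G.IsPSubgroup p H) (hHP : H ⊆ G.nz Δ P) : G.IsPSubgroup p (G.cj g '' H) := by
  refine ⟨hO.isSubgroup_cj hg hH.1 hHP, ?_⟩
  rintro _ ⟨x, hx, rfl⟩
  exact hO.isPElem_cj hg (hHP hx) (hH.2 x hx)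

end Objective

/-! ### The sets S_g and S_w in a pre-locality. -/

section PreLocality

variable {L : Type u} {G : PartialGroup L} {Δ : Set (Set L)} {S : Set L}

/-- The set of all elements of `S` that are conjugated into `S` by `g`. -/
def sg (G : PartialGroup L) (S : Set L) (g : L) : Set L :=
  {x | x ∈ S ∧ [G.inv g, x, g] ∈ G.D ∧ G.cj g x ∈ S}

lemma sg_subset (g : L) : G.sg S g ⊆ S := fun _ hx => hx.1

lemma conjInto_subset (w : List L) : G.conjInto S w ⊆ S := by
  cases w with
  | nil => exact subset_rfl
  | cons g w => exact fun x hx => hx.1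

lemma mem_conjInto_cons {g x : L} {w : List L} :
    x ∈ G.conjInto S (g :: w) ↔ x ∈ G.sg S g ∧ G.cj g x ∈ G.conjInto S w := by
  constructor
  · rintro ⟨hx, y, hy, hyw⟩
    rw [conj_iff] at hy
    rw [← hy.2] at hyw
    exact ⟨⟨hx, hy.1, conjInto_subset w hyw⟩, hyw⟩
  · rintro ⟨hx, hw⟩
    exact ⟨hx.1, _, G.conj_iff.2 ⟨hx.2.1, rfl⟩, hw⟩

lemma conjInto_single (g : L) : G.conjInto S [g] = G.sg S g := by
  ext x
  rw [mem_conjInto_cons]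
  exact ⟨fun h => h.1, fun h => ⟨h, h.2.2⟩⟩

lemma mem_conjInto_pair {a b x : L} :
    x ∈ G.conjInto S [a, b] ↔ x ∈ G.sg S a ∧ G.cj a x ∈ G.sg S b := by
  rw [mem_conjInto_cons, conjInto_single]

lemma sg_inv_mem {g x : L} (hx : x ∈ G.sg S g) : G.cj g x ∈ G.sg S (G.inv g) := by
  have := G.cj_inv_cj hx.2.1
  exact ⟨hx.2.2, this.1, by rw [this.2]; exact hx.1⟩

lemma sg_cj_inv {g x : L} (hx : x ∈ G.sg S g) : G.cj (G.inv g) (G.cj g x) = x :=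
  (G.cj_inv_cj hx.2.1).2

lemma Mor.subset_sg {P Q : Set L} {g : L} (h : G.Mor Δ g P Q) (hS : ∀ X ∈ Δ, X ⊆ S) :
    P ⊆ G.sg S g :=
  fun _ hx => ⟨hS P h.src hx, h.dom _ hx, hS Q h.tgt (h.image_mem hx)⟩

lemma Via.subset_conjInto {P : Set L} {w : List L} (h : G.Via Δ P w) (hS : ∀ X ∈ Δ, X ⊆ S) :
    P ⊆ G.conjInto S w := by
  induction w generalizing P with
  | nil => exact hS P h
  | cons g w ih =>
    intro x hx
    exact mem_conjInto_cons.2 ⟨h.uncons.1.subset_sg hS hx, ih h.uncons.2 ⟨x, hx, rfl⟩⟩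

variable (hP : G.IsPreLocality Δ S)
include hP

lemma IsPreLocality.isSubgroup_S : G.IsSubgroup S := hP.isSubgroup S hP.S_mem

lemma IsPreLocality.mem_of_le {P W : Set L} (h : P ∈ Δ) (hW : G.IsSubgroup W) (hPW : P ⊆ W)
    (hWS : W ⊆ S) : W ∈ Δ := by
  have h1 := mor_one (G := G) h
  exact hP.closed P h S hP.S_mem G.one P (G.setConj_iff.2 ⟨h1.dom, h1.img.symm⟩) (hP.isSubgroup P h)
    (hP.subset_S P h) W hW hPW hWS

lemma IsPreLocality.mor_of_image {P : Set L} {g : L} (h : P ∈ Δ) (hg : P ⊆ G.sg S g)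
    (hs : G.IsSubgroup (G.cj g '' P)) : G.Mor Δ g P (G.cj g '' P) := by
  have hs' : G.cj g '' P ⊆ S := by
    rintro _ ⟨x, hx, rfl⟩
    exact (hg hx).2.2
  have h0 : ∀ x ∈ P, [G.inv g, x, g] ∈ G.D := fun x hx => (hg hx).2.1
  exact ⟨h, hP.closed P h S hP.S_mem g _ (G.setConj_iff.2 ⟨h0, rfl⟩) hs hs' _ hs subset_rfl hs',
    h0, rfl⟩

lemma IsPreLocality.mor_of_mem_S {P : Set L} {a : L} (h : P ∈ Δ) (ha : a ∈ S) :
    G.Mor Δ a P (G.cj a '' P) := by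
  have hPS := hP.subset_S P h
  have hS := hP.isSubgroup_S
  refine hP.mor_of_image h (fun x hx =>
    ⟨hPS hx, hS.mem_D _ (by simp [ha, hPS hx, hS.inv_mem]), hS.cj_mem ha (hPS hx)⟩) ?_
  exact hP.isSubgroup_cj (hP.mor_of_mem hP.S_mem ha) (hP.isSubgroup P h)
    fun x hx => hP.mor_of_mem hP.S_mem (hPS hx)

lemma IsPreLocality.exists_mor (g : L) : ∃ P Q, G.Mor Δ g P Q := by
  obtain ⟨X, hX⟩ := (hP.mem_D_iff [g]).1 (G.singleton_mem g)
  exact ⟨X, _, hX.uncons.1⟩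

/-- Since g = a⁻¹ · g · a^g, the element g acts along P^a → P → Q → Q^(a^g). -/
lemma IsPreLocality.mor_shift {P Q : Set L} {g a : L} (h : G.Mor Δ g P Q) (ha : a ∈ G.sg S g) :
    G.Mor Δ g (G.cj a '' P) (G.cj (G.cj g a) '' Q) := by
  have h1 := hP.mor_of_mem_S h.src ha.1
  have h2 := hP.mor_of_mem_S h.tgt ha.2.2
  have e := G.inv_cj_mul ha.2.1
  have h3 := hP.mor_mul (hP.mor_mul h1.inv h) h2
  rwa [(G.assoc_left e.1).2, e.2] at h3

lemma IsPreLocality.cj_mul_of_sg {g a b : L} (ha : a ∈ G.sg S g) (hb : b ∈ G.sg S g) :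
    [G.inv g, G.mul a b, g] ∈ G.D ∧ G.cj g (G.mul a b) = G.mul (G.cj g a) (G.cj g b) := by
  obtain ⟨P, Q, h⟩ := hP.exists_mor g
  have h1 := hP.mor_shift h ha
  have h2 := hP.mor_shift h1 hb
  -- The elements a and b need not normalize a common object, so the chain runs Q → P → P^a, across
  -- by g and back, then by b to P^(ab) and across by g again.
  have := G.cj_mul_elem (g := g) (x := a) (y := b) (hP.mem_D (h.inv.cons
    ((hP.mor_of_mem_S h.src ha.1).cons (h1.cons (h1.inv.cons
    ((hP.mor_of_mem_S h1.src hb.1).cons h2.single))))))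
  exact ⟨this.1, this.2.2⟩

lemma IsPreLocality.isSubgroup_sg (g : L) : G.IsSubgroup (G.sg S g) := by
  have hS := hP.isSubgroup_S
  refine hS.of_subset (sg_subset g) ⟨hS.one_mem, (G.cj_one_elem g).1, ?_⟩ ?_ ?_
  · rw [(G.cj_one_elem g).2]
    exact hS.one_mem
  · intro x hx
    refine ⟨hS.inv_mem x hx.1, (G.cj_inv_elem hx.2.1).1, ?_⟩
    rw [(G.cj_inv_elem hx.2.1).2]
    exact hS.inv_mem _ hx.2.2
  · intro x hx y hy
    have h := hP.cj_mul_of_sg hx hy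
    refine ⟨hS.mul_mem hx.1 hy.1, h.1, ?_⟩
    rw [h.2]
    exact hS.mul_mem hx.2.2 hy.2.2

lemma IsPreLocality.isSubgroup_conjInto (w : List L) : G.IsSubgroup (G.conjInto S w) := by
  induction w with
  | nil => exact hP.isSubgroup_S
  | cons g w ih =>
    have hg := hP.isSubgroup_sg g
    refine hg.of_subset (fun x hx => (mem_conjInto_cons.1 hx).1) ?_ ?_ ?_
    · rw [mem_conjInto_cons, (G.cj_one_elem g).2]
      exact ⟨hg.one_mem, ih.one_mem⟩
    · intro x hx
      rw [mem_conjInto_cons] at hx ⊢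
      rw [(G.cj_inv_elem hx.1.2.1).2]
      exact ⟨hg.inv_mem x hx.1, ih.inv_mem _ hx.2⟩
    · intro x hx y hy
      rw [mem_conjInto_cons] at hx hy ⊢
      rw [(hP.cj_mul_of_sg hx.1 hy.1).2]
      exact ⟨hg.mul_mem hx.1 hy.1, ih.mul_mem hx.2 hy.2⟩

lemma IsPreLocality.isSubgroup_image {H : Set L} {g : L} (hH : G.IsSubgroup H)
    (hg : H ⊆ G.sg S g) : G.IsSubgroup (G.cj g '' H) := by
  refine hP.isSubgroup_S.of_subset ?_ ⟨_, hH.one_mem, (G.cj_one_elem g).2⟩ ?_ ?_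
  · rintro _ ⟨x, hx, rfl⟩
    exact (hg hx).2.2
  · rintro _ ⟨x, hx, rfl⟩
    exact ⟨_, hH.inv_mem x hx, (G.cj_inv_elem (hg hx).2.1).2⟩
  · rintro _ ⟨x, hx, rfl⟩ _ ⟨y, hy, rfl⟩
    exact ⟨_, hH.mul_mem hx hy, (hP.cj_mul_of_sg (hg hx) (hg hy)).2⟩

lemma IsPreLocality.mor {P : Set L} {g : L} (h : P ∈ Δ) (hg : P ⊆ G.sg S g) :
    G.Mor Δ g P (G.cj g '' P) :=
  hP.mor_of_image h hg (hP.isSubgroup_image (hP.isSubgroup P h) hg)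

lemma IsPreLocality.subset_sg {P Q : Set L} {g : L} (h : G.Mor Δ g P Q) : P ⊆ G.sg S g :=
  h.subset_sg hP.subset_S

lemma IsPreLocality.subset_conjInto {P : Set L} {w : List L} (h : G.Via Δ P w) :
    P ⊆ G.conjInto S w := h.subset_conjInto hP.subset_S

/-- With `subset_conjInto` this identifies chains starting at an object P with the inclusion P ⊆
S_w; so w lies in the domain exactly when S_w is an object. -/
lemma IsPreLocality.via {P : Set L} {w : List L} (h : P ∈ Δ) (hw : P ⊆ G.conjInto S w) :
    G.Via Δ P w := by
  induction w generalizing P with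
  | nil => exact h
  | cons g w ih =>
    have h1 := hP.mor h fun x hx => (mem_conjInto_cons.1 (hw hx)).1
    refine h1.cons (ih h1.tgt ?_)
    rintro _ ⟨x, hx, rfl⟩
    exact (mem_conjInto_cons.1 (hw hx)).2

lemma IsPreLocality.conjInto_mem {w : List L} (h : w ∈ G.D) : G.conjInto S w ∈ Δ := by
  obtain ⟨X, hX⟩ := (hP.mem_D_iff w).1 h
  exact hP.mem_of_le hX.src (hP.isSubgroup_conjInto w) (hP.subset_conjInto hX) (conjInto_subset w)

lemma IsPreLocality.sg_mem (g : L) : G.sg S g ∈ Δ := by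
  rw [← conjInto_single]
  exact hP.conjInto_mem (G.singleton_mem g)

lemma IsPreLocality.mor_sg (g : L) : G.Mor Δ g (G.sg S g) (G.sg S (G.inv g)) := by
  have h := hP.mor (hP.sg_mem g) subset_rfl
  have e : G.cj g '' G.sg S g = G.sg S (G.inv g) := by
    apply Set.Subset.antisymm
    · rintro _ ⟨x, hx, rfl⟩
      exact sg_inv_mem hx
    · intro y hy
      have h1 := sg_inv_mem hy
      have h2 := sg_cj_inv hy
      rw [G.inv_inv] at h1 h2
      exact ⟨_, h1, h2⟩
  rwa [e] at h

lemma IsPreLocality.cj_mul_pair {a b x : L} (h : [a, b] ∈ G.D) (hx : x ∈ G.conjInto S [a, b]) :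
    x ∈ G.sg S (G.mul a b) ∧ G.cj (G.mul a b) x = G.cj b (G.cj a x) := by
  have h1 := (hP.via (hP.conjInto_mem h) subset_rfl)
  have ha := h1.uncons.1
  have hb := h1.uncons.2.uncons.1
  have h2 := hP.cj_comp ha hb (hP.mor_of_mem ha.src hx)
  exact ⟨hP.subset_sg (hP.mor_mul ha hb) hx, h2.2⟩

lemma IsPreLocality.sg_of_mem_S {s : L} (hs : s ∈ S) : G.sg S s = S :=
  (sg_subset s).antisymm (hP.subset_sg (hP.mor_of_mem hP.S_mem hs))

lemma IsPreLocality.sg_one : G.sg S G.one = S := hP.sg_of_mem_S hP.isSubgroup_S.one_mem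

end PreLocality

end PartialGroup

namespace PartialGroup

/-! ### Two facts on finite groups, stated for finite subgroups. -/

section FiniteGroups

variable {L : Type u} {G : PartialGroup L} {p : ℕ}

/-- Normalizers grow in finite `p`-subgroups. -/
lemma exists_larger_normalizer (hp : p.Prime) {E C : Set L} (hE : G.IsPSubgroup p E)
    (hEf : E.Finite) (hC : G.IsSubgroup C) (hCE : C ⊆ E) (hne : ¬ E ⊆ C) :
    ∃ B : Set L, G.IsSubgroup B ∧ C ⊆ B ∧ B ⊆ E ∧ (∀ b ∈ B, ∀ c ∈ C, G.cj b c ∈ C) ∧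
      ∃ a ∈ B, a ∉ C := by
  let _ := hE.1.group
  have : Fact p.Prime := ⟨hp⟩
  have : Finite E := hEf
  have hn : Group.IsNilpotent E := ((hE.1.isPGroup_iff p).2 hE).isNilpotent
  have hlt : hE.1.subgroupOf hC < ⊤ := by
    rw [lt_top_iff_ne_top]
    intro e
    exact hne fun x hx => (e ▸ Subgroup.mem_top (⟨x, hx⟩ : E) : (⟨x, hx⟩ : E) ∈ hE.1.subgroupOf hC)
  obtain ⟨hle, hnot⟩ := SetLike.lt_iff_le_and_exists.1
    (Group.normalizerCondition_of_isNilpotent _ hlt)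
  refine ⟨_, hE.1.coe_subgroup (Subgroup.normalizer (hE.1.subgroupOf hC : Set E)), ?_, ?_, ?_, ?_⟩
  · intro x hx
    exact ⟨⟨x, hCE hx⟩, hle hx, rfl⟩
  · rintro _ ⟨x, -, rfl⟩
    exact x.2
  · rintro _ ⟨b, hb, rfl⟩ c hc
    rw [← hE.1.coe_cj b ⟨c, hCE hc⟩]
    exact (Subgroup.mem_normalizer_iff''.1 hb ⟨c, hCE hc⟩).1 hc
  · obtain ⟨a, ha, ha'⟩ := hnot
    exact ⟨a, ⟨a, ha, rfl⟩, ha'⟩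

/-- Sylow's theorem in a finite subgroup. -/
lemma exists_conj_le_pSubgroup (hp : p.Prime) {F R : Set L} (hF : G.IsSubgroup F)
    (hFf : F.Finite) (hR : G.IsPSubgroup p R) (hRF : R ⊆ F) {a : L} (ha : a ∈ F)
    (hap : G.IsPElem p a) :
    ∃ B : Set L, G.IsPSubgroup p B ∧ B ⊆ F ∧ a ∈ B ∧ ∃ h ∈ F, ∀ r ∈ R, G.cj h r ∈ B := by
  let _ := hF.group
  have : Fact p.Prime := ⟨hp⟩
  have : Finite F := hFf
  have h1 : IsPGroup p (hF.subgroupOf hR.1) := by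
    rw [hF.isPGroup_subgroup_iff]
    convert hR
    ext x
    exact ⟨by rintro ⟨y, hy, rfl⟩; exact hy, fun hx => ⟨⟨x, hRF hx⟩, hx, rfl⟩⟩
  obtain ⟨k, hk⟩ := (hF.isPElem_iff p ⟨a, ha⟩).1 hap
  have h2 : IsPGroup p (Subgroup.zpowers (⟨a, ha⟩ : F)) := by
    rintro ⟨_, m, rfl⟩
    refine ⟨k, Subtype.ext ?_⟩
    change ((⟨a, ha⟩ : F) ^ m) ^ p ^ k = 1
    rw [← zpow_natCast, ← zpow_mul, mul_comm, zpow_mul, zpow_natCast, hk, one_zpow]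
  obtain ⟨P1, hP1⟩ := h2.exists_le_sylow
  obtain ⟨P2, hP2⟩ := h1.exists_le_sylow
  obtain ⟨g, rfl⟩ := MulAction.exists_smul_eq F P2 P1
  -- The action on Sylow subgroups is r ↦ g r g⁻¹ whereas `cj h r` is h⁻¹ r h; hence the witness
  -- g⁻¹.
  refine ⟨_, (hF.isPGroup_subgroup_iff p ((g • P2 : Sylow p F) : Subgroup F)).1
    (g • P2 : Sylow p F).isPGroup', ?_, ⟨_, hP1 (Subgroup.mem_zpowers _), rfl⟩,
    (g⁻¹ : F), Subtype.coe_prop _, ?_⟩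
  · rintro _ ⟨x, -, rfl⟩
    exact x.2
  · intro r hr
    rw [← hF.coe_cj g⁻¹ ⟨r, hRF hr⟩]
    refine ⟨_, ?_, rfl⟩
    have h3 : (⟨r, hRF hr⟩ : F) ∈ (P2 : Subgroup F) := hP2 hr
    have h4 := Subgroup.smul_mem_pointwise_smul _ (MulAut.conj g) _ h3
    rw [_root_.inv_inv]
    exact h4

end FiniteGroups

/-! ### The closure X^⋆, depth in Ω_S(L), and growth of normalizers. -/

section Star

variable {L : Type u} {G : PartialGroup L} {Δ : Set (Set L)} {S : Set L}

lemma subset_star (X : Set L) : X ⊆ G.star S X := Set.subset_iInter₂ fun _ h => h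

lemma mem_star {X : Set L} {x : L} :
    x ∈ G.star S X ↔ ∀ w, X ⊆ G.conjInto S w → x ∈ G.conjInto S w := Set.mem_iInter₂

lemma star_subset {X : Set L} {w : List L} (h : X ⊆ G.conjInto S w) :
    G.star S X ⊆ G.conjInto S w := fun _ hx => mem_star.1 hx w h

lemma star_subset_sg {X : Set L} {g : L} (h : X ⊆ G.sg S g) : G.star S X ⊆ G.sg S g := by
  rw [← conjInto_single] at h ⊢
  exact star_subset h

lemma star_subset_S {X : Set L} (h : X ⊆ S) : G.star S X ⊆ S := star_subset (w := []) h

lemma star_subset_star {X Y : Set L} (h : X ⊆ G.star S Y) : G.star S X ⊆ G.star S Y :=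
  fun _ hx => mem_star.2 fun w hw => mem_star.1 hx w (h.trans (star_subset hw))

lemma star_mono {X Y : Set L} (h : X ⊆ Y) : G.star S X ⊆ G.star S Y :=
  star_subset_star (h.trans (subset_star Y))

lemma star_star (X : Set L) : G.star S (G.star S X) = G.star S X :=
  (star_subset_star subset_rfl).antisymm (subset_star _)

lemma star_conjInto (w : List L) : G.star S (G.conjInto S w) = G.conjInto S w :=
  (star_subset subset_rfl).antisymm (subset_star _)

lemma star_sg (g : L) : G.star S (G.sg S g) = G.sg S g := by
  rw [← conjInto_single, star_conjInto]

lemma star_S : G.star S S = S := star_conjInto (G := G) (S := S) []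

/-- If X^g ⊆ S_w then X ⊆ S_{(g,w)}, and so X^⋆ ⊆ S_{(g,w)}. -/
lemma cj_mem_star {X : Set L} {g x : L} (h : X ⊆ G.sg S g) (hx : x ∈ G.star S X) :
    G.cj g x ∈ G.star S (G.cj g '' X) := by
  rw [mem_star]
  intro w hw
  have : X ⊆ G.conjInto S (g :: w) := fun y hy => mem_conjInto_cons.2 ⟨h hy, hw ⟨y, hy, rfl⟩⟩
  exact (mem_conjInto_cons.1 (star_subset this hx)).2

lemma image_cj_inv {X : Set L} {g : L} (h : X ⊆ G.sg S g) :
    G.cj (G.inv g) '' (G.cj g '' X) = X := by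
  rw [Set.image_image]
  exact (Set.image_congr fun x hx => sg_cj_inv (h hx)).trans (Set.image_id X)

lemma image_subset_sg_inv {X : Set L} {g : L} (h : X ⊆ G.sg S g) :
    G.cj g '' X ⊆ G.sg S (G.inv g) := by
  rintro _ ⟨x, hx, rfl⟩
  exact sg_inv_mem (h hx)

lemma cj_image_star {X : Set L} {g : L} (h : X ⊆ G.sg S g) :
    G.cj g '' G.star S X = G.star S (G.cj g '' X) := by
  apply Set.Subset.antisymm
  · rintro _ ⟨x, hx, rfl⟩
    exact cj_mem_star h hx
  · intro y hy
    have h1 := image_subset_sg_inv h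
    have h2 := cj_mem_star h1 hy
    rw [image_cj_inv h] at h2
    refine ⟨_, h2, ?_⟩
    have := sg_cj_inv (star_subset_sg h1 hy)
    rwa [G.inv_inv] at this

lemma IsPreLocality.isSubgroup_star (hP : G.IsPreLocality Δ S) {X : Set L} (h : X ⊆ S) :
    G.IsSubgroup (G.star S X) := by
  refine hP.isSubgroup_S.of_subset (star_subset_S h) ?_ ?_ ?_
  · exact mem_star.2 fun w _ => (hP.isSubgroup_conjInto w).one_mem
  · exact fun x hx => mem_star.2 fun w hw =>
      (hP.isSubgroup_conjInto w).inv_mem _ (mem_star.1 hx w hw)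
  · exact fun x hx y hy => mem_star.2 fun w hw =>
      (hP.isSubgroup_conjInto w).mul_mem (mem_star.1 hx w hw) (mem_star.1 hy w hw)

lemma IsPreLocality.star_mem_Omega (hP : G.IsPreLocality Δ S) {X : Set L} (h : X ⊆ S) :
    G.star S X ∈ G.Omega S :=
  ⟨_, hP.isSubgroup_star h, star_subset_S h, (star_star X).symm⟩

lemma star_of_mem_Omega {X : Set L} (h : X ∈ G.Omega S) : G.star S X = X := by
  obtain ⟨Y, -, -, rfl⟩ := h
  exact star_star Y

lemma subset_of_mem_Omega {X : Set L} (h : X ∈ G.Omega S) : X ⊆ S := by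
  obtain ⟨Y, -, h, rfl⟩ := h
  exact star_subset_S h

lemma IsPreLocality.star_mem_of_subset (hP : G.IsPreLocality Δ S) {P X : Set L} (h : P ∈ Δ)
    (hPX : P ⊆ G.star S X) (hX : X ⊆ S) : G.star S X ∈ Δ :=
  hP.mem_of_le h (hP.isSubgroup_star hX) hPX (star_subset_S hX)

lemma IsPreLocality.star_mem (hP : G.IsPreLocality Δ S) {P : Set L} (h : P ∈ Δ) :
    G.star S P ∈ Δ := hP.star_mem_of_subset h (subset_star P) (hP.subset_S P h)

/-- There is a chain of length `n` in `Ω_S(L)` that ends at `X^⋆`. -/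
def HasDepth (G : PartialGroup L) (S : Set L) : ℕ → Set L → Prop
  | 0, _ => True
  | n + 1, X => ∃ Y ⊆ S, G.star S Y ⊂ G.star S X ∧ HasDepth G S n Y

/-- The dimension of `X^⋆` in the poset `Ω_S(L)`. -/
noncomputable def depth (G : PartialGroup L) (S X : Set L) : ℕ := sSup {n | G.HasDepth S n X}

lemma HasDepth.mono {n : ℕ} {X Y : Set L} (h : G.HasDepth S n X) (hXY : X ⊆ G.star S Y) :
    G.HasDepth S n Y := by
  cases n with
  | zero => trivial
  | succ n =>
    obtain ⟨Z, hZ, hlt, hd⟩ := h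
    exact ⟨Z, hZ, hlt.trans_subset (star_subset_star hXY), hd⟩

lemma HasDepth.image {n : ℕ} {X : Set L} {g : L} (h : G.HasDepth S n X) (hg : X ⊆ G.sg S g) :
    G.HasDepth S n (G.cj g '' X) := by
  induction n generalizing X with
  | zero => trivial
  | succ n ih =>
    obtain ⟨Z, hZ, hlt, hd⟩ := h
    have h1 := star_subset_sg hg
    have hZg : Z ⊆ G.sg S g := (subset_star Z).trans (hlt.subset.trans h1)
    refine ⟨G.cj g '' Z, ?_, ?_, ih hd hZg⟩
    · rintro _ ⟨z, hz, rfl⟩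
      exact (hZg hz).2.2
    · rw [← cj_image_star hZg, ← cj_image_star hg]
      refine ⟨Set.image_mono hlt.subset, fun hle => hlt.not_subset fun x hx => ?_⟩
      obtain ⟨z, hz, e⟩ := hle ⟨x, hx, rfl⟩
      have h2 := sg_cj_inv (h1 hx)
      rw [← e, sg_cj_inv (h1 (hlt.subset hz))] at h2
      rwa [← h2]

variable (hP : G.IsPreLocality Δ S) (hf : Order.krullDim (G.Omega S) < ⊤)

include hP in
lemma HasDepth.exists_ltSeries {n : ℕ} {X : Set L} (h : G.HasDepth S n X) (hX : X ⊆ S) :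
    ∃ l : LTSeries (G.Omega S), l.length = n ∧ (l.last : Set L) = G.star S X := by
  induction n generalizing X with
  | zero => exact ⟨RelSeries.singleton _ ⟨_, hP.star_mem_Omega hX⟩, rfl, rfl⟩
  | succ n ih =>
    obtain ⟨Z, hZ, hlt, hd⟩ := h
    obtain ⟨l, hl, e⟩ := ih hd hZ
    refine ⟨l.snoc ⟨_, hP.star_mem_Omega hX⟩ ?_, ?_, ?_⟩
    · change (l.last : Set L) < G.star S X
      rw [e]
      exact hlt
    · simp [hl]
    · simp

include hP hf

lemma IsPreLocality.exists_depth_bound :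
    ∃ M : ℕ, ∀ n X, X ⊆ S → G.HasDepth S n X → n ≤ M := by
  obtain ⟨M, hM⟩ : ∃ M : ℕ, Order.krullDim (G.Omega S) ≤ M := by
    induction h : Order.krullDim (G.Omega S) with
    | bot => exact ⟨0, bot_le⟩
    | coe a =>
      rw [h] at hf
      have : a ≠ ⊤ := by
        rintro rfl
        exact lt_irrefl _ hf
      obtain ⟨m, rfl⟩ := ENat.ne_top_iff_exists.1 this
      exact ⟨m, le_rfl⟩
  refine ⟨M, fun n X hX h => ?_⟩
  obtain ⟨l, hl, -⟩ := h.exists_ltSeries hP hX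
  have := (Order.LTSeries.length_le_krullDim l).trans hM
  rw [hl] at this
  exact_mod_cast this

lemma IsPreLocality.bddAbove_depth {X : Set L} (hX : X ⊆ S) :
    BddAbove {n | G.HasDepth S n X} := by
  obtain ⟨M, hM⟩ := hP.exists_depth_bound hf
  exact ⟨M, fun n hn => hM n X hX hn⟩

lemma IsPreLocality.hasDepth_depth {X : Set L} (hX : X ⊆ S) :
    G.HasDepth S (G.depth S X) X :=
  Nat.sSup_mem (s := {n | G.HasDepth S n X}) ⟨0, trivial⟩ (hP.bddAbove_depth hf hX)

lemma IsPreLocality.le_depth {X : Set L} (hX : X ⊆ S) {n : ℕ} (h : G.HasDepth S n X) :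
    n ≤ G.depth S X := le_csSup (hP.bddAbove_depth hf hX) h

lemma IsPreLocality.exists_depth_le : ∃ M : ℕ, ∀ X, X ⊆ S → G.depth S X ≤ M := by
  obtain ⟨M, hM⟩ := hP.exists_depth_bound hf
  exact ⟨M, fun X hX => hM _ X hX (hP.hasDepth_depth hf hX)⟩

lemma IsPreLocality.depth_mono {X Y : Set L} (hXY : X ⊆ G.star S Y) (hY : Y ⊆ S) :
    G.depth S X ≤ G.depth S Y :=
  hP.le_depth hf hY
    ((hP.hasDepth_depth hf (hXY.trans (star_subset_S hY))).mono hXY)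

/-- Otherwise X^⋆ is strictly smaller than Y^⋆ and a longest chain ending at X^⋆ could be prolonged.
This does the work of comparing orders of finite groups. -/
lemma IsPreLocality.subset_star_of_depth_le {X Y : Set L} (hXY : X ⊆ G.star S Y) (hY : Y ⊆ S)
    (h : G.depth S Y ≤ G.depth S X) : Y ⊆ G.star S X := by
  by_contra hn
  have hX := hXY.trans (star_subset_S hY)
  have h1 : G.star S X ⊂ G.star S Y :=
    ⟨star_subset_star hXY, fun hle => hn ((subset_star Y).trans hle)⟩
  have := hP.le_depth hf hY (n := G.depth S X + 1) ⟨X, hX, h1, hP.hasDepth_depth hf hX⟩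
  omega

lemma IsPreLocality.depth_lt {X Y : Set L} (hXY : X ⊆ G.star S Y) (hY : Y ⊆ S)
    (h : ¬ Y ⊆ G.star S X) : G.depth S X < G.depth S Y := by
  by_contra hn
  exact h (hP.subset_star_of_depth_le hf hXY hY (not_lt.1 hn))

lemma IsPreLocality.depth_star {X : Set L} (hX : X ⊆ S) :
    G.depth S (G.star S X) = G.depth S X :=
  (hP.depth_mono hf subset_rfl hX).antisymm
    (hP.depth_mono hf ((subset_star X).trans (subset_star _)) (star_subset_S hX))

lemma IsPreLocality.depth_image {X : Set L} {g : L} (hg : X ⊆ G.sg S g) :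
    G.depth S (G.cj g '' X) = G.depth S X := by
  have key : ∀ {Y : Set L} {h : L}, Y ⊆ G.sg S h → G.depth S Y ≤ G.depth S (G.cj h '' Y) := by
    intro Y h hh
    refine hP.le_depth hf ?_ ((hP.hasDepth_depth hf (hh.trans (sg_subset h))).image hh)
    rintro _ ⟨y, hy, rfl⟩
    exact (hh hy).2.2
  refine le_antisymm ?_ (key hg)
  have := key (image_subset_sg_inv hg)
  rwa [image_cj_inv hg] at this

lemma IsPreLocality.exists_max_depth {α : Type*} (A : Set α) (hA : A.Nonempty) (φ : α → Set L)
    (hφ : ∀ a ∈ A, φ a ⊆ S) :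
    ∃ a ∈ A, ∀ b ∈ A, G.depth S (φ b) ≤ G.depth S (φ a) := by
  obtain ⟨M, hM⟩ := hP.exists_depth_le hf
  have hb : BddAbove ((fun a => G.depth S (φ a)) '' A) := by
    refine ⟨M, ?_⟩
    rintro _ ⟨a, ha, rfl⟩
    exact hM _ (hφ a ha)
  obtain ⟨a, ha, e⟩ := Nat.sSup_mem (hA.image _) hb
  refine ⟨a, ha, fun b hbA => ?_⟩
  change G.depth S (φ a) = _ at e
  rw [e]
  exact le_csSup hb ⟨b, hbA, rfl⟩

/-- A finite subset of X of greatest depth will do: adjoining a further point of X cannot enlarge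
its closure. This is what makes local finiteness usable for infinite P. -/
lemma IsPreLocality.exists_finite_star {X : Set L} (hX : X ⊆ S) :
    ∃ F ⊆ X, F.Finite ∧ X ⊆ G.star S F := by
  obtain ⟨F, hF, hmax⟩ := hP.exists_max_depth hf {F : Set L | F ⊆ X ∧ F.Finite}
    ⟨∅, Set.empty_subset _, Set.finite_empty⟩ id fun F hF => hF.1.trans hX
  refine ⟨F, hF.1, hF.2, fun x hx => ?_⟩
  have h1 : insert x F ⊆ X := Set.insert_subset hx hF.1
  exact hP.subset_star_of_depth_le hf ((Set.subset_insert x F).trans (subset_star _))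
    (h1.trans hX) (hmax _ ⟨h1, hF.2.insert x⟩) (Set.mem_insert x F)

/-- If `g` conjugates `X` into `X`, then it normalizes `X^⋆`. -/
lemma IsPreLocality.image_star_eq {X : Set L} {g : L} (hg : X ⊆ G.sg S g)
    (h : G.cj g '' X ⊆ G.star S X) : G.cj g '' G.star S X = G.star S X := by
  have hX := hg.trans (sg_subset g)
  rw [cj_image_star hg]
  refine (star_subset_star h).antisymm (star_subset_star ?_)
  -- Conjugation preserves depth, so the inclusion of X^g in X^⋆ forces equal closures.
  exact hP.subset_star_of_depth_le hf h hX (hP.depth_image hf hg).ge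

lemma IsPreLocality.mor_star {X : Set L} {g : L} (hX : G.star S X ∈ Δ) (hg : X ⊆ G.sg S g)
    (h : G.cj g '' X ⊆ G.star S X) : G.Mor Δ g (G.star S X) (G.star S X) := by
  have := hP.mor hX (star_subset_sg hg)
  rwa [hP.image_star_eq hf hg h] at this

/-- Normalizers grow over members of `Ω_S(L)`. -/
lemma IsPreLocality.exists_normalizing {p : ℕ} (hp : p.Prime) {P R : Set L} (hPS : P ⊆ S)
    (hstar : G.star S P = P) (hR : G.IsPSubgroup p R) (hloc : G.IsLocallyFinite R) (hPR : P ⊆ R)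
    (hne : ¬ R ⊆ P) : ∃ a ∈ R, a ∉ P ∧ P ⊆ G.sg S a ∧ G.cj a '' P = P := by
  obtain ⟨q, hqR, hqP⟩ := Set.not_subset.1 hne
  obtain ⟨F, hFP, hFf, hPF⟩ := hP.exists_finite_star hf hPS
  obtain ⟨E, hE, hEf, hFE, hER⟩ := hloc (insert q F) (Set.insert_subset hqR (hFP.trans hPR))
    (hFf.insert q)
  have hEp : G.IsPSubgroup p E := ⟨hE, fun x hx => hR.2 x (hER hx)⟩
  have hPsub : G.IsSubgroup P := by
    rw [← hstar]
    exact hP.isSubgroup_star hPS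
  have hC : G.IsSubgroup (E ∩ P) := hE.of_subset Set.inter_subset_left
    ⟨hE.one_mem, hPsub.one_mem⟩ (fun x hx => ⟨hE.inv_mem x hx.1, hPsub.inv_mem x hx.2⟩)
    fun x hx y hy => ⟨hE.mul_mem hx.1 hy.1, hPsub.mul_mem hx.2 hy.2⟩
  obtain ⟨B, hB, -, hBE, hconj, a, haB, haC⟩ := exists_larger_normalizer hp hEp hEf hC
    Set.inter_subset_left fun h => hqP (h (hFE (Set.mem_insert q F))).2
  have haE := hBE haB
  -- E contains a finite set whose closure contains P. Hence whatever normalizes the finite group E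
  -- ∩ P also normalizes P.
  have e : G.star S (E ∩ P) = P := by
    apply Set.Subset.antisymm
    · exact (star_mono Set.inter_subset_right).trans hstar.subset
    · exact hPF.trans (star_mono fun x hx => ⟨hFE (Set.mem_insert_of_mem q hx), hFP hx⟩)
  have h1 : E ∩ P ⊆ G.sg S a := fun x hx =>
    ⟨hPS hx.2, hE.mem_D _ (by simp [hx.1, haE, hE.inv_mem]), hPS (hconj a haB x hx).2⟩
  have h2 : G.cj a '' (E ∩ P) ⊆ G.star S (E ∩ P) := by
    rintro _ ⟨x, hx, rfl⟩
    exact subset_star _ (hconj a haB x hx)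
  have h3 := hP.image_star_eq hf h1 h2
  have h4 := star_subset_sg h1
  rw [e] at h3 h4
  exact ⟨a, hER haE, fun h => haC ⟨haE, h⟩, h4, h3⟩

end Star

end PartialGroup

namespace PartialGroup

/-! ### Sylow's theorem in a locality. -/

section Sylow

variable {L : Type u} {G : PartialGroup L} {Δ : Set (Set L)} {S : Set L} {p : ℕ}

lemma exists_max_of_bounded {α : Type*} {A : Set α} (hA : A.Nonempty) (f : α → ℕ) (M : ℕ)
    (hf : ∀ a ∈ A, f a ≤ M) : ∃ a ∈ A, ∀ b ∈ A, f b ≤ f a := by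
  have hb : BddAbove (f '' A) := ⟨M, by rintro _ ⟨a, ha, rfl⟩; exact hf a ha⟩
  obtain ⟨a, ha, e⟩ := Nat.sSup_mem (hA.image _) hb
  exact ⟨a, ha, fun b hbA => e ▸ le_csSup hb ⟨b, hbA, rfl⟩⟩

/-- The `p`-elements that normalize `S` lie in `S`. -/
lemma IsLocality.mem_S_of_isPElem (hL : G.IsLocality p Δ S) {r : L} (hr : r ∈ G.nz Δ S)
    (hp : G.IsPElem p r) : r ∈ S := by
  have hN := hL.nz_isSubgroup hL.S_mem
  have hS := hL.isSubgroup_S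
  have hSN : S ⊆ G.nz Δ S := fun x hx => hL.mor_of_mem hL.S_mem hx
  let _ := hN.group
  have : Fact p.Prime := ⟨hL.prime⟩
  have e : Subtype.val '' (hN.subgroupOf hS : Set (G.nz Δ S)) = S := by
    ext x
    exact ⟨by rintro ⟨y, hy, rfl⟩; exact hy, fun hx => ⟨⟨x, hSN hx⟩, hx, rfl⟩⟩
  have h1 : IsPGroup p (hN.subgroupOf hS) := by
    rw [hN.isPGroup_subgroup_iff, e]
    exact hL.isPSubgroup
  obtain ⟨k, hk⟩ := (hN.isPElem_iff p ⟨r, hr⟩).1 hp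
  have h2 : IsPGroup p (Subgroup.zpowers (⟨r, hr⟩ : G.nz Δ S)) := by
    rintro ⟨_, m, rfl⟩
    refine ⟨k, Subtype.ext ?_⟩
    change ((⟨r, hr⟩ : G.nz Δ S) ^ m) ^ p ^ k = 1
    rw [← zpow_natCast, ← zpow_mul, mul_comm, zpow_mul, zpow_natCast, hk, one_zpow]
  have hnorm : (hN.subgroupOf hS).Normal := by
    refine ⟨fun n hn g => ?_⟩
    have h3 := hN.coe_cj g⁻¹ n
    rw [_root_.inv_inv] at h3
    change ((g * n * g⁻¹ : G.nz Δ S) : L) ∈ S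
    rw [h3]
    exact Mor.image_mem (g⁻¹ : G.nz Δ S).2 hn
  -- S is normal in its normalizer, so ⟨r⟩S is a p-group, and the maximality of S applies.
  have h4 := (hN.isPGroup_subgroup_iff p _).1 (h2.to_sup_of_normal_right h1)
  have h5 := hL.maximal _ h4 fun x hx =>
    ⟨⟨x, hSN hx⟩, Subgroup.mem_sup_right (show (⟨x, hSN hx⟩ : G.nz Δ S) ∈ hN.subgroupOf hS from hx),
      rfl⟩
  rw [← h5]
  exact ⟨⟨r, hr⟩, Subgroup.mem_sup_left (Subgroup.mem_zpowers _), rfl⟩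

/-- Sylow's theorem in a locality: if `K` contains `S` and is closed under inversion and products,
then a finite `p`-subgroup in `K` that normalizes an object is conjugate by an element of `K` to a
subgroup of `S`. -/
theorem IsLocality.exists_conj_into (hL : G.IsLocality p Δ S) {K : Set L} (hSK : S ⊆ K)
    (hinv : ∀ x ∈ K, G.inv x ∈ K) (hmul : ∀ a ∈ K, ∀ b ∈ K, [a, b] ∈ G.D → G.mul a b ∈ K)
    {P R : Set L} (hPΔ : P ∈ Δ) (hRf : R.Finite) (hR : G.IsPSubgroup p R) (hRK : R ⊆ K)
    (hRP : R ⊆ G.nz Δ P) : ∃ g ∈ K, P ⊆ G.sg S g ∧ ∀ r ∈ R, G.cj g r ∈ S := by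
  obtain ⟨M, hM⟩ := hL.exists_depth_le hL.finite_dim
  have hf := hL.finite_dim
  induction hn : M - G.depth S P using Nat.strong_induction_on generalizing P R with
  | _ n ih =>
  have hPS := hL.subset_S P hPΔ
  set P1 := G.star S P with hP1
  have hP1Δ : P1 ∈ Δ := hL.star_mem hPΔ
  have hP1S : P1 ⊆ S := star_subset_S hPS
  have hRP1 : R ⊆ G.nz Δ P1 := fun r hr => by
    refine hL.mor_star hf hP1Δ (hL.subset_sg (hRP hr)) ?_
    rw [(hRP hr).img]
    exact subset_star P
  have hstar : G.star S P1 = P1 := star_star P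
  have hd : G.depth S P1 = G.depth S P := hL.depth_star hf hPS
  suffices ∃ g ∈ K, P1 ⊆ G.sg S g ∧ ∀ r ∈ R, G.cj g r ∈ S by
    obtain ⟨g, hg, h1, h2⟩ := this
    exact ⟨g, hg, (subset_star P).trans h1, h2⟩
  clear_value P1
  -- At the top of the induction R normalizes S, and its p-elements already lie in S.
  by_cases hSP : S ⊆ P1
  · obtain rfl : P1 = S := hP1S.antisymm hSP
    refine ⟨G.one, hSK hL.isSubgroup_S.one_mem, hL.sg_one.ge, fun r hr => ?_⟩
    rw [(G.one_cj r).2]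
    exact hL.mem_S_of_isPElem (hRP1 hr) (hR.2 r hr)
  -- The p-group B found below contains a and a conjugate of R, so it is enough to conjugate B into
  -- S.
  obtain ⟨a, haS, haP, hag, haeq⟩ := hL.exists_normalizing hf hL.prime hP1S hstar
    hL.isPSubgroup (hL.locallyFinite S hL.isSubgroup_S) hP1S hSP
  have haN : G.Mor Δ a P1 P1 := by
    have := hL.mor hP1Δ hag
    rwa [haeq] at this
  have hNs := hL.nz_isSubgroup hP1Δ
  have hNK : G.IsSubgroup (G.nz Δ P1 ∩ K) := hNs.of_subset Set.inter_subset_left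
    ⟨hNs.one_mem, hSK hL.isSubgroup_S.one_mem⟩
    (fun x hx => ⟨hNs.inv_mem x hx.1, hinv x hx.2⟩)
    fun x hx y hy => ⟨hNs.mul_mem hx.1 hy.1, hmul x hx.2 y hy.2 (hL.mul_mem_D hx.1 hy.1)⟩
  obtain ⟨F, hF, hFf, hRF, hFN⟩ := hL.locallyFinite _ hNK (insert a R)
    (Set.insert_subset ⟨haN, hSK haS⟩ fun r hr => ⟨hRP1 hr, hRK hr⟩) (hRf.insert a)
  obtain ⟨B, hB, hBF, haB, h, hhF, hRB⟩ := exists_conj_le_pSubgroup hL.prime hF hFf hR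
    ((Set.subset_insert a R).trans hRF) (hRF (Set.mem_insert a R)) (hL.isPSubgroup.2 a haS)
  have hBf := hFf.subset hBF
  have hBN : B ⊆ G.nz Δ P1 := fun b hb => (hFN (hBF hb)).1
  -- C g is the part of B that g takes into S. The depth condition in A makes the induction
  -- hypothesis available for (P1 ∪ C g)^g; the identity satisfies it because a ∈ C 1 lies outside
  -- P1.
  let C : L → Set L := fun g => {b | b ∈ B ∧ G.cj g b ∈ S}
  let A : Set L := {g | g ∈ K ∧ P1 ⊆ G.sg S g ∧
    G.depth S P1 < G.depth S (G.cj g '' (P1 ∪ C g))}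
  have hone : G.one ∈ A := by
    have e : G.cj G.one '' (P1 ∪ C G.one) = P1 ∪ C G.one :=
      (Set.image_congr fun x _ => (G.one_cj x).2).trans (Set.image_id _)
    refine ⟨hSK hL.isSubgroup_S.one_mem, hP1S.trans hL.sg_one.ge, ?_⟩
    rw [e]
    refine hL.depth_lt hf (Set.subset_union_left.trans (subset_star _)) ?_ ?_
    · refine Set.union_subset hP1S fun b hb => ?_
      have := hb.2
      rwa [(G.one_cj b).2] at this
    · rw [hstar]
      intro hle
      refine haP (hle (Or.inr ⟨haB, ?_⟩))
      rwa [(G.one_cj a).2]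
  obtain ⟨g, hgA, hmax⟩ := exists_max_of_bounded ⟨_, hone⟩ (fun g => (C g).ncard) B.ncard
    fun g _ => Set.ncard_le_ncard (fun b hb => hb.1) hBf
  obtain ⟨hgK, hPg, hdg⟩ := hgA
  have hg := hL.mor hP1Δ hPg
  by_cases hBC : B ⊆ C g
  · have hh := hFN (hhF)
    refine ⟨G.mul h g, hmul _ hh.2 _ hgK (hL.mul_mem_D hh.1 hg),
      hL.subset_sg (hL.mor_mul hh.1 hg), fun r hr => ?_⟩
    rw [(hL.cj_comp hh.1 hg (hRP1 hr)).2]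
    exact (hBC (hRB r hr)).2
  exfalso
  have hCs : G.IsSubgroup (C g) := by
    have hS := hL.isSubgroup_S
    refine hB.1.of_subset (fun b hb => hb.1) ⟨hB.1.one_mem, ?_⟩ ?_ ?_
    · rw [(G.cj_one_elem g).2]
      exact hS.one_mem
    · intro x hx
      refine ⟨hB.1.inv_mem x hx.1, ?_⟩
      rw [(G.cj_inv_elem (hL.cj_mem_D hg (hBN hx.1))).2]
      exact hS.inv_mem _ hx.2
    · intro x hx y hy
      refine ⟨hB.1.mul_mem hx.1 hy.1, ?_⟩
      rw [hL.cj_mul hg (hBN hx.1) (hBN hy.1)]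
      exact hS.mul_mem hx.2 hy.2
  -- E^g normalizes the closure of U, which is deeper than P1. Induction gives k conjugating E^g
  -- into S, and then C (gk) is larger than C g, against the choice of g.
  obtain ⟨E, hE, hCE, hEB, hconj, c, hcE, hcC⟩ := exists_larger_normalizer hL.prime hB hBf hCs
    (fun b hb => hb.1) hBC
  set U := G.cj g '' (P1 ∪ C g) with hU
  have hUS : U ⊆ S := by
    rintro _ ⟨x, hx | hx, rfl⟩
    · exact (hPg hx).2.2
    · exact hx.2
  have hXN : P1 ∪ C g ⊆ G.nz Δ P1 :=
    Set.union_subset (fun x hx => hL.mor_of_mem hP1Δ hx) fun x hx => hBN hx.1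
  have hQU : G.cj g '' P1 ⊆ U := Set.image_mono Set.subset_union_left
  have hUΔ : G.star S U ∈ Δ := hL.star_mem_of_subset hg.tgt (hQU.trans (subset_star U)) hUS
  have hEN : G.cj g '' E ⊆ G.nz Δ (G.star S U) := by
    rintro _ ⟨b, hb, rfl⟩
    have hbN := hBN (hEB hb)
    have key : ∀ u ∈ U, [G.inv (G.cj g b), u, G.cj g b] ∈ G.D ∧ G.cj (G.cj g b) u ∈ U := by
      rintro _ ⟨x, hx, rfl⟩
      refine ⟨hL.cj_mem_D (hL.mor_cj hg hbN) (hL.mor_cj hg (hXN hx)), ?_⟩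
      rw [hL.cj_cj hg hbN (hXN hx)]
      refine ⟨_, ?_, rfl⟩
      rcases hx with hx | hx
      · exact Or.inl (Mor.image_mem hbN hx)
      · exact Or.inr (hconj b hb x hx)
    refine hL.mor_star hf hUΔ (fun u hu => ⟨hUS hu, (key u hu).1, hUS (key u hu).2⟩) ?_
    rintro _ ⟨u, hu, rfl⟩
    exact subset_star U (key u hu).2
  have hEp : G.IsPSubgroup p E := ⟨hE, fun x hx => hB.2 x (hEB hx)⟩
  have hEK : G.cj g '' E ⊆ K := by
    rintro _ ⟨b, hb, rfl⟩
    have hbN := hFN (hBF (hEB hb))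
    rw [G.cj_eq_mul (hL.cj_mem_D hg hbN.1)]
    exact hmul _ (hmul _ (hinv g hgK) b hbN.2 (hL.mul_mem_D hg.inv hbN.1)) g hgK
      (hL.mul_mem_D (hL.mor_mul hg.inv hbN.1) hg)
  obtain ⟨k, hkK, hUk, hEk⟩ := ih (M - G.depth S (G.star S U)) (by
      have h1 := hM P1 hP1S
      have h2 := hM (G.star S U) (star_subset_S hUS)
      have h3 := hL.depth_star hf hUS
      omega) hUΔ ((hBf.subset hEB).image _)
    (hL.isPSubgroup_cj hg hEp fun x hx => hBN (hEB hx)) hEK hEN rfl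
  have hk := hL.mor hg.tgt ((hQU.trans (subset_star U)).trans hUk)
  have hgk : ∀ x ∈ G.nz Δ P1, G.cj (G.mul g k) x = G.cj k (G.cj g x) :=
    fun x hx => (hL.cj_comp hg hk hx).2
  have hCC : C g ⊆ C (G.mul g k) := by
    intro b hb
    refine ⟨hb.1, ?_⟩
    rw [hgk b (hBN hb.1)]
    exact (hUk (subset_star U ⟨b, Or.inr hb, rfl⟩)).2.2
  have hcC' : c ∈ C (G.mul g k) := by
    refine ⟨hEB hcE, ?_⟩
    rw [hgk c (hBN (hEB hcE))]
    exact hEk _ ⟨c, hcE, rfl⟩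
  have hA' : G.mul g k ∈ A := by
    refine ⟨hmul g hgK k hkK (hL.mul_mem_D hg hk), hL.subset_sg (hL.mor_mul hg hk), ?_⟩
    have h1 := (subset_star U).trans hUk
    refine (hdg.trans_le (hL.depth_image hf h1).ge).trans_le (hL.depth_mono hf ?_ ?_)
    · refine subset_trans ?_ (subset_star _)
      rintro _ ⟨_, ⟨x, hx, rfl⟩, rfl⟩
      rw [← hgk x (hXN hx)]
      exact ⟨x, hx.imp_right fun hx => hCC hx, rfl⟩
    · rintro _ ⟨x, hx | hx, rfl⟩
      · exact (hL.subset_sg (hL.mor_mul hg hk) hx).2.2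
      · exact hx.2
  have := Set.ncard_lt_ncard (s := C g) (t := C (G.mul g k))
    ⟨hCC, fun hle => hcC (hle hcC')⟩ (hBf.subset fun b hb => hb.1)
  exact absurd (hmax _ hA') (not_le.2 this)

end Sylow

end PartialGroup

namespace PartialGroup

/-! ### Partial normal subgroups and the Frattini argument. -/

section Normal

variable {L : Type u} {G : PartialGroup L} {Δ : Set (Set L)} {S : Set L} {p : ℕ} {N : Set L}

lemma IsPreLocality.mem_sg_of_nz (hP : G.IsPreLocality Δ S) {g h : L} {P Q : Set L}
    (hg : G.Mor Δ g P Q) (hh : G.Mor Δ h P P) (hS : h ∈ S) (hgS : G.cj g h ∈ S) :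
    h ∈ G.sg S g := ⟨hS, hP.cj_mem_D hg hh, hgS⟩

lemma IsPreLocality.subset_pair (hP : G.IsPreLocality Δ S) {a b : L} {P Q R : Set L}
    (ha : G.Mor Δ a P Q) (hb : G.Mor Δ b Q R) : P ⊆ G.conjInto S [a, b] :=
  hP.subset_conjInto (ha.cons hb.single)

lemma IsPreLocality.mor_pair (hP : G.IsPreLocality Δ S) {a b : L} {P : Set L} (h : P ∈ Δ)
    (hab : P ⊆ G.conjInto S [a, b]) :
    G.Mor Δ a P (G.cj a '' P) ∧ G.Mor Δ b (G.cj a '' P) (G.cj b '' (G.cj a '' P)) := by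
  have := hP.via h hab
  exact ⟨this.uncons.1, this.uncons.2.uncons.1⟩

lemma Mor.unique {g : L} {P Q R : Set L} (h : G.Mor Δ g P Q) (h' : G.Mor Δ g P R) : Q = R :=
  h.img.symm.trans h'.img

lemma isSubgroup_inter (hP : G.IsPreLocality Δ S) (hN : G.IsPartialNormal N) :
    G.IsSubgroup (S ∩ N) := by
  have hS := hP.isSubgroup_S
  refine hS.of_subset Set.inter_subset_left ⟨hS.one_mem, hN.one_mem⟩
    (fun x hx => ⟨hS.inv_mem x hx.1, hN.inv_mem x hx.2⟩) fun x hx y hy =>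
    ⟨hS.mul_mem hx.1 hy.1, hN.mul_mem (hS.mem_D _ (by simp [hx.1, hy.1])) hx.2 hy.2⟩

/-- The factor is the commutator a⁻¹ a^x: it lies in S, and as (x⁻¹)^a · x it lies in N. -/
lemma exists_cj_eq_mul (hP : G.IsPreLocality Δ S) (hN : G.IsPartialNormal N) {x a : L}
    (hx : x ∈ N) (ha : a ∈ G.sg S x) : ∃ t ∈ S ∩ N, G.cj x a = G.mul a t := by
  have hS := hP.isSubgroup_S
  have h1 := hP.mor_sg (S := S) x
  have h2 := hP.mor_of_mem (hP.sg_mem x) ha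
  have h3 := hP.mor_of_mem_S (hP.sg_mem (G.inv x)) ha.1
  have hD : [G.inv a, G.inv x, a, x] ∈ G.D :=
    hP.mem_D (h3.inv.cons (h1.inv.cons (h2.cons h1.single)))
  have e1 := G.pr_mid [G.inv a] [G.inv x, a, x] [] hD
  have e2 := G.pr_mid [] [G.inv a, G.inv x, a] [x] hD
  refine ⟨G.mul (G.inv a) (G.cj x a), ⟨hS.mul_mem (hS.inv_mem a ha.1) ha.2.2, ?_⟩, ?_⟩
  · have : G.mul (G.inv a) (G.cj x a) = G.mul (G.cj a (G.inv x)) x := e1.2.trans e2.2.symm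
    rw [this]
    exact hN.mul_mem e2.1 (hN.cj_mem (G.mem_left (u := [G.inv a, G.inv x, a]) (v := [x]) hD)
      (hN.inv_mem x hx)) hx
  · have := G.inv_mul_cancel' (a := G.inv a) (b := G.cj x a)
      (hS.mem_D _ (by simp [hS.inv_mem, ha.1, ha.2.2]))
    rw [G.inv_inv] at this
    exact this.symm

/-- Conjugation by elements of `N` preserves membership in the subgroups of `S` over `S ∩ N`. -/
lemma cj_mem_iff (hP : G.IsPreLocality Δ S) (hN : G.IsPartialNormal N) {x a : L} (hx : x ∈ N)
    (ha : a ∈ G.sg S x) {Q : Set L} (hQ : G.IsSubgroup Q) (hTQ : S ∩ N ⊆ Q) :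
    a ∈ Q ↔ G.cj x a ∈ Q := by
  obtain ⟨t, ht, e⟩ := exists_cj_eq_mul hP hN hx ha
  have hS := hP.isSubgroup_S
  refine ⟨fun h => e ▸ hQ.mul_mem h (hTQ ht), fun h => ?_⟩
  have := hQ.mul_mem h (hQ.inv_mem t (hTQ ht))
  rwa [e, G.mul_inv_cancel' (hS.mem_D _ (by simp [ha.1, ht.1]))] at this

/-- Inside the group normalizing P, take m = z⁻¹ · h z h⁻¹. -/
lemma exists_cj_eq_mul_of_nz (hP : G.IsPreLocality Δ S) (hN : G.IsPartialNormal N) {z h : L}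
    {P : Set L} (hz : z ∈ N) (hzP : G.Mor Δ z P P) (hh : G.Mor Δ h P P) :
    ∃ m ∈ N, G.Mor Δ m P P ∧ G.cj z h = G.mul m h := by
  have hH := hP.nz_isSubgroup hzP.src
  have h1 := hP.mor_cj hh.inv hzP
  refine ⟨G.mul (G.inv z) (G.cj (G.inv h) z), hN.mul_mem (hP.mul_mem_D hzP.inv h1)
    (hN.inv_mem z hz) (hN.cj_mem (hP.cj_mem_D hh.inv hzP) hz), hP.mor_mul hzP.inv h1, ?_⟩
  let _ := hH.group
  have e : (⟨z, hzP⟩ : G.nz Δ P)⁻¹ * ⟨h, hh⟩ * ⟨z, hzP⟩ =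
      ⟨z, hzP⟩⁻¹ * ((⟨h, hh⟩ : G.nz Δ P)⁻¹⁻¹ * ⟨z, hzP⟩ * (⟨h, hh⟩ : G.nz Δ P)⁻¹) * ⟨h, hh⟩ := by
    group
  have e' := congrArg Subtype.val e
  rw [hH.coe_cj, hH.coe_mul, hH.coe_mul, hH.coe_cj] at e'
  exact e'

lemma cj_mem_inter (hN : G.IsPartialNormal N) {f t : L} (hf : S ∩ N ⊆ G.sg S f)
    (ht : t ∈ S ∩ N) : G.cj f t ∈ S ∩ N :=
  ⟨(hf ht).2.2, hN.cj_mem (hf ht).2.1 ht.2⟩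

lemma exists_sup_inter (hP : G.IsPreLocality Δ S) (hN : G.IsPartialNormal N) {Q : Set L}
    (hQ : G.IsSubgroup Q) (hQS : Q ⊆ S) :
    ∃ R : Set L, G.IsSubgroup R ∧ Q ⊆ R ∧ S ∩ N ⊆ R ∧ R ⊆ S ∧
      ∀ r ∈ R, ∃ a ∈ Q, ∃ t ∈ S ∩ N, r = G.mul a t := by
  have hS := hP.isSubgroup_S
  have hT := isSubgroup_inter hP hN
  let _ := hS.group
  have hnorm : (hS.subgroupOf hT).Normal := by
    refine ⟨fun n hn g => ?_⟩
    have h3 := hS.coe_cj g⁻¹ n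
    rw [_root_.inv_inv] at h3
    change ((g * n * g⁻¹ : S) : L) ∈ S ∩ N
    rw [h3]
    exact ⟨hS.cj_mem (Subtype.coe_prop _) n.2,
      hN.cj_mem (hS.mem_D _ (by simp [hS.inv_mem])) hn.2⟩
  refine ⟨_, hS.coe_subgroup (hS.subgroupOf hQ ⊔ hS.subgroupOf hT), ?_, ?_, ?_, ?_⟩
  · exact fun x hx => ⟨⟨x, hQS hx⟩, Subgroup.mem_sup_left
      (show (⟨x, hQS hx⟩ : S) ∈ hS.subgroupOf hQ from hx), rfl⟩
  · exact fun x hx => ⟨⟨x, hx.1⟩, Subgroup.mem_sup_right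
      (show (⟨x, hx.1⟩ : S) ∈ hS.subgroupOf hT from hx), rfl⟩
  · rintro _ ⟨x, -, rfl⟩
    exact x.2
  · rintro _ ⟨x, hx, rfl⟩
    obtain ⟨a, ha, t, ht, rfl⟩ := Subgroup.mem_sup_of_normal_right.1 hx
    exact ⟨a, ha, t, ht, rfl⟩

/-- The elements of the product `N S`. -/
def mulSet (G : PartialGroup L) (N S : Set L) : Set L :=
  {k | ∃ x ∈ N, ∃ s ∈ S, [x, s] ∈ G.D ∧ k = G.mul x s}

/-- An element of S acts on every object, so x = (xs)s⁻¹ acts wherever xs does. -/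
lemma mor_mul_S (hP : G.IsPreLocality Δ S) {x s : L} (hs : s ∈ S) {P Q : Set L}
    (h : G.Mor Δ (G.mul x s) P Q) : ∃ R, G.Mor Δ x P R ∧ G.Mor Δ s R Q := by
  have h1 := hP.mor_sg (S := S) x
  have h2 := hP.mor_of_mem_S h1.tgt hs
  have h3 := hP.mor_of_mem_S h.tgt (hP.isSubgroup_S.inv_mem s hs)
  have h4 := hP.mor_mul h h3
  rw [hP.mul_inv_cancel h1 h2] at h4
  have h5 := h3.inv
  rw [G.inv_inv] at h5
  exact ⟨_, h4, h5⟩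

variable (hL : G.IsLocality p Δ S) (hN : G.IsPartialNormal N)
include hL hN

/-- P^z ⊆ P by `cj_mem_iff`. As depths are equal, P lies in the closure of P^z and hence in S_{z⁻¹};
the same argument for z⁻¹ gives the other inclusion. -/
lemma mor_self_of_inter_subset {z : L} (hz : z ∈ N) {P : Set L} (h : P ∈ Δ) (hTP : S ∩ N ⊆ P)
    (hzP : P ⊆ G.sg S z) : G.Mor Δ z P P := by
  have hPs := hL.isSubgroup P h
  have hPS := hL.subset_S P h
  have hsub : G.cj z '' P ⊆ P := by
    rintro _ ⟨a, ha, rfl⟩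
    exact (cj_mem_iff hL.toIsPreLocality hN hz (hzP ha) hPs hTP).1 ha
  have h1 : P ⊆ G.star S (G.cj z '' P) :=
    hL.subset_star_of_depth_le hL.finite_dim (hsub.trans (subset_star P)) hPS
      (hL.depth_image hL.finite_dim hzP).ge
  have h2 := h1.trans (star_subset_sg (image_subset_sg_inv hzP))
  have h3 := hL.mor h hzP
  have e : G.cj z '' P = P := by
    refine hsub.antisymm fun y hy => ?_
    have h4 := sg_cj_inv (h2 hy)
    rw [G.inv_inv] at h4
    exact ⟨_, (cj_mem_iff hL.toIsPreLocality hN (hN.inv_mem z hz) (h2 hy) hPs hTP).1 hy, h4⟩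
  rwa [e] at h3

/-- An f that conjugates S ∩ N into S maps it into itself. The comparison of depths makes this a
true normalization, without assuming S ∩ N finite. -/
lemma inter_subset_sg_inv {f : L} (hf : S ∩ N ⊆ G.sg S f) : S ∩ N ⊆ G.sg S (G.inv f) := by
  have h1 : G.cj f '' (S ∩ N) ⊆ G.star S (S ∩ N) := by
    rintro _ ⟨t, ht, rfl⟩
    exact subset_star _ (cj_mem_inter hN hf ht)
  exact (hL.subset_star_of_depth_le hL.finite_dim h1 Set.inter_subset_left
    (hL.depth_image hL.finite_dim hf).ge).trans (star_subset_sg (image_subset_sg_inv hf))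

/-- Here y = x^f. It is defined because a ∈ S_f if and only if a^x ∈ S_f, the subgroup S_f
containing S ∩ N. -/
lemma exists_mul_eq_mul_right {x f : L} (hx : x ∈ N) (hf : S ∩ N ⊆ G.sg S f) {P : Set L}
    (h : P ∈ Δ) (hxf : P ⊆ G.conjInto S [x, f]) :
    P ⊆ G.sg S f ∧ ∃ y ∈ N, P ⊆ G.conjInto S [f, y] ∧ G.mul x f = G.mul f y := by
  obtain ⟨h1, h2⟩ := hL.mor_pair h hxf
  have h3 : P ⊆ G.sg S f := by
    intro a ha
    have := mem_conjInto_pair.1 (hxf ha)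
    exact (cj_mem_iff hL.toIsPreLocality hN hx this.1 (hL.isSubgroup_sg f) hf).2 this.2
  have h4 := hL.mor h h3
  have hD : [G.inv f, x, f] ∈ G.D := hL.mem_D (h4.inv.cons (h1.cons h2.single))
  have hy := hL.mor_mul (hL.mor_mul h4.inv h1) h2
  rw [← G.cj_eq_mul hD] at hy
  exact ⟨h3, G.cj f x, hN.cj_mem hD hx, hL.subset_pair h4 hy, (G.mul_cj hD).2.2.symm⟩

/-- The mirror image, with x the conjugate of y by f⁻¹: the tool for collecting factors from N on
the left. -/
lemma exists_mul_eq_mul_left {y f : L} (hy : y ∈ N) (hf : S ∩ N ⊆ G.sg S f) {P : Set L}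
    (h : P ∈ Δ) (hfy : P ⊆ G.conjInto S [f, y]) :
    ∃ x ∈ N, P ⊆ G.conjInto S [x, f] ∧ G.mul f y = G.mul x f := by
  obtain ⟨h1, h2⟩ := hL.mor_pair h hfy
  have hf' := inter_subset_sg_inv hL hN hf
  have h3 : G.cj y '' (G.cj f '' P) ⊆ G.sg S (G.inv f) := by
    rintro _ ⟨_, ⟨a, ha, rfl⟩, rfl⟩
    have := mem_conjInto_pair.1 (hfy ha)
    exact (cj_mem_iff hL.toIsPreLocality hN hy this.2 (hL.isSubgroup_sg _) hf').1
      (sg_inv_mem this.1)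
  have h4 := hL.mor h2.tgt h3
  have hD : [G.inv (G.inv f), y, G.inv f] ∈ G.D := by
    rw [G.inv_inv]
    exact hL.mem_D (h1.cons (h2.cons h4.single))
  have e : G.cj (G.inv f) y = G.mul (G.mul f y) (G.inv f) := by
    rw [G.cj_eq_mul hD, G.inv_inv]
  have h5 := hL.mor_mul (hL.mor_mul h1 h2) h4
  rw [← e] at h5
  have h6 := h4.inv
  rw [G.inv_inv] at h6
  refine ⟨G.cj (G.inv f) y, hN.cj_mem hD hy, hL.subset_pair h5 h6, ?_⟩
  rw [e]
  have := hL.mul_inv_cancel (hL.mor_mul h1 h2) h4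
  rw [G.inv_inv] at this
  exact this.symm

omit hL in
lemma subset_mulSet : S ⊆ G.mulSet N S :=
  fun s hs => ⟨G.one, hN.one_mem, s, hs, G.one_mul_mem s, (G.one_mul' s).symm⟩

omit hL hN in
lemma mul_mem_mulSet (hP : G.IsPreLocality Δ S) {x s : L} (hx : x ∈ N) (hs : s ∈ S) :
    G.mul x s ∈ G.mulSet N S := by
  have h1 := hP.mor_sg (S := S) x
  exact ⟨x, hx, s, hs, hP.mul_mem_D h1 (hP.mor_of_mem_S h1.tgt hs), rfl⟩

lemma inv_mem_mulSet {k : L} (hk : k ∈ G.mulSet N S) : G.inv k ∈ G.mulSet N S := by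
  obtain ⟨x, hx, s, hs, hD, rfl⟩ := hk
  have hs' := hL.isSubgroup_S.inv_mem s hs
  have hD' : [G.inv s, G.inv x] ∈ G.D := by simpa using G.inv_word_mem hD
  obtain ⟨y, hy, -, e⟩ := exists_mul_eq_mul_left hL hN (hN.inv_mem x hx)
    (Set.inter_subset_left.trans (hL.sg_of_mem_S hs').ge) (hL.conjInto_mem hD') subset_rfl
  rw [G.inv_mul_rev hD, e]
  exact mul_mem_mulSet hL.toIsPreLocality hy hs'

lemma mul_mem_mulSet_of_mem {a b : L} (ha : a ∈ G.mulSet N S) (hb : b ∈ G.mulSet N S)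
    (h : [a, b] ∈ G.D) : G.mul a b ∈ G.mulSet N S := by
  obtain ⟨x, hx, s, hs, -, rfl⟩ := ha
  obtain ⟨y, hy, u, hu, -, rfl⟩ := hb
  obtain ⟨ha, hb⟩ := hL.mor_pair (hL.conjInto_mem h) subset_rfl
  obtain ⟨A, hxA, hsA⟩ := mor_mul_S hL.toIsPreLocality hs ha
  obtain ⟨B, hyB, huB⟩ := mor_mul_S hL.toIsPreLocality hu hb
  obtain ⟨y', hy', hA, e⟩ := exists_mul_eq_mul_left hL hN hy
    (Set.inter_subset_left.trans (hL.sg_of_mem_S hs).ge) hxA.tgt (hL.subset_pair hsA hyB)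
  obtain ⟨h1, h2⟩ := hL.mor_pair hxA.tgt hA
  have h3 := hL.mor_mul h1 h2
  rw [← e] at h3
  have h4 := h3.unique (hL.mor_mul hsA hyB)
  rw [h4] at h2
  have h5 := hL.mor_mul h2 huB
  rw [hL.assoc hxA hsA (hL.mor_mul hyB huB), ← hL.assoc hsA hyB huB, e, hL.assoc h1 h2 huB,
    ← hL.assoc hxA h1 h5]
  exact mul_mem_mulSet hL.toIsPreLocality (hN.mul_mem (hL.mul_mem_D hxA h1) hx hy')
    (hL.isSubgroup_S.mul_mem hs hu)

/-- A finite set of elements of `S` normalizing `P`, whose conjugates under `g` lie in `N S`, is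
conjugated into `S` by `g v` for some `v ∈ N`. -/
lemma exists_conj_into_of_normal {g : L} {P Q F : Set L} (hg : G.Mor Δ g P Q) (hF : F.Finite)
    (hFS : F ⊆ S) (hFP : F ⊆ G.nz Δ P) (hFN : ∀ h ∈ F, G.cj g h ∈ G.mulSet N S) :
    ∃ v ∈ N, Q ⊆ G.sg S v ∧ ∀ h ∈ F, G.cj v (G.cj g h) ∈ S := by
  have hS := hL.isSubgroup_S
  have hH := hL.nz_isSubgroup hg.src
  -- F need not be a group, so it is enlarged inside this subgroup to a finite R. Then R^g is a
  -- finite p-subgroup in NS, and Sylow's theorem applies with K = NS.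
  have hA : G.IsSubgroup {h | h ∈ S ∧ G.Mor Δ h P P ∧ G.cj g h ∈ G.mulSet N S} := by
    refine hS.of_subset (fun h hh => hh.1) ⟨hS.one_mem, hH.one_mem, ?_⟩ ?_ ?_
    · rw [(G.cj_one_elem g).2]
      exact subset_mulSet hN hS.one_mem
    · intro x hx
      refine ⟨hS.inv_mem x hx.1, hx.2.1.inv, ?_⟩
      rw [(G.cj_inv_elem (hL.cj_mem_D hg hx.2.1)).2]
      exact inv_mem_mulSet hL hN hx.2.2
    · intro x hx y hy
      refine ⟨hS.mul_mem hx.1 hy.1, hL.mor_mul hx.2.1 hy.2.1, ?_⟩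
      rw [hL.cj_mul hg hx.2.1 hy.2.1]
      exact mul_mem_mulSet_of_mem hL hN hx.2.2 hy.2.2
        (hL.mul_mem_D (hL.mor_cj hg hx.2.1) (hL.mor_cj hg hy.2.1))
  obtain ⟨R, hR, hRf, hFR, hRA⟩ := hL.locallyFinite _ hA F
    (fun h hh => ⟨hFS hh, hFP hh, hFN h hh⟩) hF
  have hRN : R ⊆ G.nz Δ P := fun h hh => (hRA hh).2.1
  have hRp : G.IsPSubgroup p R := ⟨hR, fun x hx => hL.isPSubgroup.2 x (hRA hx).1⟩
  obtain ⟨k, hk, hQk, hRk⟩ := hL.exists_conj_into (subset_mulSet hN)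
    (fun x hx => inv_mem_mulSet hL hN hx) (fun a ha b hb => mul_mem_mulSet_of_mem hL hN ha hb)
    hg.tgt (hRf.image (G.cj g)) (hL.isPSubgroup_cj hg hRp hRN)
    (by rintro _ ⟨x, hx, rfl⟩; exact (hRA hx).2.2)
    (by rintro _ ⟨x, hx, rfl⟩; exact hL.mor_cj hg (hRN hx))
  -- The conjugating element is vs, and its factor s ∈ S can be undone within S.
  obtain ⟨v, hv, s, hs, -, rfl⟩ := hk
  obtain ⟨A, hvA, hsA⟩ := mor_mul_S hL.toIsPreLocality hs (hL.mor hg.tgt hQk)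
  refine ⟨v, hv, hL.subset_sg hvA, fun h hh => ?_⟩
  have h1 := hL.mor_cj hg (hRN (hFR hh))
  have h2 := hRk _ ⟨h, hFR hh, rfl⟩
  rw [(hL.cj_comp hvA hsA h1).2] at h2
  have h3 := hL.cj_inv_cj hsA (hL.mor_cj hvA h1)
  rw [← h3]
  exact hS.cj_mem (hS.inv_mem s hs) h2

/-- The Frattini argument: every `g` is on `P` a product of an element of `N` and an element that
normalizes `S ∩ N`. -/
theorem exists_eq_mul_of_subset_sg {P : Set L} {g : L} (h : P ∈ Δ) (hPg : P ⊆ G.sg S g) :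
    ∃ x ∈ N, ∃ f, S ∩ N ⊆ G.sg S f ∧ P ⊆ G.conjInto S [x, f] ∧ g = G.mul x f := by
  have hf := hL.finite_dim
  obtain ⟨M, hM⟩ := hL.exists_depth_le hf
  induction hn : M - G.depth S P using Nat.strong_induction_on generalizing P g with
  | _ n ih =>
  have hPS := hL.subset_S P h
  set P1 := G.star S P with hP1
  have hP1Δ : P1 ∈ Δ := hL.star_mem h
  have hP1S : P1 ⊆ S := star_subset_S hPS
  have hP1g : P1 ⊆ G.sg S g := star_subset_sg hPg
  have hstar : G.star S P1 = P1 := star_star P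
  have hd : G.depth S P1 = G.depth S P := hL.depth_star hf hPS
  suffices ∃ x ∈ N, ∃ f, S ∩ N ⊆ G.sg S f ∧ P1 ⊆ G.conjInto S [x, f] ∧ g = G.mul x f by
    obtain ⟨x, hx, f, h1, h2, h3⟩ := this
    exact ⟨x, hx, f, h1, (subset_star P).trans h2, h3⟩
  clear_value P1
  by_cases hT : S ∩ N ⊆ P1
  · exact ⟨G.one, hN.one_mem, g, hT.trans hP1g,
      hL.subset_pair (mor_one hP1Δ) (hL.mor hP1Δ hP1g), (G.one_mul' g).symm⟩
  have hP1s := hL.isSubgroup P1 hP1Δ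
  -- Normalizers grow in R = P1(S ∩ N). Removing the factor from P1 gives t ∈ S ∩ N outside P1 and
  -- normalizing it.
  obtain ⟨R, hR, hPR, hTR, hRS, hRmul⟩ := exists_sup_inter hL.toIsPreLocality hN hP1s hP1S
  obtain ⟨r, hrR, hrP, hrg, hre⟩ := hL.exists_normalizing hf hL.prime hP1S hstar
    ⟨hR, fun x hx => hL.isPSubgroup.2 x (hRS hx)⟩ (hL.locallyFinite R hR) hPR
    fun hle => hT (hTR.trans hle)
  have hrN : G.Mor Δ r P1 P1 := by
    have := hL.mor hP1Δ hrg
    rwa [hre] at this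
  obtain ⟨a, haP, t, ht, rfl⟩ := hRmul r hrR
  have htN : G.Mor Δ t P1 P1 := by
    have := hL.mor_mul (hL.mor_of_mem hP1Δ haP).inv hrN
    rwa [G.inv_mul_cancel' (hL.isSubgroup_S.mem_D _ (by simp [hP1S haP, ht.1]))] at this
  have htP : t ∉ P1 := fun h => hrP (hP1s.mul_mem haP h)
  have hg := hL.mor hP1Δ hP1g
  -- Since t^g ∈ N, some v ∈ N makes gv conjugate t into S as well as P1. Induction applies to gv on
  -- the deeper closure of P1 ∪ {t}.
  obtain ⟨v, hv, hQv, htv⟩ := exists_conj_into_of_normal hL hN hg (Set.finite_singleton t)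
    (by simpa using ht.1) (by rintro _ rfl; exact htN) (by
      rintro _ rfl
      have h1 := hN.cj_mem (hL.cj_mem_D hg htN) ht.2
      have := mul_mem_mulSet hL.toIsPreLocality h1 hL.isSubgroup_S.one_mem
      rwa [G.mul_one'] at this)
  have hvm := hL.mor hg.tgt hQv
  have hgv := hL.mor_mul hg hvm
  have htgv : t ∈ G.sg S (G.mul g v) := by
    refine hL.mem_sg_of_nz hgv htN ht.1 ?_
    rw [(hL.cj_comp hg hvm htN).2]
    exact htv t rfl
  have hins : insert t P1 ⊆ G.sg S (G.mul g v) := Set.insert_subset htgv (hL.subset_sg hgv)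
  have hinsS : insert t P1 ⊆ S := Set.insert_subset ht.1 hP1S
  have hP2 : G.star S (insert t P1) ∈ Δ :=
    hL.star_mem_of_subset hP1Δ ((Set.subset_insert t P1).trans (subset_star _)) hinsS
  have hlt : G.depth S P1 < G.depth S (insert t P1) :=
    hL.depth_lt hf ((Set.subset_insert t P1).trans (subset_star _)) hinsS fun hle =>
      htP (hstar ▸ hle (Set.mem_insert t P1))
  obtain ⟨x, hx, f, hTf, hxf, e⟩ := ih (M - G.depth S (G.star S (insert t P1))) (by
    have h1 := hM _ hP1S
    have h2 := hM _ hinsS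
    have h3 := hL.depth_star hf hinsS
    omega) hP2 (star_subset_sg hins) rfl
  obtain ⟨hxm, hfm⟩ := hL.mor_pair hP1Δ
    (((Set.subset_insert t P1).trans (subset_star _)).trans hxf)
  have hxfm := hL.mor_mul hxm hfm
  rw [← e] at hxfm
  have hvi := hvm.inv
  rw [hgv.unique hxfm] at hvi
  -- From gv = xf one gets g = x f v⁻¹ = (x v') f.
  obtain ⟨v', hv', hA, e'⟩ := exists_mul_eq_mul_left hL hN (hN.inv_mem v hv) hTf hfm.src
    (hL.subset_pair hfm hvi)
  obtain ⟨hm1, hm2⟩ := hL.mor_pair hfm.src hA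
  refine ⟨G.mul x v', hN.mul_mem (hL.mul_mem_D hxm hm1) hx hv', f, hTf,
    hL.subset_pair (hL.mor_mul hxm hm1) hm2, ?_⟩
  rw [hL.assoc hxm hm1 hm2, ← e', ← hL.assoc hxm hfm hvi, ← e, hL.mul_inv_cancel hg hvm]

end Normal

end PartialGroup

namespace PartialGroup

/-! ### Agreement up to N, maximal representatives and the splitting lemma. -/

section Agree

variable {L : Type u} {G : PartialGroup L} {Δ : Set (Set L)} {S : Set L} {p : ℕ} {N : Set L}

/-- The elements `f` and `f'` act on the object `P`, which contains `S ∩ N`, and differ there by an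
element of `N`. -/
structure Agree (G : PartialGroup L) (Δ : Set (Set L)) (S N P : Set L) (f f' : L) : Prop where
  mem : P ∈ Δ
  inter : S ∩ N ⊆ P
  right : P ⊆ G.sg S f'
  exists_mor : ∃ z ∈ N, G.Mor Δ z P P ∧ f = G.mul z f'

/-- `f` normalizes `S ∩ N` and does not extend, up to an element of `N`, to a larger subgroup of
`S`. -/
def IsMaxRep (G : PartialGroup L) (Δ : Set (Set L)) (S N : Set L) (f : L) : Prop :=
  S ∩ N ⊆ G.sg S f ∧ ∀ f', G.Agree Δ S N (G.sg S f) f' f → G.sg S f' ⊆ G.sg S f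

lemma mem_coset {f y : L} :
    y ∈ G.coset N f ↔ ∃ x ∈ N, [x, f] ∈ G.D ∧ G.mul x f = y := by
  refine exists_congr fun x => and_congr_right fun _ => ⟨?_, ?_⟩
  · rintro ⟨h, e⟩
    exact ⟨h, by rw [← e, G.pr_eq, mul]⟩
  · rintro ⟨h, e⟩
    exact ⟨h, by rw [← e, G.pr_eq, mul]⟩

lemma mem_coset_self (hN : G.IsPartialNormal N) (f : L) : f ∈ G.coset N f :=
  mem_coset.2 ⟨G.one, hN.one_mem, G.one_mul_mem f, G.one_mul' f⟩

variable (hL : G.IsLocality p Δ S) (hN : G.IsPartialNormal N)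

include hL in
lemma Agree.left {P : Set L} {f f' : L} (h : G.Agree Δ S N P f f') : P ⊆ G.sg S f := by
  obtain ⟨z, -, hzP, rfl⟩ := h.exists_mor
  exact hL.subset_sg (hL.mor_mul hzP (hL.mor h.mem h.right))

include hN in
lemma Agree.refl {P : Set L} {f : L} (h : P ∈ Δ) (hT : S ∩ N ⊆ P) (hf : P ⊆ G.sg S f) :
    G.Agree Δ S N P f f :=
  ⟨h, hT, hf, G.one, hN.one_mem, mor_one h, (G.one_mul' f).symm⟩

include hL hN

lemma Agree.symm {P : Set L} {f f' : L} (h : G.Agree Δ S N P f f') : G.Agree Δ S N P f' f := by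
  have hl := h.left hL
  obtain ⟨z, hz, hzP, rfl⟩ := h.exists_mor
  exact ⟨h.mem, h.inter, hl, G.inv z, hN.inv_mem z hz, hzP.inv,
    (hL.inv_mul_cancel hzP (hL.mor h.mem h.right)).symm⟩

lemma Agree.trans {P : Set L} {f f' f'' : L} (h : G.Agree Δ S N P f f')
    (h' : G.Agree Δ S N P f' f'') : G.Agree Δ S N P f f'' := by
  obtain ⟨z, hz, hzP, rfl⟩ := h.exists_mor
  obtain ⟨y, hy, hyP, rfl⟩ := h'.exists_mor
  exact ⟨h.mem, h.inter, h'.right, G.mul z y, hN.mul_mem (hL.mul_mem_D hzP hyP) hz hy,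
    hL.mor_mul hzP hyP, (hL.assoc hzP hyP (hL.mor h.mem h'.right)).symm⟩

lemma Agree.mono {P R : Set L} {f f' : L} (h : G.Agree Δ S N P f f') (hR : R ∈ Δ)
    (hT : S ∩ N ⊆ R) (hRP : R ⊆ P) : G.Agree Δ S N R f f' := by
  obtain ⟨z, hz, hzP, e⟩ := h.exists_mor
  exact ⟨hR, hT, hRP.trans h.right, z, hz,
    mor_self_of_inter_subset hL hN hz hR hT (hRP.trans (hL.subset_sg hzP)), e⟩

lemma Agree.of_subset_sg {P X : Set L} {f f' z : L} (h : P ∈ Δ) (hT : S ∩ N ⊆ P)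
    (hPX : P ⊆ G.star S X) (hz : z ∈ N) (hX : X ⊆ G.sg S z) (hf' : X ⊆ G.sg S f')
    (e : f = G.mul z f') : G.Agree Δ S N (G.star S X) f f' := by
  have h1 := hL.star_mem_of_subset h hPX (hX.trans (sg_subset z))
  exact ⟨h1, hT.trans hPX, star_subset_sg hf', z, hz,
    mor_self_of_inter_subset hL hN hz h1 (hT.trans hPX) (star_subset_sg hX), e⟩

lemma Agree.star {P : Set L} {f f' : L} (h : G.Agree Δ S N P f f') :
    G.Agree Δ S N (G.star S P) f f' := by
  obtain ⟨z, hz, hzP, e⟩ := h.exists_mor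
  exact Agree.of_subset_sg hL hN h.mem h.inter (subset_star P) hz (hL.subset_sg hzP) h.right e

/-- Modulo N the elements f and f' act in the same way on the normalizer of P, because f = zf' with
z ∈ N. -/
lemma Agree.exists_cj_eq {P : Set L} {f f' h : L} (hA : G.Agree Δ S N P f f')
    (hh : G.Mor Δ h P P) :
    ∃ m ∈ N, [m, G.cj f' h] ∈ G.D ∧ G.cj f h = G.mul m (G.cj f' h) := by
  obtain ⟨z, hz, hzP, rfl⟩ := hA.exists_mor
  have hf' := hL.mor hA.mem hA.right
  obtain ⟨m, hm, hmP, e⟩ := exists_cj_eq_mul_of_nz hL.toIsPreLocality hN hz hzP hh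
  refine ⟨G.cj f' m, hN.cj_mem (hL.cj_mem_D hf' hmP) hm,
    hL.mul_mem_D (hL.mor_cj hf' hmP) (hL.mor_cj hf' hh), ?_⟩
  rw [(hL.cj_comp hzP hf' hh).2, e, hL.cj_mul hf' hmP hh]

/-- Write b^f = m b^{f'} with m ∈ S ∩ N. Then f'⁻¹ conjugates b^f into S, and the result is b^z; so
z acts on b as well. -/
lemma Agree.star_insert {P : Set L} {f f' b : L} (hA : G.Agree Δ S N P f f')
    (hb : G.Mor Δ b P P) (hbf : b ∈ G.sg S f) (hbf' : b ∈ G.sg S f') :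
    G.Agree Δ S N (G.star S (insert b P)) f f' := by
  have hS := hL.isSubgroup_S
  obtain ⟨m, hm, hmD, e⟩ := hA.exists_cj_eq hL hN hb
  have hmS : m ∈ S := by
    rw [← G.mul_inv_cancel' hmD, ← e]
    exact hS.mul_mem hbf.2.2 (hS.inv_mem _ hbf'.2.2)
  have h1 : G.cj f b ∈ G.sg S (G.inv f') := by
    rw [e]
    exact (hL.isSubgroup_sg _).mul_mem
      (inter_subset_sg_inv hL hN (hA.inter.trans hA.right) ⟨hmS, hm⟩) (sg_inv_mem hbf')
  obtain ⟨z, hz, hzP, rfl⟩ := hA.exists_mor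
  have hf' := hL.mor hA.mem hA.right
  have h2 : b ∈ G.sg S z := by
    refine hL.mem_sg_of_nz hzP hb hbf.1 ?_
    rw [← hL.cj_inv_cj hf' (hL.mor_cj hzP hb), ← (hL.cj_comp hzP hf' hb).2]
    exact h1.2.2
  exact Agree.of_subset_sg hL hN hA.mem hA.inter ((Set.subset_insert b P).trans (subset_star _))
    hz (Set.insert_subset h2 (hL.subset_sg hzP)) (Set.insert_subset hbf' hA.right) rfl

/-- Two elements that agree on an object up to `N` have a common extension up to `N`. -/
theorem Agree.exists_extension {P : Set L} {f f' : L} (hA : G.Agree Δ S N P f f') :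
    ∃ k, G.Agree Δ S N (G.sg S f) k f ∧ G.Agree Δ S N (G.sg S f') k f' := by
  have hf := hL.finite_dim
  obtain ⟨M, hM⟩ := hL.exists_depth_le hf
  induction hn : M - G.depth S P using Nat.strong_induction_on generalizing P f f' with
  | _ n ih =>
  have hd : G.depth S (G.star S P) = G.depth S P := hL.depth_star hf (hL.subset_S P hA.mem)
  replace hA := hA.star hL hN
  have hstar := star_star (G := G) (S := S) P
  set R := G.star S P
  clear_value R
  have hRS := hL.subset_S R hA.mem
  have hins : ∀ b ∈ S, b ∉ R → M - G.depth S (G.star S (insert b R)) < n := by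
    intro b hb hbR
    have h1 := Set.insert_subset hb hRS
    have h2 : G.depth S R < G.depth S (insert b R) :=
      hL.depth_lt hf ((Set.subset_insert b R).trans (subset_star _)) h1 fun hle =>
        hbR (hstar ▸ hle (Set.mem_insert b R))
    have h3 := hM _ h1
    have h4 := hL.depth_star hf h1
    omega
  have hl := hA.left hL
  have hTf := hA.inter.trans hl
  have hTf' := hA.inter.trans hA.right
  have hsg : ∀ g, R ⊆ G.sg S g → ¬ G.sg S g ⊆ R → ∃ a ∈ G.sg S g, a ∉ R ∧ G.Mor Δ a R R := by
    intro g hRg hne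
    obtain ⟨a, ha, haR, hag, hae⟩ := hL.exists_normalizing hf hL.prime hRS hstar
      ⟨hL.isSubgroup_sg g, fun x hx => hL.isPSubgroup.2 x hx.1⟩
      (hL.locallyFinite _ (hL.isSubgroup_sg g)) hRg hne
    have := hL.mor hA.mem hag
    rw [hae] at this
    exact ⟨a, ha, haR, this⟩
  -- If R exhausts S_f, then f' is itself a common extension; symmetrically in the next case.
  by_cases h1 : G.sg S f ⊆ R
  · obtain rfl := hl.antisymm h1
    exact ⟨f', hA.symm hL hN, Agree.refl hN (hL.sg_mem f') hTf' subset_rfl⟩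
  by_cases h2 : G.sg S f' ⊆ R
  · obtain rfl := hA.right.antisymm h2
    exact ⟨f, Agree.refl hN (hL.sg_mem f) hTf subset_rfl, hA⟩
  obtain ⟨a, haf, haR, ham⟩ := hsg f hl h1
  obtain ⟨b, hbf', hbR, hbm⟩ := hsg f' hA.right h2
  have hfm := hL.mor hA.mem hl
  -- a^f lies in S and b^f in N b^{f'}, so both lie in NS, and a single v ∈ N conjugates both into
  -- S.
  obtain ⟨v, hv, hQv, hFv⟩ := exists_conj_into_of_normal hL hN (F := {a, b}) hfm (by simp)
    (by rintro _ (rfl | rfl); exacts [haf.1, hbf'.1]) (by rintro _ (rfl | rfl); exacts [ham, hbm])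
    (by
      rintro _ (rfl | rfl)
      · exact subset_mulSet hN haf.2.2
      · obtain ⟨m, hm, -, e⟩ := hA.exists_cj_eq hL hN hbm
        rw [e]
        exact mul_mem_mulSet hL.toIsPreLocality hm hbf'.2.2)
  have hvm := hL.mor hfm.tgt hQv
  have hfv := hL.mor_mul hfm hvm
  have key : ∀ c ∈ ({a, b} : Set L), G.Mor Δ c R R → c ∈ S → c ∈ G.sg S (G.mul f v) := by
    intro c hc hcm hcS
    refine hL.mem_sg_of_nz hfv hcm hcS ?_
    rw [(hL.cj_comp hfm hvm hcm).2]
    exact hFv c hc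
  have hR2 := hL.star_mem_of_subset (X := insert a R) hA.mem
    ((Set.subset_insert a R).trans (subset_star _)) (Set.insert_subset haf.1 hRS)
  have hT2 : S ∩ N ⊆ G.star S (insert a R) :=
    hA.inter.trans ((Set.subset_insert a R).trans (subset_star _))
  have hsub : G.star S (insert a R) ⊆ G.conjInto S [f, v] := by
    refine star_subset (Set.insert_subset (mem_conjInto_pair.2 ⟨haf, haf.2.2, ?_, ?_⟩)
      (hL.subset_pair hfm hvm))
    · exact hL.cj_mem_D hvm (hL.mor_cj hfm ham)
    · exact hFv a (Or.inl rfl)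
  obtain ⟨y, hy, hyf, e⟩ := exists_mul_eq_mul_left hL hN hv hTf hR2 hsub
  obtain ⟨hym, hfm2⟩ := hL.mor_pair hR2 hyf
  have hyself := mor_self_of_inter_subset hL hN hy hR2 hT2 (hL.subset_sg hym)
  have hA1 : G.Agree Δ S N (G.star S (insert a R)) (G.mul f v) f := by
    refine ⟨hR2, hT2, ?_, y, hy, hyself, e⟩
    rw [hym.unique hyself] at hfm2
    exact hL.subset_sg hfm2
  -- k1 extends both fv and f, so it conjugates b into S. It therefore agrees with f' on the closure
  -- of R ∪ {b}, and a second use of the induction joins k1 with f'.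
  obtain ⟨k1, hk1, hk1f⟩ := ih _ (hins a haf.1 haR) hA1 rfl
  have hb1 : b ∈ G.sg S k1 := hk1.left hL (key b (Or.inr rfl) hbm hbf'.1)
  have hA2 : G.Agree Δ S N R k1 f' := (hk1f.mono hL hN hA.mem hA.inter hl).trans hL hN hA
  obtain ⟨k, hk, hkf'⟩ := ih _ (hins b hbf'.1 hbR) (hA2.star_insert hL hN hbm hb1 hbf') rfl
  exact ⟨k, (hk.mono hL hN (hL.sg_mem f) hTf (hk1f.left hL)).trans hL hN hk1f, hkf'⟩

/-- Take k with S_k of greatest depth among the elements that agree with f on S_f. Anything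
extending k is again such an element. -/
lemma exists_isMaxRep {f : L} (hf : S ∩ N ⊆ G.sg S f) :
    ∃ k, G.IsMaxRep Δ S N k ∧ G.Agree Δ S N (G.sg S f) f k := by
  obtain ⟨k, hk, hmax⟩ := hL.exists_max_depth hL.finite_dim
    {k | G.Agree Δ S N (G.sg S f) f k} ⟨f, Agree.refl hN (hL.sg_mem f) hf subset_rfl⟩
    (fun k => G.sg S k) fun k _ => sg_subset k
  refine ⟨k, ⟨hf.trans hk.right, fun f' h => ?_⟩, hk⟩
  have h1 := hk.trans hL hN ((h.mono hL hN hk.mem hk.inter hk.right).symm hL hN)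
  have := hL.subset_star_of_depth_le hL.finite_dim ((h.left hL).trans (subset_star _))
    (sg_subset f') (hmax f' h1)
  rwa [star_sg] at this

/-- A common extension k of f' and f has S_k ⊆ S_f by maximality. Thus agreement on one object
becomes agreement on all of S_{f'}. -/
lemma IsMaxRep.agree {f f' : L} {P : Set L} (h : G.IsMaxRep Δ S N f)
    (hA : G.Agree Δ S N P f' f) : G.Agree Δ S N (G.sg S f') f' f := by
  obtain ⟨k, hk', hk⟩ := hA.exists_extension hL hN
  have h1 := (hk'.left hL).trans (h.2 k hk)
  exact (hk'.symm hL hN).trans hL hN (hk.mono hL hN (hL.sg_mem f') hk'.inter h1)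

/-- If `g` is the product of an element of `N` with `f` on `P`, and `f` agrees with `k`, then so is
it with `k`. -/
lemma Agree.exists_subset_pair {P R : Set L} {x f k : L} (hA : G.Agree Δ S N R f k) (hx : x ∈ N)
    (h : P ∈ Δ) (hP : P ⊆ G.conjInto S [x, f]) (hR : G.cj x '' P ⊆ R) :
    ∃ y ∈ N, P ⊆ G.conjInto S [y, k] ∧ G.mul x f = G.mul y k := by
  obtain ⟨hxm, -⟩ := hL.mor_pair h hP
  obtain ⟨z, hz, hzR, rfl⟩ := hA.exists_mor
  have hzm := hL.mor hxm.tgt (hR.trans (hL.subset_sg hzR))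
  have hkm := hL.mor hzm.tgt (by
    rintro _ ⟨c, hc, rfl⟩
    exact hA.right (hzR.image_mem (hR hc)))
  exact ⟨G.mul x z, hN.mul_mem (hL.mul_mem_D hxm hzm) hx hz,
    hL.subset_pair (hL.mor_mul hxm hzm) hkm, (hL.assoc hxm hzm hkm).symm⟩

lemma exists_isMaxRep_mul (g : L) :
    ∃ f, G.IsMaxRep Δ S N f ∧ ∃ x ∈ N, G.sg S g ⊆ G.conjInto S [x, f] ∧ g = G.mul x f := by
  obtain ⟨x, hx, f, hf, h1, rfl⟩ := exists_eq_mul_of_subset_sg hL hN (hL.sg_mem g) subset_rfl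
  obtain ⟨k, hk, hA⟩ := exists_isMaxRep hL hN hf
  obtain ⟨y, hy, h2, e⟩ := hA.exists_subset_pair hL hN hx (hL.sg_mem _) h1
    (hL.subset_sg (hL.mor_pair (hL.sg_mem _) h1).2)
  exact ⟨k, hk, y, hy, h2, e⟩

/-- Two factorizations of an element on an object yield elements that agree up to `N`. -/
lemma exists_agree {P : Set L} {x y f k : L} (h : P ∈ Δ) (hx : x ∈ N) (hy : y ∈ N)
    (hf : S ∩ N ⊆ G.sg S f) (hk : S ∩ N ⊆ G.sg S k) (hxf : P ⊆ G.conjInto S [x, f])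
    (hyk : P ⊆ G.conjInto S [y, k]) (e : G.mul x f = G.mul y k) :
    ∃ R, G.Agree Δ S N R k f := by
  obtain ⟨hxm, hfm⟩ := hL.mor_pair h hxf
  obtain ⟨hym, hkm⟩ := hL.mor_pair h hyk
  have h1 := hL.mor_mul hxm hfm
  rw [e] at h1
  have h2 := h1.unique (hL.mor_mul hym hkm)
  -- On P^y one has k = (y⁻¹x)f. Agreement needs an object containing S ∩ N, so P^y is enlarged to R
  -- = P^y(S ∩ N), on which y⁻¹x acts as k f⁻¹.
  obtain ⟨R, hR, hAR, hTR, hRS, hRmul⟩ := exists_sup_inter hL.toIsPreLocality hN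
    (hL.isSubgroup _ hym.tgt) (hL.subset_S _ hym.tgt)
  have hRΔ := hL.mem_of_le hym.tgt hR hAR hRS
  have hRk : R ⊆ G.sg S k := by
    intro r hr
    obtain ⟨a, ha, t, ht, rfl⟩ := hRmul r hr
    exact (hL.isSubgroup_sg k).mul_mem (hL.subset_sg hkm ha) (hk ht)
  have hRf : G.cj k '' R ⊆ G.sg S (G.inv f) := by
    rintro _ ⟨r, hr, rfl⟩
    obtain ⟨a, ha, t, ht, rfl⟩ := hRmul r hr
    rw [(hL.cj_mul_of_sg (hL.subset_sg hkm ha) (hk ht)).2]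
    refine (hL.isSubgroup_sg _).mul_mem ?_ (inter_subset_sg_inv hL hN hf (cj_mem_inter hN hk ht))
    have := hkm.image_mem ha
    rw [← h2] at this
    exact hL.subset_sg hfm.inv this
  have hkR := hL.mor hRΔ hRk
  have hfR := hL.mor hkR.tgt hRf
  have hz := hL.mor_mul hym.inv hxm
  have ez : k = G.mul (G.mul (G.inv y) x) f := by
    rw [hL.assoc hym.inv hxm hfm, e, hL.inv_mul_cancel hym hkm]
  have hzR := hL.mor_mul hkR hfR
  have ez' : G.mul k (G.inv f) = G.mul (G.inv y) x := by
    conv_lhs => rw [ez]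
    exact hL.mul_inv_cancel hz hfm
  rw [ez'] at hzR
  have hzN := hN.mul_mem (hL.mul_mem_D hym.inv hxm) (hN.inv_mem y hy) hx
  have hzs := mor_self_of_inter_subset hL hN hzN hRΔ hTR (hL.subset_sg hzR)
  have h3 := hfR.inv
  rw [G.inv_inv, hzR.unique hzs] at h3
  exact ⟨R, hRΔ, hTR, hL.subset_sg h3, _, hzN, hzs, ez⟩

/-- The splitting lemma. -/
theorem IsMaxRep.sg_mul_subset {x f : L} (hf : G.IsMaxRep Δ S N f) (hx : x ∈ N)
    (hD : [x, f] ∈ G.D) : G.sg S (G.mul x f) ⊆ G.conjInto S [x, f] := by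
  -- A factorization yk valid on all of S_{xf} exists. As k agrees with f, maximality of f turns it
  -- into y'f, still valid on S_{xf}; cancelling f gives y' = x.
  obtain ⟨k, hk, y, hy, h1, e⟩ := exists_isMaxRep_mul hL hN (G.mul x f)
  have hP := hL.conjInto_mem hD
  have h2 : G.conjInto S [x, f] ⊆ G.sg S (G.mul x f) := fun a ha => (hL.cj_mul_pair hD ha).1
  obtain ⟨R, hR⟩ := exists_agree hL hN hP hx hy hf.1 hk.1 subset_rfl (h2.trans h1) e
  obtain ⟨y', hy', h3, e'⟩ := (hf.agree hL hN hR).exists_subset_pair hL hN hy (hL.sg_mem _) h1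
    (hL.subset_sg (hL.mor_pair (hL.sg_mem _) h1).2)
  rw [← e] at e'
  obtain ⟨hm1, hm2⟩ := hL.mor_pair (hL.sg_mem _) h3
  have h4 : y' = x := by
    rw [← hL.mul_inv_cancel hm1 hm2, ← e', G.mul_inv_cancel' hD]
  rwa [h4] at h3

lemma IsMaxRep.exists_of_mem_coset {g f : L} (hf : G.IsMaxRep Δ S N f) (hg : g ∈ G.coset N f) :
    ∃ x ∈ N, G.sg S g ⊆ G.conjInto S [x, f] ∧ g = G.mul x f := by
  obtain ⟨x, hx, hD, rfl⟩ := mem_coset.1 hg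
  exact ⟨x, hx, hf.sg_mul_subset hL hN hx hD, rfl⟩

omit hL hN in
lemma mem_coset_of_subset_pair (hP : G.IsPreLocality Δ S) {P : Set L} {x f : L} (hx : x ∈ N)
    (h : P ∈ Δ) (hxf : P ⊆ G.conjInto S [x, f]) : G.mul x f ∈ G.coset N f :=
  mem_coset.2 ⟨x, hx, hP.mem_D (hP.via h hxf), rfl⟩

lemma IsMaxRep.sg_subset {g f : L} (hf : G.IsMaxRep Δ S N f) (hg : g ∈ G.coset N f) :
    G.sg S g ⊆ G.sg S f := by
  obtain ⟨x, hx, h1, -⟩ := hf.exists_of_mem_coset hL hN hg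
  exact (exists_mul_eq_mul_right hL hN hx hf.1 (hL.sg_mem g) h1).1

lemma exists_mem_coset (g : L) : ∃ f, G.IsMaxRep Δ S N f ∧ g ∈ G.coset N f := by
  obtain ⟨f, hf, x, hx, h, rfl⟩ := exists_isMaxRep_mul hL hN g
  exact ⟨f, hf, mem_coset_of_subset_pair hL.toIsPreLocality hx (hL.sg_mem _) h⟩

lemma Agree.coset_subset {f k : L} (hA : G.Agree Δ S N (G.sg S f) f k) :
    G.coset N f ⊆ G.coset N k := by
  intro g hg
  obtain ⟨x, hx, hD, rfl⟩ := mem_coset.1 hg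
  have hP := hL.conjInto_mem hD
  obtain ⟨y, hy, h1, e⟩ := hA.exists_subset_pair hL hN hx hP subset_rfl
    (hL.subset_sg (hL.mor_pair hP subset_rfl).2)
  rw [e]
  exact mem_coset_of_subset_pair hL.toIsPreLocality hy hP h1

/-- The two factorizations of g make f and k agree on some object, and each is maximal, so each
coset contains the other. -/
lemma IsMaxRep.coset_eq {g f k : L} (hf : G.IsMaxRep Δ S N f) (hk : G.IsMaxRep Δ S N k)
    (hgf : g ∈ G.coset N f) (hgk : g ∈ G.coset N k) : G.coset N f = G.coset N k := by
  obtain ⟨x, hx, h1, e⟩ := hf.exists_of_mem_coset hL hN hgf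
  obtain ⟨y, hy, h2, e'⟩ := hk.exists_of_mem_coset hL hN hgk
  obtain ⟨R, hR⟩ := exists_agree hL hN (hL.sg_mem g) hx hy hf.1 hk.1 h1 h2 (e.symm.trans e')
  exact ((hk.agree hL hN (hR.symm hL hN)).coset_subset hL hN).antisymm
    ((hf.agree hL hN hR).coset_subset hL hN)

lemma IsMaxRep.exists_mul_mem_coset {P : Set L} {x h f : L} (hf : G.IsMaxRep Δ S N f)
    (hh : h ∈ G.coset N f) (hx : x ∈ N) (hP : P ∈ Δ) (hxh : P ⊆ G.conjInto S [x, h]) :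
    G.mul x h ∈ G.coset N f := by
  obtain ⟨y, hy, h1, rfl⟩ := hf.exists_of_mem_coset hL hN hh
  obtain ⟨hxm, hhm⟩ := hL.mor_pair hP hxh
  obtain ⟨hym, hfm⟩ := hL.mor_pair hxm.tgt ((hL.subset_sg hhm).trans h1)
  rw [← hL.assoc hxm hym hfm]
  exact mem_coset_of_subset_pair hL.toIsPreLocality (hN.mul_mem (hL.mul_mem_D hxm hym) hx hy) hP
    (hL.subset_pair (hL.mor_mul hxm hym) hfm)

lemma IsMaxRep.coset_subset {h f : L} (hf : G.IsMaxRep Δ S N f) (hh : h ∈ G.coset N f) :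
    G.coset N h ⊆ G.coset N f := by
  intro g hg
  obtain ⟨x, hx, hD, rfl⟩ := mem_coset.1 hg
  exact hf.exists_mul_mem_coset hL hN hh hx (hL.conjInto_mem hD) subset_rfl

lemma IsMaxRep.maximal {f : L} (hf : G.IsMaxRep Δ S N f) :
    Maximal (fun Y : Set L => ∃ f : L, Y = G.coset N f) (G.coset N f) := by
  refine ⟨⟨f, rfl⟩, ?_⟩
  rintro _ ⟨h, rfl⟩ hle
  obtain ⟨k, hk, hhk⟩ := exists_mem_coset hL hN h
  have h1 := hk.coset_subset hL hN hhk
  rw [hf.coset_eq hL hN hk (mem_coset_self hN f) (h1 (hle (mem_coset_self hN f)))]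
  exact h1

lemma exists_isMaxRep_of_maximal {X : Set L}
    (hX : Maximal (fun Y : Set L => ∃ f : L, Y = G.coset N f) X) :
    ∃ f, G.IsMaxRep Δ S N f ∧ X = G.coset N f := by
  obtain ⟨⟨h, rfl⟩, hmax⟩ := hX
  obtain ⟨k, hk, hhk⟩ := exists_mem_coset hL hN h
  have h1 := hk.coset_subset hL hN hhk
  exact ⟨k, hk, h1.antisymm (hmax ⟨k, rfl⟩ h1)⟩

end Agree

end PartialGroup

namespace PartialGroup

/-! ### Homomorphisms and their kernels. -/

section Hom

variable {L : Type u} {L' : Type v} {G : PartialGroup L} {G' : PartialGroup L'} {β : L → L'}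

lemma IsHom.map_mem (h : G.IsHom G' β) {w : List L} (hw : w ∈ G.D) : w.map β ∈ G'.D :=
  (h w hw).1

lemma IsHom.map_pr (h : G.IsHom G' β) {w : List L} (hw : w ∈ G.D) :
    β (G.pr w) = G'.pr (w.map β) := by
  obtain ⟨hD, e⟩ := h w hw
  rwa [G.pr_eq, G'.pr_eq] at e

lemma IsHom.map_one (h : G.IsHom G' β) : β G.one = G'.one := by
  have := h.map_pr G.nil_mem
  rwa [G.pr_nil, List.map_nil, G'.pr_nil] at this

lemma IsHom.map_mul (h : G.IsHom G' β) {a b : L} (hD : [a, b] ∈ G.D) :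
    [β a, β b] ∈ G'.D ∧ β (G.mul a b) = G'.mul (β a) (β b) :=
  ⟨h.map_mem hD, h.map_pr hD⟩

lemma IsHom.map_inv (h : G.IsHom G' β) (a : L) : β (G.inv a) = G'.inv (β a) := by
  have h1 := h.map_mul (G.inv_mul_mem a)
  rw [G.inv_mul_self, h.map_one] at h1
  exact G'.eq_inv_of_mul_eq_one h1.1 h1.2.symm

lemma IsHom.map_cj (h : G.IsHom G' β) {g x : L} (hD : [G.inv g, x, g] ∈ G.D) :
    [G'.inv (β g), β x, β g] ∈ G'.D ∧ β (G.cj g x) = G'.cj (β g) (β x) := by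
  have h1 := h.map_mem hD
  have h2 := h.map_pr hD
  simp only [List.map_cons, List.map_nil, h.map_inv] at h1 h2
  exact ⟨h1, h2⟩

/-- The kernel of a homomorphism is a partial normal subgroup. -/
lemma IsHom.isPartialNormal_ker (h : G.IsHom G' β) : G.IsPartialNormal (G'.ker β) where
  nonempty := ⟨G.one, h.map_one⟩
  inv_mem := by
    intro x hx
    change β x = G'.one at hx
    change β (G.inv x) = G'.one
    rw [h.map_inv, hx, G'.inv_one]
  prod_mem := by
    intro w hw hx
    change β _ = G'.one
    rw [G.pr_eq]
    induction w with
    | nil => rw [G.pr_nil, h.map_one]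
    | cons a w ih =>
      have h1 := G.pr_cons hw
      have ha : β a = G'.one := hx a (by simp)
      rw [← h1.2, (h.map_mul h1.1).2, ha, G'.one_mul',
        ih (G.mem_right (u := [a]) hw) fun x hxw => hx x (by simp [hxw])]
  conj_mem := by
    intro x hx g y hy
    change β x = G'.one at hx
    obtain ⟨hD, rfl⟩ := G.conj_iff.1 hy
    change β _ = G'.one
    rw [(h.map_cj hD).2, hx, (G'.cj_one_elem _).2]

/-- Words of length one lie in the domain, so β is surjective and inversion is determined along with
the product. -/
lemma eq_of_isHom {Q Q' : PartialGroup L'} (hD : Q.D = List.map β '' G.D)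
    (hD' : Q'.D = List.map β '' G.D) (h : G.IsHom Q β) (h' : G.IsHom Q' β) : Q = Q' := by
  have hpr : ∀ (w : List L') (hw : w ∈ Q.D) (hw' : w ∈ Q'.D), Q.prod w hw = Q'.prod w hw' := by
    intro w hw hw'
    rw [Q.pr_eq, Q'.pr_eq]
    rw [hD] at hw
    obtain ⟨u, hu, rfl⟩ := hw
    rw [← h.map_pr hu, ← h'.map_pr hu]
  have hinv : Q.inv = Q'.inv := by
    ext x
    have hx := Q.singleton_mem x
    rw [hD] at hx
    obtain ⟨u, -, hu⟩ := hx
    obtain ⟨a, -, rfl⟩ := List.mem_map.1 (hu ▸ List.mem_singleton_self x)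
    rw [← h.map_inv, ← h'.map_inv]
  have hDD := hD.trans hD'.symm
  cases Q
  cases Q'
  simp only at hDD hinv
  subst hDD hinv
  congr
  ext w hw
  exact hpr w hw hw

lemma IsHom.isSubgroup_image (h : G.IsHom G' β) {H : Set L} (hH : G.IsSubgroup H) :
    G'.IsSubgroup (β '' H) := by
  refine isSubgroup_of_mul ⟨_, hH.one_mem, h.map_one⟩ ?_ ?_ ?_
  · rintro _ ⟨x, hx, rfl⟩
    exact ⟨_, hH.inv_mem x hx, h.map_inv x⟩
  · rintro _ ⟨x, hx, rfl⟩ _ ⟨y, hy, rfl⟩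
    exact ⟨_, hH.mul_mem hx hy, (h.map_mul (hH.mem_D _ (by simp [hx, hy]))).2⟩
  · intro w hw
    obtain ⟨u, hu, rfl⟩ : ∃ u : List L, (∀ x ∈ u, x ∈ H) ∧ u.map β = w := by
      induction w with
      | nil => exact ⟨[], by simp, rfl⟩
      | cons a w ih =>
        obtain ⟨u, hu, rfl⟩ := ih fun x hx => hw x (by simp [hx])
        obtain ⟨b, hb, rfl⟩ := hw a (by simp)
        exact ⟨b :: u, by simpa [hb] using hu, rfl⟩
    exact h.map_mem (hH.mem_D u hu)

lemma IsHom.isPElem (h : G.IsHom G' β) {p : ℕ} {x : L} (hx : G.IsPElem p x) :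
    G'.IsPElem p (β x) := by
  obtain ⟨k, hk, e⟩ := hx
  have h1 := h.map_mem hk
  have h2 := h.map_pr hk
  rw [← G.pr_eq hk, e, h.map_one] at h2
  rw [List.map_replicate] at h1 h2
  exact ⟨k, h1, by rw [G'.pr_eq, h2]⟩

end Hom

/-! ### The partial group of maximal cosets. -/

section Quotient

variable {L : Type u} {G : PartialGroup L} {Δ : Set (Set L)} {S : Set L} {p : ℕ} {N : Set L}

lemma IsObjective.exists_mor_pr (hO : G.IsObjective Δ) {P : Set L} {w : List L}
    (h : G.Via Δ P w) : ∃ Q, G.Mor Δ (G.pr w) P Q := by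
  induction w generalizing P with
  | nil =>
    rw [G.pr_nil]
    exact ⟨P, mor_one h⟩
  | cons a w ih =>
    obtain ⟨h1, h2⟩ := h.uncons
    obtain ⟨Q, hQ⟩ := ih h2
    rw [← (G.pr_cons (hO.mem_D h)).2]
    exact ⟨Q, hO.mor_mul h1 hQ⟩

variable (hL : G.IsLocality p Δ S) (hN : G.IsPartialNormal N)

/-- A representative of a maximal coset. -/
noncomputable def rep (X : G.Quotient N) : L := (exists_isMaxRep_of_maximal hL hN X.2).choose

lemma isMaxRep_rep (X : G.Quotient N) : G.IsMaxRep Δ S N (rep hL hN X) :=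
  (exists_isMaxRep_of_maximal hL hN X.2).choose_spec.1

lemma coset_rep (X : G.Quotient N) : X.1 = G.coset N (rep hL hN X) :=
  (exists_isMaxRep_of_maximal hL hN X.2).choose_spec.2

/-- The maximal coset of an element. -/
noncomputable def proj (g : L) : G.Quotient N :=
  ⟨G.coset N (exists_mem_coset hL hN g).choose,
    (exists_mem_coset hL hN g).choose_spec.1.maximal hL hN⟩

lemma mem_proj (g : L) : g ∈ (proj hL hN g).1 := (exists_mem_coset hL hN g).choose_spec.2

lemma mem_iff_eq_proj (g : L) (X : G.Quotient N) : g ∈ X.1 ↔ X = proj hL hN g := by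
  constructor
  · intro h
    apply Subtype.ext
    have h' := mem_proj hL hN g
    rw [coset_rep hL hN] at h h'
    rw [coset_rep hL hN X, coset_rep hL hN (proj hL hN g)]
    exact (isMaxRep_rep hL hN _).coset_eq hL hN (isMaxRep_rep hL hN _) h h'
  · rintro rfl
    exact mem_proj hL hN g

lemma proj_rep (X : G.Quotient N) : proj hL hN (rep hL hN X) = X := by
  refine ((mem_iff_eq_proj hL hN _ X).1 ?_).symm
  rw [coset_rep hL hN X]
  exact mem_coset_self hN _

lemma map_proj_map_rep (w : List (G.Quotient N)) :
    (w.map (rep hL hN)).map (proj hL hN) = w := by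
  rw [List.map_map]
  exact (List.map_congr_left fun X _ => proj_rep hL hN X).trans (List.map_id w)

lemma IsMaxRep.proj_eq_iff {f g : L} (hf : G.IsMaxRep Δ S N f) :
    proj hL hN g = proj hL hN f ↔ g ∈ G.coset N f := by
  let X : G.Quotient N := ⟨_, hf.maximal hL hN⟩
  have h : X = proj hL hN f := (mem_iff_eq_proj hL hN f X).1 (mem_coset_self hN f)
  rw [← h, eq_comm]
  exact (mem_iff_eq_proj hL hN g X).symm

lemma mem_coset_rep_proj (g : L) : g ∈ G.coset N (rep hL hN (proj hL hN g)) := by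
  rw [← coset_rep]
  exact mem_proj hL hN g

lemma proj_mul_left {x h : L} (hx : x ∈ N) (hD : [x, h] ∈ G.D) :
    proj hL hN (G.mul x h) = proj hL hN h := by
  have h1 := isMaxRep_rep hL hN (proj hL hN h)
  have h2 := (h1.proj_eq_iff hL hN).2 (h1.exists_mul_mem_coset hL hN (mem_coset_rep_proj hL hN h) hx
    (hL.conjInto_mem hD) subset_rfl)
  rw [h2, proj_rep]

include hL hN in
-- Each letter is some x_i f_i, and the factors x_i are moved to the front one by one. The subgroup
-- S_{fs} contains S ∩ N, so by `cj_mem_iff` the leading x can be dropped when testing whether P ⊆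
-- S_{fs}.
lemma forall₂_isMaxRep {w fs : List L}
    (h : List.Forall₂ (fun g f => G.IsMaxRep Δ S N f ∧ g ∈ G.coset N f) w fs) {P : Set L}
    (hP : P ∈ Δ) (hw : P ⊆ G.conjInto S w) :
    P ⊆ G.conjInto S fs ∧ S ∩ N ⊆ G.conjInto S fs ∧
      ∃ x ∈ N, P ⊆ G.conjInto S (x :: fs) ∧ G.pr w = G.pr (x :: fs) := by
  induction h generalizing P with
  | nil =>
    refine ⟨hw, Set.inter_subset_left, G.one, hN.one_mem, ?_, ?_⟩
    · rw [conjInto_single, hL.sg_one]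
      exact hL.subset_S P hP
    · rw [G.pr_singleton, G.pr_nil]
  | @cons g f w fs hgf _ ih =>
    obtain ⟨hf, hgf⟩ := hgf
    have hvia := hL.via hP hw
    obtain ⟨hg, hviaw⟩ := hvia.uncons
    obtain ⟨-, hTfs, x', hx', hP1, e⟩ := ih hg.tgt (hL.subset_conjInto hviaw)
    obtain ⟨x, hx, hgxf, rfl⟩ := hf.exists_of_mem_coset hL hN hgf
    obtain ⟨hxm, hfm⟩ := hL.mor_pair hP ((hL.subset_sg hg).trans hgxf)
    have hvia' := hL.via hg.tgt hP1
    obtain ⟨hxm', hviaf⟩ := hvia'.uncons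
    rw [← (hL.mor_mul hxm hfm).unique hg] at hxm' hviaf hvia'
    obtain ⟨y, hy, hyf, e'⟩ := exists_mul_eq_mul_left hL hN hx' hf.1 hfm.src
      (hL.subset_pair hfm hxm')
    obtain ⟨hym, hfm'⟩ := hL.mor_pair hfm.src hyf
    have h1 := hL.mor_mul hym hfm'
    rw [← e'] at h1
    have h2 := h1.unique (hL.mor_mul hfm hxm')
    rw [h2] at hfm'
    have hviafs := hfm'.cons hviaf
    have hvian := (hL.mor_mul hxm hym).cons hviafs
    have hTf : S ∩ N ⊆ G.conjInto S (f :: fs) := fun t ht =>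
      mem_conjInto_cons.2 ⟨hf.1 ht, hTfs (cj_mem_inter hN hf.1 ht)⟩
    refine ⟨fun a ha => ?_, hTf, G.mul x y, hN.mul_mem (hL.mul_mem_D hxm hym) hx hy,
      hL.subset_conjInto hvian, ?_⟩
    · have h3 := mem_conjInto_cons.1 (hL.subset_conjInto hvian ha)
      exact (cj_mem_iff hL.toIsPreLocality hN (hN.mul_mem (hL.mul_mem_D hxm hym) hx hy) h3.1
        (hL.isSubgroup_conjInto _) hTf).2 h3.2
    · obtain ⟨Z, hZ⟩ := hL.exists_mor_pr hviaf
      rw [← (G.pr_cons (hL.mem_D hvia)).2, e, ← (G.pr_cons (hL.mem_D hvia')).2,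
        ← (G.pr_cons (hL.mem_D hvian)).2, ← (G.pr_cons (hL.mem_D hviafs)).2,
        hL.assoc hxm hfm (hL.mor_mul hxm' hZ), ← hL.assoc hfm hxm' hZ, e',
        hL.assoc hym hfm' hZ, ← hL.assoc hxm hym (hL.mor_mul hfm' hZ)]

lemma mem_D_of_forall₂ {w fs : List L}
    (h : List.Forall₂ (fun g f => G.IsMaxRep Δ S N f ∧ g ∈ G.coset N f) w fs) (hw : w ∈ G.D) :
    fs ∈ G.D ∧ proj hL hN (G.pr w) = proj hL hN (G.pr fs) := by
  obtain ⟨h1, -, x, hx, h2, e⟩ := forall₂_isMaxRep hL hN h (hL.conjInto_mem hw) subset_rfl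
  have h3 := G.pr_cons (hL.mem_D (hL.via (hL.conjInto_mem hw) h2))
  refine ⟨hL.mem_D (hL.via (hL.conjInto_mem hw) h1), ?_⟩
  rw [e, ← h3.2, proj_mul_left hL hN hx h3.1]

lemma mem_D_rep_proj {w : List L} (hw : w ∈ G.D) :
    (w.map (proj hL hN)).map (rep hL hN) ∈ G.D ∧
      proj hL hN (G.pr w) = proj hL hN (G.pr ((w.map (proj hL hN)).map (rep hL hN))) := by
  refine mem_D_of_forall₂ hL hN ?_ hw
  rw [List.map_map, List.forall₂_map_right_iff, List.forall₂_same]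
  exact fun g _ => ⟨isMaxRep_rep hL hN _, mem_coset_rep_proj hL hN g⟩

lemma proj_inv (g : L) :
    proj hL hN (G.inv g) = proj hL hN (G.inv (rep hL hN (proj hL hN g))) := by
  have hf := isMaxRep_rep hL hN (proj hL hN g)
  set f := rep hL hN (proj hL hN g) with hfdef
  obtain ⟨x, hx, hD, e⟩ := mem_coset.1 (mem_coset_rep_proj hL hN g)
  rw [← hfdef] at hD e
  have hD' : [G.inv f, G.inv x] ∈ G.D := by simpa using G.inv_word_mem hD
  obtain ⟨y, hy, h1, e'⟩ := exists_mul_eq_mul_left hL hN (hN.inv_mem x hx)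
    (inter_subset_sg_inv hL hN hf.1) (hL.conjInto_mem hD') subset_rfl
  rw [← e, G.inv_mul_rev hD, e',
    proj_mul_left hL hN hy (hL.mem_D (hL.via (hL.conjInto_mem hD') h1))]

/-- The partial group structure on the set of maximal cosets. -/
noncomputable def quot : PartialGroup (G.Quotient N) where
  D := {w | w.map (rep hL hN) ∈ G.D}
  prod w _ := proj hL hN (G.pr (w.map (rep hL hN)))
  inv X := proj hL hN (G.inv (rep hL hN X))
  nil_mem := G.nil_mem
  singleton_mem X := G.singleton_mem _
  of_append u v h := by
    change (u ++ v).map _ ∈ G.D at h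
    rw [List.map_append] at h
    exact G.of_append _ _ h
  prod_singleton X := by
    rw [List.map_singleton, G.pr_singleton, proj_rep]
  prod_append u v w h _ := by
    change (u ++ v ++ w).map _ ∈ G.D at h
    simp only [List.map_append] at h
    have h1 := G.pr_mid _ _ _ h
    -- The contracted letter, a product of representatives, need not be the chosen representative of
    -- its coset; `mem_D_rep_proj` permits the replacement.
    have h2 := mem_D_rep_proj hL hN h1.1
    rw [h1.2] at h2
    simp only [List.map_append, List.map_cons, map_proj_map_rep] at h2
    refine ⟨?_, ?_⟩
    · change (u ++ [_] ++ w).map _ ∈ G.D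
      simpa using h2.1
    · simpa using h2.2
  inv_inv X := by rw [← proj_inv, G.inv_inv, proj_rep]
  inv_append w hw := by
    have h1 := G.inv_append' hw
    have h2 := mem_D_rep_proj hL hN h1.1
    rw [h1.2, List.map_append, map_proj_map_rep] at h2
    have e : ((w.map (rep hL hN)).map G.inv).reverse.map (proj hL hN) =
        (w.map fun X => proj hL hN (G.inv (rep hL hN X))).reverse := by
      simp [List.map_reverse, Function.comp_def]
    rw [e] at h2
    refine ⟨h2.1, ?_⟩
    rw [← h2.2, List.map_nil, G.pr_nil]

lemma isHom_proj : G.IsHom (quot hL hN) (proj hL hN) := by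
  intro w hw
  have h := mem_D_rep_proj hL hN hw
  exact ⟨h.1, by rw [G.pr_eq]; exact h.2⟩

lemma quot_D : (quot hL hN).D = List.map (proj hL hN) '' G.D := by
  ext w
  constructor
  · intro hw
    exact ⟨_, hw, map_proj_map_rep hL hN w⟩
  · rintro ⟨u, hu, rfl⟩
    exact (isHom_proj hL hN).map_mem hu

include hL in
lemma isMaxRep_of_mem_S {s : L} (hs : s ∈ S) : G.IsMaxRep Δ S N s := by
  refine ⟨?_, fun f' _ => ?_⟩
  · rw [hL.sg_of_mem_S hs]
    exact Set.inter_subset_left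
  · rw [hL.sg_of_mem_S hs]
    exact sg_subset f'

lemma ker_proj : (quot hL hN).ker (proj hL hN) = N := by
  have h1 := isMaxRep_of_mem_S (N := N) hL hL.isSubgroup_S.one_mem
  ext g
  change proj hL hN g = (quot hL hN).one ↔ _
  rw [← (isHom_proj hL hN).map_one, h1.proj_eq_iff hL hN, mem_coset]
  constructor
  · rintro ⟨x, hx, -, rfl⟩
    rwa [G.mul_one']
  · exact fun hg => ⟨g, hg, G.mul_one_mem g, G.mul_one' g⟩

include hL hN in
-- If k = z f⁻¹ agrees with f⁻¹, then k⁻¹ = f z⁻¹ lies in Nf, whence S_{k⁻¹} = S_f. Applying k⁻¹ to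
-- both sides gives S_k = S_{f⁻¹}.
lemma IsMaxRep.inv {f : L} (hf : G.IsMaxRep Δ S N f) : G.IsMaxRep Δ S N (G.inv f) := by
  have hT := inter_subset_sg_inv hL hN hf.1
  refine ⟨hT, fun k hk => ?_⟩
  have hl := hk.left hL
  obtain ⟨z, hz, hzm, rfl⟩ := hk.exists_mor
  have hfm := hL.mor_sg (S := S) f
  have hD := hL.mul_mem_D hzm hfm.inv
  have hkm := hL.mor_mul hzm hfm.inv
  have e : G.inv (G.mul z (G.inv f)) = G.mul f (G.inv z) := by
    rw [G.inv_mul_rev hD, G.inv_inv]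
  obtain ⟨y, hy, h1, e'⟩ := exists_mul_eq_mul_left hL hN (hN.inv_mem z hz) hf.1 hfm.src
    (hL.subset_pair hfm hzm.inv)
  have h2 : G.inv (G.mul z (G.inv f)) ∈ G.coset N f := by
    rw [e, e']
    exact mem_coset_of_subset_pair hL.toIsPreLocality hy hfm.src h1
  have h3 := hf.sg_subset hL hN h2
  have h4 := hL.mor_sg (S := S) (G.mul z (G.inv f))
  have h5 := hL.subset_sg hkm.inv
  have h6 := h3.antisymm h5
  rw [h6] at h4
  have h7 := h4.inv.unique hkm.inv
  rw [h7]

/-- A word of the quotient's domain has some lift in the domain of L, and its letters may be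
replaced by any maximal representatives of their cosets. -/
lemma mem_D_of_proj_mem {fs : List L} (hfs : ∀ f ∈ fs, G.IsMaxRep Δ S N f)
    (h : fs.map (proj hL hN) ∈ (quot hL hN).D) : fs ∈ G.D := by
  rw [quot_D] at h
  obtain ⟨w, hw, e⟩ := h
  refine (mem_D_of_forall₂ hL hN (w := w) ?_ hw).1
  clear hw
  induction fs generalizing w with
  | nil =>
    obtain rfl := List.map_eq_nil_iff.1 e
    exact List.Forall₂.nil
  | cons f fs ih =>
    cases w with
    | nil => simp at e
    | cons g w =>
      simp only [List.map_cons, List.cons.injEq] at e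
      have hf := hfs f (by simp)
      exact List.Forall₂.cons ⟨hf, (hf.proj_eq_iff hL hN).1 e.1⟩
        (ih (fun f hf => hfs f (by simp [hf])) w e.2)

/-- An element of `S` that is conjugated into the image of `S` by the image of `f` is conjugated
into `S` by `f`. -/
theorem IsMaxRep.mem_sg_of_proj {f s : L} (hf : G.IsMaxRep Δ S N f) (hs : s ∈ S)
    (h : proj hL hN s ∈ (quot hL hN).sg (proj hL hN '' S) (proj hL hN f)) : s ∈ G.sg S f := by
  have hhom := isHom_proj hL hN
  -- All three letters are maximal representatives, so the word lifts from the quotient.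
  have hD : [G.inv f, s, f] ∈ G.D := by
    refine mem_D_of_proj_mem hL hN ?_ ?_
    · simp only [List.mem_cons, List.not_mem_nil, or_false]
      rintro k (rfl | rfl | rfl)
      exacts [hf.inv hL hN, isMaxRep_of_mem_S hL hs, hf]
    · simp only [List.map_cons, List.map_nil, hhom.map_inv]
      exact h.2.1
  obtain ⟨s', hs', es'⟩ := h.2.2
  rw [← (hhom.map_cj hD).2, eq_comm,
    (isMaxRep_of_mem_S hL hs').proj_eq_iff hL hN, mem_coset] at es'
  obtain ⟨x, hx, -, et⟩ := es'
  obtain ⟨-, hft, eft⟩ := G.mul_cj hD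
  rw [← et] at hft eft
  have hP := hL.conjInto_mem hft
  obtain ⟨hfm, htm⟩ := hL.mor_pair hP subset_rfl
  obtain ⟨C, hxm, hsm⟩ := mor_mul_S hL.toIsPreLocality hs' htm
  obtain ⟨y, hy, hyf, e⟩ := exists_mul_eq_mul_left hL hN hx hf.1 hP (hL.subset_pair hfm hxm)
  -- With s^f = x s' this reads s f s'⁻¹ = f x = y f, an element of Nf.
  have e1 : G.mul y f = G.mul (G.mul s f) (G.inv s') := by
    rw [← eft, ← hL.assoc hfm hxm hsm, hL.mul_inv_cancel (hL.mor_mul hfm hxm) hsm, e]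
  have hfS := hL.mor_sg (S := S) f
  have hsW := hL.mor_of_mem_S hfS.src (hL.isSubgroup_S.inv_mem s hs)
  -- s f s'⁻¹ acts on the conjugate of S_f by s⁻¹. As f has the largest S_f in its coset, that
  -- conjugate lies in S_f, so s normalizes S_f.
  have hW : G.cj (G.inv s) '' G.sg S f ⊆ G.sg S f := by
    have h1 := hsW.inv
    rw [G.inv_inv] at h1
    have h2 := hL.mor_mul (hL.mor_mul h1 hfS)
      (hL.mor_of_mem_S hfS.tgt (hL.isSubgroup_S.inv_mem s' hs'))
    rw [← e1] at h2
    exact (hL.subset_sg h2).trans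
      (hf.sg_subset hL hN (mem_coset_of_subset_pair hL.toIsPreLocality hy hP hyf))
  have hsN : G.Mor Δ s (G.sg S f) (G.sg S f) := by
    have h1 := hL.image_star_eq hL.finite_dim (hL.subset_sg hsW) (hW.trans (subset_star _))
    rw [star_sg] at h1
    rw [h1] at hsW
    have := hsW.inv
    rwa [G.inv_inv] at this
  -- Now s^f ∈ NS gives v ∈ N with s ∈ S_{fv}; and fv = zf ∈ Nf implies S_{fv} ⊆ S_f.
  obtain ⟨v, hv, hQv, hsv⟩ := exists_conj_into_of_normal hL hN hfS (Set.finite_singleton s)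
    (by simpa using hs) (by rintro _ rfl; exact hsN) (by
      rintro _ rfl
      rw [← et]
      exact mul_mem_mulSet hL.toIsPreLocality hx hs')
  have hvm := hL.mor hfS.tgt hQv
  have h1 : s ∈ G.sg S (G.mul f v) := by
    refine hL.mem_sg_of_nz (hL.mor_mul hfS hvm) hsN hs ?_
    rw [(hL.cj_comp hfS hvm hsN).2]
    exact hsv s rfl
  obtain ⟨z, hz, hzf, e2⟩ := exists_mul_eq_mul_left hL hN hv hf.1 hfS.src
    (hL.subset_pair hfS hvm)
  rw [e2] at h1
  exact hf.sg_subset hL hN (mem_coset_of_subset_pair hL.toIsPreLocality hz hfS.src hzf) h1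

end Quotient

end PartialGroup

namespace PartialGroup

/-! ### Subgroups normalize objects. -/

section Normalizing

variable {L : Type u} {G : PartialGroup L} {Δ : Set (Set L)} {S : Set L}

lemma IsObjective.exists_mor_of_append (hO : G.IsObjective Δ) {P : Set L} {u v : List L}
    (h : G.Via Δ P (u ++ v)) : ∃ Q, G.Mor Δ (G.pr u) P Q ∧ G.Via Δ Q v := by
  induction u generalizing P with
  | nil =>
    rw [G.pr_nil]
    exact ⟨P, mor_one h.src, h⟩
  | cons a u ih =>
    obtain ⟨h1, h2⟩ := h.uncons
    obtain ⟨Q, hQ, hv⟩ := ih h2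
    rw [← (G.pr_cons (G.mem_left (u := a :: u) (hO.mem_D h))).2]
    exact ⟨Q, hO.mor_mul h1 hQ, hv⟩

/-- Every subgroup normalizes an object. -/
lemma IsPreLocality.exists_subset_nz (hP : G.IsPreLocality Δ S)
    (hf : Order.krullDim (G.Omega S) < ⊤) {H : Set L} (hH : G.IsSubgroup H) :
    ∃ P ∈ Δ, H ⊆ G.nz Δ P := by
  obtain ⟨M, hM⟩ := hP.exists_depth_le hf
  -- Maximizing M − depth selects a word over H with S_w of least depth.
  obtain ⟨w, hw, hmin⟩ := exists_max_of_bounded (A := {w : List L | ∀ x ∈ w, x ∈ H})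
    ⟨[], by simp⟩ (fun w => M - G.depth S (G.conjInto S w)) M fun w _ => Nat.sub_le _ _
  have hPΔ := hP.conjInto_mem (hH.mem_D w hw)
  refine ⟨_, hPΔ, fun h hh => ?_⟩
  set W := (w.map G.inv).reverse with hW
  have hWH : ∀ x ∈ W, x ∈ H := by
    intro x hx
    rw [hW, List.mem_reverse, List.mem_map] at hx
    obtain ⟨y, hy, rfl⟩ := hx
    exact hH.inv_mem y (hw y hy)
  -- For u = w w⁻¹ h w one has S_u ⊆ S_w, and minimality of depth gives S_w ⊆ S_u. Along u, the part
  -- w w⁻¹ returns S_w to itself, h carries it to its conjugate, and the final w forces that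
  -- conjugate into S_w.
  have hu : ∀ x ∈ w ++ W ++ h :: w, x ∈ H := by
    intro x hx
    simp only [List.mem_append, List.mem_cons] at hx
    rcases hx with (hx | hx) | rfl | hx
    exacts [hw x hx, hWH x hx, hh, hw x hx]
  have hsub : G.conjInto S (w ++ W ++ h :: w) ⊆ G.conjInto S w := by
    have : ∀ (a b : List L), G.conjInto S (a ++ b) ⊆ G.conjInto S a := by
      intro a b
      induction a with
      | nil => exact conjInto_subset b
      | cons g a ih =>
        intro x hx
        rw [List.cons_append, mem_conjInto_cons] at hx
        exact mem_conjInto_cons.2 ⟨hx.1, ih hx.2⟩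
    rw [List.append_assoc]
    exact this _ _
  have h1 := hmin _ hu
  have h2 := hM _ (conjInto_subset (G := G) (S := S) w)
  have h3 := hM _ (conjInto_subset (G := G) (S := S) (w ++ W ++ h :: w))
  have h4 := hP.subset_star_of_depth_le hf (hsub.trans (subset_star _)) (conjInto_subset w)
    (by omega)
  rw [star_conjInto] at h4
  obtain ⟨Q, hQ, hv⟩ := hP.exists_mor_of_append (hP.via hPΔ h4)
  have hone : G.pr (w ++ W) = G.one := by
    have := (G.inv_append' (hH.mem_D W hWH)).2
    simpa [hW, List.map_reverse, Function.comp_def, G.inv_inv] using this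
  rw [hone] at hQ
  rw [hQ.unique (mor_one hPΔ)] at hv
  obtain ⟨hm, hv'⟩ := hv.uncons
  have h5 := hP.image_star_eq hf (hP.subset_sg hm)
    ((hP.subset_conjInto hv').trans (subset_star _))
  rw [star_conjInto] at h5
  rwa [h5] at hm

end Normalizing

/-! ### The quotient is a locality. -/

section QuotientLocality

variable {L : Type u} {G : PartialGroup L} {Δ : Set (Set L)} {S : Set L} {p : ℕ} {N : Set L}
variable (hL : G.IsLocality p Δ S) (hN : G.IsPartialNormal N)

/-- The preimage in `S` of a set of maximal cosets. -/
def pre (W : Set (G.Quotient N)) : Set L := {s | s ∈ S ∧ proj hL hN s ∈ W}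

lemma pre_subset (W : Set (G.Quotient N)) : pre hL hN W ⊆ S := fun _ hs => hs.1

lemma proj_eq_one {t : L} (ht : t ∈ N) : proj hL hN t = (quot hL hN).one := by
  have : t ∈ (quot hL hN).ker (proj hL hN) := by rwa [ker_proj]
  exact this

lemma isSubgroup_pre {W : Set (G.Quotient N)} (hW : (quot hL hN).IsSubgroup W) :
    G.IsSubgroup (pre hL hN W) := by
  have hS := hL.isSubgroup_S
  have hhom := isHom_proj hL hN
  refine hS.of_subset (pre_subset hL hN W) ⟨hS.one_mem, ?_⟩ ?_ ?_
  · rw [hhom.map_one]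
    exact hW.one_mem
  · intro x hx
    refine ⟨hS.inv_mem x hx.1, ?_⟩
    rw [hhom.map_inv]
    exact hW.inv_mem _ hx.2
  · intro x hx y hy
    refine ⟨hS.mul_mem hx.1 hy.1, ?_⟩
    rw [(hhom.map_mul (hS.mem_D _ (by simp [hx.1, hy.1]))).2]
    exact hW.mul_mem hx.2 hy.2

lemma inter_subset_pre {W : Set (G.Quotient N)} (hW : (quot hL hN).IsSubgroup W) :
    S ∩ N ⊆ pre hL hN W := fun t ht => ⟨ht.1, by
  rw [proj_eq_one hL hN ht.2]
  exact hW.one_mem⟩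

lemma image_pre {W : Set (G.Quotient N)} (hW : W ⊆ proj hL hN '' S) :
    proj hL hN '' pre hL hN W = W := by
  apply Set.Subset.antisymm
  · rintro _ ⟨s, hs, rfl⟩
    exact hs.2
  · intro X hX
    obtain ⟨s, hs, rfl⟩ := hW hX
    exact ⟨s, ⟨hs, hX⟩, rfl⟩

lemma mem_of_proj_eq {s t : L} (hs : s ∈ S) (ht : t ∈ S) (e : proj hL hN s = proj hL hN t)
    {W : Set L} (hW : G.IsSubgroup W) (hTW : S ∩ N ⊆ W) (htW : t ∈ W) : s ∈ W := by
  have hS := hL.isSubgroup_S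
  obtain ⟨x, hx, hD, rfl⟩ := mem_coset.1 (((isMaxRep_of_mem_S hL ht).proj_eq_iff hL hN).1 e)
  refine hW.mul_mem (hTW ⟨?_, hx⟩) htW
  rw [← G.mul_inv_cancel' hD]
  exact hS.mul_mem hs (hS.inv_mem t ht)

lemma image_subset_S {X : Set (G.Quotient N)} (hX : X ∈ Set.image (proj hL hN) '' Δ) :
    X ⊆ proj hL hN '' S := by
  obtain ⟨P, hP, rfl⟩ := hX
  exact Set.image_mono (hL.subset_S P hP)

lemma isSubgroup_of_mem_image {X : Set (G.Quotient N)} (hX : X ∈ Set.image (proj hL hN) '' Δ) :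
    (quot hL hN).IsSubgroup X := by
  obtain ⟨P, hP, rfl⟩ := hX
  exact (isHom_proj hL hN).isSubgroup_image (hL.isSubgroup P hP)

lemma pre_mem {X : Set (G.Quotient N)} (hX : X ∈ Set.image (proj hL hN) '' Δ) :
    pre hL hN X ∈ Δ := by
  have h1 := isSubgroup_pre hL hN (isSubgroup_of_mem_image hL hN hX)
  obtain ⟨P, hP, rfl⟩ := hX
  exact hL.mem_of_le hP h1 (fun x hx => ⟨hL.subset_S P hP hx, x, hx, rfl⟩) (pre_subset _ _ _)

lemma proj_mem_sg_iff {s : L} (hs : s ∈ S) (X : G.Quotient N) :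
    proj hL hN s ∈ (quot hL hN).sg (proj hL hN '' S) X ↔ s ∈ G.sg S (rep hL hN X) := by
  have e := proj_rep hL hN X
  constructor
  · intro h
    rw [← e] at h
    exact (isMaxRep_rep hL hN X).mem_sg_of_proj hL hN hs h
  · intro h
    have := (isHom_proj hL hN).map_cj h.2.1
    rw [e] at this
    refine ⟨⟨s, hs, rfl⟩, this.1, ?_⟩
    rw [← this.2]
    exact ⟨_, h.2.2, rfl⟩

lemma cj_proj {s : L} {X : G.Quotient N} (h : s ∈ G.sg S (rep hL hN X)) :
    (quot hL hN).cj X (proj hL hN s) = proj hL hN (G.cj (rep hL hN X) s) := by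
  have := ((isHom_proj hL hN).map_cj h.2.1).2
  rw [proj_rep] at this
  exact this.symm

/-- This transfers S_w between the quotient and L; objects, Ω and dimension are compared through it.
-/
lemma proj_mem_conjInto_iff {s : L} (hs : s ∈ S) (w : List (G.Quotient N)) :
    proj hL hN s ∈ (quot hL hN).conjInto (proj hL hN '' S) w ↔
      s ∈ G.conjInto S (w.map (rep hL hN)) := by
  induction w generalizing s with
  | nil => exact ⟨fun _ => hs, fun _ => ⟨s, hs, rfl⟩⟩
  | cons X w ih =>
    rw [List.map_cons, mem_conjInto_cons, mem_conjInto_cons, proj_mem_sg_iff hL hN hs]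
    refine and_congr_right fun h => ?_
    rw [cj_proj hL hN h]
    exact ih h.2.2

lemma mor_proj {g : L} {P Q : Set L} (h : G.Mor Δ g P Q) :
    (quot hL hN).Mor (Set.image (proj hL hN) '' Δ) (proj hL hN g) (proj hL hN '' P)
      (proj hL hN '' Q) where
  src := ⟨P, h.src, rfl⟩
  tgt := ⟨Q, h.tgt, rfl⟩
  dom := by
    rintro _ ⟨x, hx, rfl⟩
    exact ((isHom_proj hL hN).map_cj (h.dom x hx)).1
  img := by
    rw [← h.img, Set.image_image, Set.image_image]
    exact Set.image_congr fun x hx => ((isHom_proj hL hN).map_cj (h.dom x hx)).2.symm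

lemma via_proj {P : Set L} {w : List L} (h : G.Via Δ P w) :
    (quot hL hN).Via (Set.image (proj hL hN) '' Δ) (proj hL hN '' P) (w.map (proj hL hN)) := by
  induction w generalizing P with
  | nil => exact ⟨P, h, rfl⟩
  | cons g w ih => exact (mor_proj hL hN h.uncons.1).cons (ih h.uncons.2)

/-- Both axioms are pulled back to L: preimages in S of objects are objects, and representatives
conjugate them as their cosets do in the quotient. -/
theorem isPreLocality_quot :
    (quot hL hN).IsPreLocality (Set.image (proj hL hN) '' Δ) (proj hL hN '' S) where
  isSubgroup X hX := isSubgroup_of_mem_image hL hN hX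
  mem_D_iff w := by
    constructor
    · intro hw
      obtain ⟨X, hX⟩ := (hL.mem_D_iff _).1 hw
      have := via_proj hL hN hX
      rw [map_proj_map_rep] at this
      exact ⟨_, this⟩
    · rintro ⟨X, hX⟩
      have h1 := hX.subset_conjInto fun Y hY => image_subset_S hL hN hY
      exact hL.mem_D (hL.via (pre_mem hL hN hX.src) fun s hs =>
        (proj_mem_conjInto_iff hL hN hs.1 w).1 (h1 hs.2))
  closed X hX Y hY g Z hZ hZs hZY W hW hZW hWY := by
    have hYS := image_subset_S hL hN hY
    obtain ⟨hD, rfl⟩ := (setConj_iff _).1 hZ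
    have h1 : pre hL hN X ⊆ G.sg S (rep hL hN g) := fun s hs =>
      (proj_mem_sg_iff hL hN hs.1 g).1
        ⟨⟨s, hs.1, rfl⟩, hD _ hs.2, hYS (hZY ⟨_, hs.2, rfl⟩)⟩
    have h2 := hL.mor (pre_mem hL hN hX) h1
    refine ⟨_, hL.mem_of_le h2.tgt (isSubgroup_pre hL hN hW) ?_ (pre_subset _ _ _),
      image_pre hL hN (hWY.trans hYS)⟩
    rintro _ ⟨s, hs, rfl⟩
    refine ⟨(h1 hs).2.2, ?_⟩
    rw [← cj_proj hL hN (h1 hs)]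
    exact hZW ⟨_, hs.2, rfl⟩
  S_mem := ⟨S, hL.S_mem, rfl⟩
  subset_S X hX := image_subset_S hL hN hX

lemma pre_mem_Omega {W : Set (G.Quotient N)}
    (hW : W ∈ (quot hL hN).Omega (proj hL hN '' S)) : pre hL hN W ∈ G.Omega S := by
  have h1 : G.star S (pre hL hN W) = pre hL hN W := by
    refine Set.Subset.antisymm (fun s hs => ?_) (subset_star _)
    have hsS := star_subset_S (pre_subset hL hN W) hs
    refine ⟨hsS, ?_⟩
    rw [← star_of_mem_Omega hW, mem_star]
    intro w hw
    rw [proj_mem_conjInto_iff hL hN hsS]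
    exact mem_star.1 hs _ fun t ht => (proj_mem_conjInto_iff hL hN ht.1 w).1 (hw ht.2)
  rw [← h1]
  exact hL.star_mem_Omega (pre_subset hL hN W)

lemma krullDim_Omega_quot :
    Order.krullDim ((quot hL hN).Omega (proj hL hN '' S)) < ⊤ := by
  refine (Order.krullDim_le_of_strictMono
    (fun W : (quot hL hN).Omega (proj hL hN '' S) =>
      (⟨pre hL hN W.1, pre_mem_Omega hL hN W.2⟩ : G.Omega S)) ?_).trans_lt hL.finite_dim
  intro V W hVW
  refine ⟨fun s hs => ⟨hs.1, hVW.le hs.2⟩, fun hle => hVW.not_ge ?_⟩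
  change W.1 ⊆ V.1
  rw [← image_pre hL hN (subset_of_mem_Omega W.2)]
  rintro _ ⟨s, hs, rfl⟩
  exact (hle hs).2

/-- Every subgroup of the quotient is the image of a subgroup. -/
lemma exists_isSubgroup_image {H : Set (G.Quotient N)} (hH : (quot hL hN).IsSubgroup H) :
    ∃ K, G.IsSubgroup K ∧ proj hL hN '' K = H := by
  have hhom := isHom_proj hL hN
  obtain ⟨P', hP', hHP⟩ := (isPreLocality_quot hL hN).exists_subset_nz
    (krullDim_Omega_quot hL hN) hH
  have hP := pre_mem hL hN hP'
  have hPs := isSubgroup_of_mem_image hL hN hP'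
  have hn := hL.nz_isSubgroup hP
  refine ⟨{h | h ∈ G.nz Δ (pre hL hN P') ∧ proj hL hN h ∈ H}, hn.of_subset (fun h hh => hh.1)
    ⟨hn.one_mem, ?_⟩ ?_ ?_, ?_⟩
  · rw [hhom.map_one]
    exact hH.one_mem
  · intro x hx
    refine ⟨hn.inv_mem x hx.1, ?_⟩
    rw [hhom.map_inv]
    exact hH.inv_mem _ hx.2
  · intro x hx y hy
    refine ⟨hn.mul_mem hx.1 hy.1, ?_⟩
    rw [(hhom.map_mul (hL.mul_mem_D hx.1 hy.1)).2]
    exact hH.mul_mem hx.2 hy.2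
  apply Set.Subset.antisymm
  · rintro _ ⟨x, hx, rfl⟩
    exact hx.2
  intro X hX
  -- It remains to see that the representative of X, which conjugates the preimage of P' into S,
  -- normalizes it.
  refine ⟨rep hL hN X, ⟨?_, by rwa [proj_rep]⟩, proj_rep hL hN X⟩
  have hXm := hHP hX
  have h1 : pre hL hN P' ⊆ G.sg S (rep hL hN X) := fun s hs =>
    (proj_mem_sg_iff hL hN hs.1 X).1 ((isPreLocality_quot hL hN).subset_sg hXm hs.2)
  have h2 := hL.mor hP h1
  have hTP := inter_subset_pre hL hN hPs
  have e : G.cj (rep hL hN X) '' pre hL hN P' = pre hL hN P' := by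
    apply Set.Subset.antisymm
    · rintro _ ⟨s, hs, rfl⟩
      refine ⟨(h1 hs).2.2, ?_⟩
      rw [← cj_proj hL hN (h1 hs)]
      exact Mor.image_mem hXm hs.2
    · intro y hy
      have hy' := hy.2
      rw [← Mor.img hXm, ← image_pre hL hN (image_subset_S hL hN hP')] at hy'
      obtain ⟨_, ⟨s, hs, rfl⟩, es⟩ := hy'
      rw [cj_proj hL hN (h1 hs)] at es
      -- y differs from the conjugate of s by an element of S ∩ N, and S ∩ N lies in the conjugate
      -- of the preimage because the inverse representative maps it into itself.
      refine mem_of_proj_eq hL hN hy.1 (h1 hs).2.2 es.symm (hL.isSubgroup _ h2.tgt) ?_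
        ⟨s, hs, rfl⟩
      intro t ht
      have hT := hTP.trans h1
      have hT' := inter_subset_sg_inv hL hN hT
      have h3 := sg_cj_inv (hT' ht)
      rw [G.inv_inv] at h3
      exact ⟨_, hTP (cj_mem_inter hN hT' ht), h3⟩
  rwa [e] at h2

lemma isLocallyFinite_quot {H : Set (G.Quotient N)} (hH : (quot hL hN).IsSubgroup H) :
    (quot hL hN).IsLocallyFinite H := by
  obtain ⟨K, hK, rfl⟩ := exists_isSubgroup_image hL hN hH
  intro F hF hFf
  obtain ⟨E, hEK, hEf, rfl⟩ := Set.exists_subset_image_finite_and.1 ⟨F, hF, hFf, rfl⟩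
  obtain ⟨A, hA, hAf, hEA, hAK⟩ := hL.locallyFinite K hK E hEK hEf
  exact ⟨_, (isHom_proj hL hN).isSubgroup_image hA, hAf.image _, Set.image_mono hEA,
    Set.image_mono hAK⟩

lemma isPSubgroup_quot : (quot hL hN).IsPSubgroup p (proj hL hN '' S) := by
  refine ⟨(isHom_proj hL hN).isSubgroup_image hL.isSubgroup_S, ?_⟩
  rintro _ ⟨x, hx, rfl⟩
  exact (isHom_proj hL hN).isPElem (hL.isPSubgroup.2 x hx)

/-- If the image of an element of finite order has order a power of `p`, then it is the image of a
`p`-element that is a power of the given one. -/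
lemma exists_isPElem_of_proj {K : Set L} (hK : G.IsSubgroup K) (hKf : K.Finite) {f : L}
    (hf : f ∈ K) {R : Set (G.Quotient N)} (hR : (quot hL hN).IsSubgroup R)
    (hfR : proj hL hN f ∈ R) (hp : (quot hL hN).IsPElem p (proj hL hN f)) :
    ∃ y ∈ K, G.IsPElem p y ∧ proj hL hN y = proj hL hN f := by
  have : Fact p.Prime := ⟨hL.prime⟩
  let _ := hK.group
  let _ := hR.group
  have : Finite K := hKf
  obtain ⟨j, hj⟩ := (hR.isPElem_iff p ⟨_, hfR⟩).1 hp
  obtain ⟨a, m, hm, ho⟩ := Nat.exists_eq_pow_mul_and_not_dvd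
    (orderOf_pos (⟨f, hf⟩ : K)).ne' p hL.prime.ne_one
  have hcop : Nat.Coprime (p ^ j) m := Nat.Coprime.pow_left j ((hL.prime.coprime_iff_not_dvd).2 hm)
  -- The order of f is p^a m and that of its image divides p^j. With n ≡ 0 mod m, f^n is a
  -- p-element; with n ≡ 1 mod p^j, its image is unchanged.
  obtain ⟨n, hn1, hn2⟩ := Nat.chineseRemainder hcop 1 0
  refine ⟨((⟨f, hf⟩ : K) ^ n : K), Subtype.coe_prop _, (hK.isPElem_iff p _).2 ⟨a, ?_⟩, ?_⟩
  · rw [← pow_mul, ← orderOf_dvd_iff_pow_eq_one, ho, mul_comm]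
    exact Nat.mul_dvd_mul_right ((Nat.modEq_zero_iff_dvd).1 hn2) _
  · rw [hK.coe_pow]
    have h1 := (isHom_proj hL hN).map_pr
      (hK.mem_D (List.replicate n f) (by simp +contextual [List.mem_replicate, hf]))
    rw [List.map_replicate] at h1
    refine h1.trans ?_
    rw [← hR.coe_pow ⟨_, hfR⟩ n]
    have h2 : (⟨_, hfR⟩ : R) ^ n = (⟨_, hfR⟩ : R) ^ 1 :=
      pow_eq_pow_iff_modEq.2 (hn1.of_dvd (orderOf_dvd_of_pow_eq_one hj))
    rw [h2, pow_one]

/-- If R were larger, normalizer growth would give b ∈ R outside the image of S and normalizing it.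
Its representative normalizes S, and a p-power-order power of that representative, still with image
b, lies in S: a contradiction. -/
lemma maximal_quot {R : Set (G.Quotient N)} (hR : (quot hL hN).IsPSubgroup p R)
    (hSR : proj hL hN '' S ⊆ R) : R = proj hL hN '' S := by
  have hPQ := isPreLocality_quot hL hN
  refine Set.Subset.antisymm ?_ hSR
  by_contra hne
  obtain ⟨b, hbR, hbS, hbg, hbe⟩ := hPQ.exists_normalizing (krullDim_Omega_quot hL hN) hL.prime
    subset_rfl star_S hR (isLocallyFinite_quot hL hN hR.1) hSR hne
  refine hbS ?_
  have h1 : S ⊆ G.sg S (rep hL hN b) := fun s hs =>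
    (proj_mem_sg_iff hL hN hs b).1 (hbg ⟨s, hs, rfl⟩)
  have h2 := hL.mor hL.S_mem h1
  have h3 := hL.image_star_eq hL.finite_dim h1 ((hL.subset_S _ h2.tgt).trans (subset_star S))
  rw [star_S] at h3
  rw [h3] at h2
  obtain ⟨K, hK, hKf, hfK, hKS⟩ := hL.locallyFinite _ (hL.nz_isSubgroup hL.S_mem)
    {rep hL hN b} (by rintro _ rfl; exact h2) (Set.finite_singleton _)
  have e := proj_rep hL hN b
  obtain ⟨y, hyK, hyp, hy⟩ := exists_isPElem_of_proj hL hN hK hKf (hfK rfl) hR.1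
    (by rwa [e]) (by rw [e]; exact hR.2 b hbR)
  rw [← e, ← hy]
  exact ⟨y, hL.mem_S_of_isPElem (hKS hyK) hyp, rfl⟩

theorem isLocality_quot :
    (quot hL hN).IsLocality p (Set.image (proj hL hN) '' Δ) (proj hL hN '' S) where
  toIsPreLocality := isPreLocality_quot hL hN
  prime := hL.prime
  finite_dim := krullDim_Omega_quot hL hN
  isPSubgroup := isPSubgroup_quot hL hN
  maximal := fun _ hR hSR => maximal_quot hL hN hR hSR
  countable := by
    intro H hH
    obtain ⟨K, hK, rfl⟩ := exists_isSubgroup_image hL hN hH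
    exact (hL.countable K hK).image _
  locallyFinite := fun _ hH => isLocallyFinite_quot hL hN hH

theorem isProjection_proj :
    G.IsProjection Δ (quot hL hN) (Set.image (proj hL hN) '' Δ) (proj hL hN) where
  isHom := isHom_proj hL hN
  map_D := (quot_D hL hN).symm
  map_objects := rfl

end QuotientLocality

end PartialGroup

theorem corollary5p5 {L : Type u} (p : ℕ) (G : PartialGroup L) (Δ : Set (Set L)) (S : Set L)
    (hL : G.IsLocality p Δ S) :
    (∀ N : Set L, G.IsPartialNormal N →
      ∃ ρ : L → G.Quotient N,
        -- each `g` lies in exactly one maximal coset, namely in `ρ g`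
        (∀ (g : L) (X : G.Quotient N), g ∈ X.1 ↔ X = ρ g) ∧
        ∃ Q : PartialGroup (G.Quotient N),
          -- the unique structure with domain the image of `D` for which `ρ` is a homomorphism
          (∀ Q' : PartialGroup (G.Quotient N),
            (Q'.D = List.map ρ '' G.D ∧ G.IsHom Q' ρ) ↔ Q' = Q) ∧
          Q.ker ρ = N ∧
          Q.IsLocality p (Set.image ρ '' Δ) (ρ '' S) ∧
          G.IsProjection Δ Q (Set.image ρ '' Δ) ρ) ∧
    -- partial normal subgroups are exactly the kernels of projections
    (∀ N : Set L, G.IsPartialNormal N ↔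
      ∃ (L' : Type u) (q : ℕ) (G' : PartialGroup L') (Δ' : Set (Set L')) (S' : Set L')
        (β : L → L'), G'.IsLocality q Δ' S' ∧ G.IsProjection Δ G' Δ' β ∧ G'.ker β = N) ∧
    -- the same for the kernels of projections to localities in any universe
    (∀ (L' : Type v) (q : ℕ) (G' : PartialGroup L') (Δ' : Set (Set L')) (S' : Set L')
      (β : L → L'), G'.IsLocality q Δ' S' → G.IsProjection Δ G' Δ' β →
        G.IsPartialNormal (G'.ker β)) := by
  refine ⟨fun N hN => ⟨PartialGroup.proj hL hN, PartialGroup.mem_iff_eq_proj hL hN, PartialGroup.quot hL hN, fun Q' => ?_,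
    PartialGroup.ker_proj hL hN, PartialGroup.isLocality_quot hL hN, PartialGroup.isProjection_proj hL hN⟩, fun N => ⟨fun hN => ?_, ?_⟩,
    fun L' q G' Δ' S' β _ hβ => hβ.isHom.isPartialNormal_ker⟩
  · constructor
    · rintro ⟨hD, h⟩
      exact PartialGroup.eq_of_isHom hD (PartialGroup.quot_D hL hN) h (PartialGroup.isHom_proj hL hN)
    · rintro rfl
      exact ⟨PartialGroup.quot_D hL hN, PartialGroup.isHom_proj hL hN⟩
  · exact ⟨_, p, PartialGroup.quot hL hN, _, _, PartialGroup.proj hL hN, PartialGroup.isLocality_quot hL hN, PartialGroup.isProjection_proj hL hN,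
      PartialGroup.ker_proj hL hN⟩
  · rintro ⟨L', q, G', Δ', S', β, -, hβ, rfl⟩
    exact hβ.isHom.isPartialNormal_ker
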